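/- Let $\mathcal D$ be a countably infinite alphabet of names and $\Sigma$ a finite alphabet of tags (either fixed, or given as part of the input; the statement holds in both cases). An $r$-register assignment is a function $\rho:[1,r]\to\mathcal D\uplus\{\#\}$, and $\operatorname{rng}(\rho)=\rho([1,r])\cap\mathcal D$. An $r$-fresh-register automaton ($r$-FRA) over a class $A$ of $r$-register assignments is a tuple $\langle Q,q_0,\rho_0,\delta,F\rangle$ with $Q$ a finite set of states, $q_0\in Q$, $F\subseteq Q$, $\rho_0\in A$ and a transition relation $\delta\subseteq Q\times\Sigma\times(\mathcal P([1,r])\cup\{\circledast\})\times[0,r]\times\mathcal P([1,r])\times Q$ with $i\notin Z$ for each transition $q\xrightarrow{t,X,i,Z}q'$. Its configurations are the triples $(q,\rho,H)$ with $q\in Q$, $\rho\in A$ and $H\subseteq\mathcal D$ finite with $\operatorname{rng}(\rho)\subseteq H$. There is a step $(q,\rho,H)\xrightarrow{(t,d)}(q',\rho',H')$ if there is a transition $q\xrightarrow{t,X,i,Z}q'$ in $\delta$ such that either $X=\{j\mid\rho(j)=d\}$, or $X=\circledast$ and $d\notin H$; and $\rho'(j)=d$ if $j=i$, $\rho'(j)=\#$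 if $j\in Z$, $\rho'(j)=\rho(j)$ otherwise; and $H'=H\cup\{d\}$. A register automaton (RA) is an FRA without $\circledast$-transitions; its configurations are the pairs $(q,\rho)$ with $q\in Q$ and $\rho\in A$, and its steps are defined in the same way without the history. For $X\in\{S,M\}$ and $Y\in\{F,\#_0,\#\}$, FRA($XY$) and RA($XY$) are the automata over the largest class $A$ obeying the following disciplines. Under $S$ every $\rho\in A$ is injective on non-empty registers, and each transition has $X=\circledast$ or $X\subseteq\{i\}$; $M$ imposes no restriction. Under $F$ no $\rho\in A$ takes the value $\#$; under $F$ and $\#_0$ each transition has $Z=\emptyset$ and $i\neq0$; $\#$ imposes no restriction. The problem $\sim$-FRA($XY$) is: given an FRA($XY$) and configurations $(q_1,\rho_1,H)$ and $(q_2,\rho_2,H)$ with the same history, are they bisimilar? The problem $\sim$-RA($XY$) is: given an RA($XY$) and configurations $(q_1,\rho_1)$ and $(q_2,\rho_2)$, are they bisimilar? Write $P_1\le P_2$ if there is a polynomial-time many-one reduction from $P_1$ to $P_2$. Then 1. $\sim$-RA($XY$) $\le$ $\sim$-FRA($XY$) for all $X\in\{S,M\}$ and $Y\in\{F,\#_0,\#\}$;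 2. $\sim$-RA($SF$) $\le$ $\sim$-RA($S\#_0$) $\le$ $\sim$-RA($S\#$) $\le$ $\sim$-RA($MF$) $\le$ $\sim$-RA($M\#_0$) $\le$ $\sim$-RA($M\#$); 3. $\sim$-FRA($SF$) $\le$ $\sim$-FRA($S\#_0$) $\le$ $\sim$-FRA($S\#$) $\le$ $\sim$-FRA($MF$) $\le$ $\sim$-FRA($M\#_0$) $\le$ $\sim$-FRA($M\#$). -/

import Mathlib

/-! ## Labelled transition systems and bisimilarity -/

/-- `R` is a bisimulation on the labelled transition system with configurations `C`, action labels
`Act`, and transition relations `step ℓ`. -/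
def IsBisimulation {Act C : Type} (step : Act → C → C → Prop) (R : C → C → Prop) : Prop :=
  ∀ c₁ c₂, R c₁ c₂ → ∀ l,
    (∀ c₁', step l c₁ c₁' → ∃ c₂', step l c₂ c₂' ∧ R c₁' c₂') ∧
    (∀ c₂', step l c₂ c₂' → ∃ c₁', step l c₁ c₁' ∧ R c₁' c₂')

/-- Two configurations are bisimilar if some bisimulation relates them. -/
def Bisimilar {Act C : Type} (step : Act → C → C → Prop) (c₁ c₂ : C) : Prop :=
  ∃ R : C → C → Prop, IsBisimulation step R ∧ R c₁ c₂

/-! ## Fresh-register automata -/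

/-- Register assignments; `none` is the symbol `#` (empty register). -/
abbrev RegAssignment (r : ℕ) (D : Type) : Type := Fin r → Option D

/-- The guard of a transition: `fresh` is `⊛`, and `exactly X` asks that the letter be stored in
exactly the registers in `X`. -/
inductive Guard (r : ℕ) : Type
  | fresh : Guard r
  | exactly (X : Finset (Fin r)) : Guard r

/-- A transition `q --(t, X, i, Z)--> q'`. The component `i ∈ [0, r]` is `target`, where `none` stands
for `0` (the letter is not stored). -/
structure RegTransition (Q T : Type) (r : ℕ) : Type where
  src : Q
  tag : T
  guard : Guard r
  target : Option (Fin r)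
  erase : Finset (Fin r)
  dst : Q
  target_notMem_erase : ∀ i, target = some i → i ∉ erase

/-- The assignment after `τ` has been taken on the letter `d`. -/
def RegTransition.update {Q T D : Type} {r : ℕ} (τ : RegTransition Q T r)
    (ρ : RegAssignment r D) (d : D) : RegAssignment r D :=
  fun j => if τ.target = some j then some d else if j ∈ τ.erase then none else ρ j

/-- An `r`-fresh-register automaton with states `Q`, tags `T` and names `D`, over the class `A` of
register assignments. -/
structure FRA (Q T D : Type) (r : ℕ) (A : Set (RegAssignment r D)) : Type where
  init : Q
  initReg : RegAssignment r D
  initReg_mem : initReg ∈ A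
  trans : Set (RegTransition Q T r)
  final : Set Q

namespace FRA

variable {Q T D : Type} {r : ℕ} {A : Set (RegAssignment r D)}

/-- A register automaton is a fresh-register automaton without `⊛`-transitions. -/
def IsRA (𝒜 : FRA Q T D r A) : Prop := ∀ τ ∈ 𝒜.trans, τ.guard ≠ Guard.fresh

/-- Configurations `(q, ρ, H)` of a fresh-register automaton. -/
structure Config (𝒜 : FRA Q T D r A) : Type where
  state : Q
  reg : RegAssignment r D
  hist : Finset D
  reg_mem : reg ∈ A
  range_subset : ∀ i d, reg i = some d → d ∈ hist

/-- The transition relation of the configuration graph of a fresh-register automaton. -/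
def Step [DecidableEq D] (𝒜 : FRA Q T D r A) (l : T × D) (κ₁ κ₂ : 𝒜.Config) : Prop :=
  ∃ τ ∈ 𝒜.trans, τ.src = κ₁.state ∧ τ.tag = l.1 ∧ τ.dst = κ₂.state ∧
    ((∃ X, τ.guard = Guard.exactly X ∧ ∀ j, j ∈ X ↔ κ₁.reg j = some l.2) ∨
      (τ.guard = Guard.fresh ∧ l.2 ∉ κ₁.hist)) ∧
    κ₂.reg = τ.update κ₁.reg l.2 ∧
    κ₂.hist = insert l.2 κ₁.hist

/-- Configurations `(q, ρ)` of a register automaton. -/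
structure RAConfig (𝒜 : FRA Q T D r A) : Type where
  state : Q
  reg : RegAssignment r D
  reg_mem : reg ∈ A

/-- The transition relation of the configuration graph of a register automaton. -/
def RAStep (𝒜 : FRA Q T D r A) (l : T × D) (κ₁ κ₂ : 𝒜.RAConfig) : Prop :=
  ∃ τ ∈ 𝒜.trans, τ.src = κ₁.state ∧ τ.tag = l.1 ∧ τ.dst = κ₂.state ∧
    (∃ X, τ.guard = Guard.exactly X ∧ ∀ j, j ∈ X ↔ κ₁.reg j = some l.2) ∧
    κ₂.reg = τ.update κ₁.reg l.2

end FRA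

/-! ## Register disciplines -/

/-- Single (`S`) or multiple (`M`) assignment. -/
inductive Storage : Type
  | S | M

/-- Registers are always filled (`F`), initially possibly empty (`#₀`, here `E0`), or erasable
during a run (`#`, here `E`). -/
inductive Emptiness : Type
  | F | E0 | E

/-- The largest class of `r`-register assignments that obeys the discipline `XY`. -/
def admissible (X : Storage) (Y : Emptiness) (r : ℕ) (D : Type) : Set (RegAssignment r D) :=
  {ρ | (X = Storage.S → ∀ i j, ρ i = ρ j → i = j ∨ (ρ i = none ∧ ρ j = none)) ∧
    (Y = Emptiness.F → ∀ i, ρ i ≠ none)}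

/-- The discipline `XY` on transitions: under `S` the guard is `⊛` or contained in `{i}` (hence empty
if `i = 0`); under `F` and `#₀` nothing is erased and `i ≠ 0`. -/
def RegTransition.Permitted {Q T : Type} {r : ℕ} (X : Storage) (Y : Emptiness)
    (τ : RegTransition Q T r) : Prop :=
  (X = Storage.S →
    τ.guard = Guard.fresh ∨ ∃ G, τ.guard = Guard.exactly G ∧ ∀ j ∈ G, τ.target = some j) ∧
  (Y ≠ Emptiness.E → τ.erase = ∅ ∧ τ.target ≠ none)

/-! ## Decision problems and polynomial-time many-one reductions -/

/-- A decision problem: instances with an injective encoding by words over a finite alphabet, and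
the set of yes-instances. -/
structure DecisionProblem : Type 1 where
  Inst : Type
  Sym : Type
  [symFintype : Fintype Sym]
  code : Inst → List Sym
  code_injective : Function.Injective code
  yes : Inst → Prop

/-- There is a polynomial-time many-one reduction from `P₁` to `P₂` (computed by a multi-stack
Turing machine). -/
def DecisionProblem.ReducesTo (P₁ P₂ : DecisionProblem) : Prop :=
  ∃ f : P₁.Inst → P₂.Inst,
    Nonempty (Turing.TM2ComputableInPolyTime P₁.code P₂.code f) ∧
      ∀ x, P₁.yes x ↔ P₂.yes (f x)

/-! ## Instances: finite descriptions of automata -/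

/-- A finite description of an automaton: the sizes of the tag alphabet and of the state set, the
number of registers, and the components of the automaton, with names taken from `ℕ` and the
transition relation given as a list. -/
structure AutDesc : Type where
  tags : ℕ
  states : ℕ
  regs : ℕ
  init : Fin states
  initReg : RegAssignment regs ℕ
  final : Finset (Fin states)
  trans : List (RegTransition (Fin states) (Fin tags) regs)

/-- The automaton with a given description. -/
def AutDesc.toFRA (a : AutDesc) {A : Set (RegAssignment a.regs ℕ)} (h : a.initReg ∈ A) :
    FRA (Fin a.states) (Fin a.tags) ℕ a.regs A where
  init := a.init
  initReg := a.initReg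
  initReg_mem := h
  trans := {τ | τ ∈ a.trans}
  final := {q | q ∈ a.final}

/-- Common part of the instances of the problems: an FRA(`XY`) and two pairs of a state and an
assignment. The tag alphabet is part of the instance if `k = none`, and has the fixed size `s`
if `k = some s`. -/
structure BisimInput (k : Option ℕ) (X : Storage) (Y : Emptiness) : Type where
  aut : AutDesc
  tags_eq : ∀ s, k = some s → aut.tags = s
  initReg_mem : aut.initReg ∈ admissible X Y aut.regs ℕ
  permitted : ∀ τ ∈ aut.trans, τ.Permitted X Y
  q₁ : Fin aut.states
  ρ₁ : RegAssignment aut.regs ℕ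
  q₂ : Fin aut.states
  ρ₂ : RegAssignment aut.regs ℕ
  ρ₁_mem : ρ₁ ∈ admissible X Y aut.regs ℕ
  ρ₂_mem : ρ₂ ∈ admissible X Y aut.regs ℕ

/-- The automaton of an instance. -/
def BisimInput.toFRA {k : Option ℕ} {X : Storage} {Y : Emptiness} (x : BisimInput k X Y) :
    FRA (Fin x.aut.states) (Fin x.aut.tags) ℕ x.aut.regs (admissible X Y x.aut.regs ℕ) :=
  x.aut.toFRA x.initReg_mem

/-- Instances of the bisimilarity problem for RA(`XY`). -/
structure RAInput (k : Option ℕ) (X : Storage) (Y : Emptiness) : Type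
    extends BisimInput k X Y where
  isRA : toBisimInput.toFRA.IsRA

/-- Instances of the bisimilarity problem for FRA(`XY`): both configurations have the same history
`H`, given as a list. -/
structure FRAInput (k : Option ℕ) (X : Storage) (Y : Emptiness) : Type
    extends BisimInput k X Y where
  hist : List ℕ
  range₁_subset : ∀ i d, ρ₁ i = some d → d ∈ hist
  range₂_subset : ∀ i d, ρ₂ i = some d → d ∈ hist

/-- The two configurations `(q₁, ρ₁)` and `(q₂, ρ₂)` are bisimilar. -/
def RAInput.Yes {k : Option ℕ} {X : Storage} {Y : Emptiness} (x : RAInput k X Y) : Prop :=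
  Bisimilar x.toFRA.RAStep ⟨x.q₁, x.ρ₁, x.ρ₁_mem⟩ ⟨x.q₂, x.ρ₂, x.ρ₂_mem⟩

/-- The two configurations `(q₁, ρ₁, H)` and `(q₂, ρ₂, H)` are bisimilar. -/
def FRAInput.Yes {k : Option ℕ} {X : Storage} {Y : Emptiness} (x : FRAInput k X Y) : Prop :=
  Bisimilar x.toFRA.Step
    ⟨x.q₁, x.ρ₁, x.hist.toFinset, x.ρ₁_mem,
      fun i d h => List.mem_toFinset.2 (x.range₁_subset i d h)⟩
    ⟨x.q₂, x.ρ₂, x.hist.toFinset, x.ρ₂_mem,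
      fun i d h => List.mem_toFinset.2 (x.range₂_subset i d h)⟩

/-! ## Encoding of instances by words

Cardinalities and indices are written in unary (states, tags and registers are listed explicitly in
an automaton), sets of states or registers as bit vectors, and names in binary. -/

/-- The alphabet of the encodings. -/
inductive CodeSym : Type
  | zero | one | hash | star | sep
  deriving DecidableEq

instance : Fintype CodeSym :=
  ⟨{CodeSym.zero, CodeSym.one, CodeSym.hash, CodeSym.star, CodeSym.sep},
    fun x => by cases x <;> simp⟩

namespace Code

open CodeSym

/-- Unary notation. -/
def idx (n : ℕ) : List CodeSym := List.replicate n one ++ [sep]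

/-- Binary notation, least significant bit first. -/
def name (d : ℕ) : List CodeSym :=
  (Computability.encodeNat d).map (fun b => if b then one else zero) ++ [sep]

/-- Contents of a register. -/
def content : Option ℕ → List CodeSym
  | none => [hash]
  | some d => name d

/-- Register assignments, register by register. -/
def assignment {r : ℕ} (ρ : RegAssignment r ℕ) : List CodeSym := (List.ofFn ρ).flatMap content

/-- Bit vectors. -/
def subset {n : ℕ} (X : Finset (Fin n)) : List CodeSym :=
  List.ofFn (fun i => if i ∈ X then one else zero) ++ [sep]

/-- Guards. -/
def guard {r : ℕ} : Guard r → List CodeSym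
  | Guard.fresh => [star]
  | Guard.exactly X => subset X

/-- The number in `[0, r]` that names a register or `0`. -/
def target {r : ℕ} : Option (Fin r) → List CodeSym
  | none => idx 0
  | some i => idx (i.val + 1)

/-- Lists. -/
def list {α : Type} (c : α → List CodeSym) (l : List α) : List CodeSym :=
  l.flatMap (fun x => hash :: c x) ++ [sep]

/-- Transitions. -/
def transition {n s r : ℕ} (τ : RegTransition (Fin n) (Fin s) r) : List CodeSym :=
  idx τ.src.val ++ (idx τ.tag.val ++ (guard τ.guard ++ (target τ.target ++
    (subset τ.erase ++ idx τ.dst.val))))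

/-- Automata. -/
def aut (a : AutDesc) : List CodeSym :=
  idx a.tags ++ (idx a.states ++ (idx a.regs ++ (idx a.init.val ++ (assignment a.initReg ++
    (subset a.final ++ list transition a.trans)))))

/-- Common part of the instances. -/
def bisimInput {k : Option ℕ} {X : Storage} {Y : Emptiness} (x : BisimInput k X Y) :
    List CodeSym :=
  aut x.aut ++ (idx x.q₁.val ++ (assignment x.ρ₁ ++ (idx x.q₂.val ++ assignment x.ρ₂)))

/-- Instances for register automata. -/
def raInput {k : Option ℕ} {X : Storage} {Y : Emptiness} (x : RAInput k X Y) : List CodeSym :=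
  bisimInput x.toBisimInput

/-- Instances for fresh-register automata. -/
def fraInput {k : Option ℕ} {X : Storage} {Y : Emptiness} (x : FRAInput k X Y) : List CodeSym :=
  bisimInput x.toBisimInput ++ list name x.hist

/-! ### The encodings are injective -/

/-- Unique readability of a code in front of any other word. -/
def Readable {α : Type} (c : α → List CodeSym) : Prop :=
  ∀ a b u v, c a ++ u = c b ++ v → a = b ∧ u = v

theorem readable_idx : Readable idx := by
  intro a
  induction a with
  | zero =>
    intro b u v h
    cases b with
    | zero => simpa [idx] using h
    | succ b => simp [idx, List.replicate_succ] at h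
  | succ a ih =>
    intro b u v h
    cases b with
    | zero => simp [idx, List.replicate_succ] at h
    | succ b =>
      have := ih b u v (by simpa [idx, List.replicate_succ] using h)
      exact ⟨by rw [this.1], this.2⟩

theorem readable_bits : ∀ (a b : List Bool) (u v : List CodeSym),
    (a.map (fun b => if b then one else zero) ++ [sep]) ++ u =
      (b.map (fun b => if b then one else zero) ++ [sep]) ++ v → a = b ∧ u = v := by
  intro a
  induction a with
  | nil =>
    intro b u v h
    cases b with
    | nil => simpa using h
    | cons y b => cases y <;> simp at h
  | cons x a ih =>
    intro b u v h
    cases b with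
    | nil => cases x <;> simp at h
    | cons y b =>
      cases x <;> cases y <;> simp at h <;>
      · have := ih b u v (by simpa using h)
        exact ⟨by rw [this.1], this.2⟩

theorem readable_name : Readable name := by
  intro a b u v h
  obtain ⟨h1, h2⟩ := readable_bits _ _ u v h
  refine ⟨?_, h2⟩
  rw [← Computability.decode_encodeNat a, h1, Computability.decode_encodeNat]

theorem name_ne_hash (d : ℕ) (u v : List CodeSym) : name d ++ u ≠ hash :: v := by
  unfold name
  cases Computability.encodeNat d with
  | nil => simp
  | cons b l => cases b <;> simp

theorem readable_content : Readable content := by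
  intro a b u v h
  cases a with
  | none =>
    cases b with
    | none => simpa [content] using h
    | some b => exact absurd h.symm (name_ne_hash _ _ _)
  | some a =>
    cases b with
    | none => exact absurd h (name_ne_hash _ _ _)
    | some b =>
      have := readable_name a b u v h
      exact ⟨by rw [this.1], this.2⟩

theorem readable_flatMap {α : Type} {c : α → List CodeSym} (hc : Readable c) :
    ∀ (a b : List α) (u v : List CodeSym), a.length = b.length →
      a.flatMap c ++ u = b.flatMap c ++ v → a = b ∧ u = v := by
  intro a
  induction a with
  | nil =>
    intro b u v hl h
    cases b with
    | nil => simpa using h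
    | cons y b => simp at hl
  | cons x a ih =>
    intro b u v hl h
    cases b with
    | nil => simp at hl
    | cons y b =>
      obtain ⟨h1, h2⟩ := hc x y _ _ (by simpa using h)
      obtain ⟨h3, h4⟩ := ih b u v (by simpa using hl) h2
      exact ⟨by rw [h1, h3], h4⟩

theorem readable_assignment {r : ℕ} : Readable (assignment (r := r)) := by
  intro a b u v h
  obtain ⟨h1, h2⟩ := readable_flatMap readable_content _ _ u v (by simp) h
  exact ⟨List.ofFn_injective h1, h2⟩

theorem readable_subset {n : ℕ} : Readable (subset (n := n)) := by
  intro a b u v h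
  have h' := List.append_inj h (by simp [subset])
  refine ⟨?_, h'.2⟩
  have h1 := List.ofFn_injective (List.append_inj_left' h'.1 rfl)
  ext i
  have h2 := congrFun h1 i
  by_cases ha : i ∈ a <;> by_cases hb : i ∈ b <;> simp_all

theorem subset_ne_star {n : ℕ} (X : Finset (Fin n)) (u v : List CodeSym) :
    subset X ++ u ≠ star :: v := by
  unfold subset
  cases n with
  | zero => simp
  | succ n =>
    rw [List.ofFn_succ]
    by_cases h : (0 : Fin (n + 1)) ∈ X <;> simp [h]

theorem readable_guard {r : ℕ} : Readable (guard (r := r)) := by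
  intro a b u v h
  cases a with
  | fresh =>
    cases b with
    | fresh => simpa [guard] using h
    | exactly b => exact absurd h.symm (subset_ne_star _ _ _)
  | exactly a =>
    cases b with
    | fresh => exact absurd h (subset_ne_star _ _ _)
    | exactly b =>
      have := readable_subset a b u v h
      exact ⟨by rw [this.1], this.2⟩

theorem readable_target {r : ℕ} : Readable (target (r := r)) := by
  intro a b u v h
  cases a <;> cases b <;> obtain ⟨h1, h2⟩ := readable_idx _ _ u v h
  · exact ⟨rfl, h2⟩
  · omega
  · omega
  · exact ⟨by rw [Fin.ext (Nat.succ_injective h1)], h2⟩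

theorem readable_list {α : Type} {c : α → List CodeSym} (hc : Readable c) :
    Readable (list c) := by
  intro a
  induction a with
  | nil =>
    intro b u v h
    cases b with
    | nil => simpa [list] using h
    | cons y b => simp [list] at h
  | cons x a ih =>
    intro b u v h
    cases b with
    | nil => simp [list] at h
    | cons y b =>
      obtain ⟨h1, h2⟩ := hc x y (list c a ++ u) (list c b ++ v) (by simpa [list] using h)
      obtain ⟨h3, h4⟩ := ih b u v h2
      exact ⟨by rw [h1, h3], h4⟩

theorem readable_transition {n s r : ℕ} :
    Readable (transition (n := n) (s := s) (r := r)) := by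
  rintro ⟨a1, a2, a3, a4, a5, a6, _⟩ ⟨b1, b2, b3, b4, b5, b6, _⟩ u v h
  simp only [transition, List.append_assoc] at h
  obtain ⟨h1, e1⟩ := readable_idx _ _ _ _ h
  obtain ⟨h2, e2⟩ := readable_idx _ _ _ _ e1
  obtain ⟨h3, e3⟩ := readable_guard _ _ _ _ e2
  obtain ⟨h4, e4⟩ := readable_target _ _ _ _ e3
  obtain ⟨h5, e5⟩ := readable_subset _ _ _ _ e4
  obtain ⟨h6, e6⟩ := readable_idx _ _ _ _ e5
  obtain rfl := Fin.ext h1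
  obtain rfl := Fin.ext h2
  obtain rfl := Fin.ext h6
  subst h3 h4 h5
  exact ⟨rfl, e6⟩

theorem readable_aut : Readable aut := by
  rintro ⟨a1, a2, a3, a4, a5, a6, a7⟩ ⟨b1, b2, b3, b4, b5, b6, b7⟩ u v h
  simp only [aut, List.append_assoc] at h
  obtain ⟨rfl, e1⟩ := readable_idx _ _ _ _ h
  obtain ⟨rfl, e2⟩ := readable_idx _ _ _ _ e1
  obtain ⟨rfl, e3⟩ := readable_idx _ _ _ _ e2
  obtain ⟨h4, e4⟩ := readable_idx _ _ _ _ e3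
  obtain ⟨rfl, e5⟩ := readable_assignment _ _ _ _ e4
  obtain ⟨rfl, e6⟩ := readable_subset _ _ _ _ e5
  obtain ⟨rfl, e7⟩ := readable_list readable_transition _ _ _ _ e6
  obtain rfl := Fin.ext h4
  exact ⟨rfl, e7⟩

theorem readable_bisimInput {k : Option ℕ} {X : Storage} {Y : Emptiness} :
    Readable (bisimInput (k := k) (X := X) (Y := Y)) := by
  rintro ⟨a, _, _, _, a1, a2, a3, a4, _, _⟩ ⟨b, _, _, _, b1, b2, b3, b4, _, _⟩ u v h
  simp only [bisimInput, List.append_assoc] at h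
  obtain ⟨rfl, e1⟩ := readable_aut _ _ _ _ h
  obtain ⟨h1, e2⟩ := readable_idx _ _ _ _ e1
  obtain ⟨rfl, e3⟩ := readable_assignment _ _ _ _ e2
  obtain ⟨h3, e4⟩ := readable_idx _ _ _ _ e3
  obtain ⟨rfl, e5⟩ := readable_assignment _ _ _ _ e4
  obtain rfl := Fin.ext h1
  obtain rfl := Fin.ext h3
  exact ⟨rfl, e5⟩

theorem raInput_injective {k : Option ℕ} {X : Storage} {Y : Emptiness} :
    Function.Injective (raInput (k := k) (X := X) (Y := Y)) := by
  rintro ⟨a, _⟩ ⟨b, _⟩ h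
  obtain ⟨rfl, -⟩ := readable_bisimInput a b [] [] (by simpa [raInput] using h)
  rfl

theorem fraInput_injective {k : Option ℕ} {X : Storage} {Y : Emptiness} :
    Function.Injective (fraInput (k := k) (X := X) (Y := Y)) := by
  rintro ⟨a, a', _, _⟩ ⟨b, b', _, _⟩ h
  obtain ⟨rfl, h⟩ := readable_bisimInput a b _ _ h
  obtain ⟨rfl, -⟩ := readable_list readable_name a' b' [] [] (by simpa using h)
  rfl

end Code

/-! ## The bisimilarity problems -/

/-- The bisimilarity problem for RA(`XY`). -/
def raBisim (k : Option ℕ) (X : Storage) (Y : Emptiness) : DecisionProblem where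
  Inst := RAInput k X Y
  Sym := CodeSym
  code := Code.raInput
  code_injective := Code.raInput_injective
  yes := RAInput.Yes

/-- The bisimilarity problem for FRA(`XY`). -/
def fraBisim (k : Option ℕ) (X : Storage) (Y : Emptiness) : DecisionProblem where
  Inst := FRAInput k X Y
  Sym := CodeSym
  code := Code.fraInput
  code_injective := Code.fraInput_injective
  yes := FRAInput.Yes

/-! Each reduction needs an equivalence between yes-instances and a polynomial-time machine; the two
are proved separately.

From RA to FRA the automaton stays as it is, and the names in the two assignments form the common
history. Without `⊛` the history is never consulted, so forgetting it is a functional bisimulation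
(`FRA.bisimilar_toRA`). From `F` to `#₀` to `#` the whole instance stays as it is: the class of
assignments may grow, but no permitted transition leaves the old class (`FRA.bisimilar_cast`,
`FRA.bisimilar_castRA`).

The substantial step leads from `S#` to `MF`. Where registers are always filled, emptiness is
expressed by multiplicity: register `j` becomes two cells, the second always holding the dummy name
`j`, the first holding the same dummy exactly when the register is empty. An auxiliary register
receives the letters that are not to be stored. Since a transition can only write the letter just
read, each simulated transition is followed by a sweep that reads the dummies in order and writes
dummy `j` either to the first cell of `j`, which empties the register, or to the second, which
changes nothing. The sweep is deterministic and its labels depend only on the tag of the simulated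
transition, so it reveals nothing to an observer; `bisimilar_iff_of_encoding` turns this into
preservation and reflection of bisimilarity.

Names are kept apart from dummies by an injective renaming. A letter read by the simulating
automaton may lie outside the range of a given renaming, so the bisimulation lets the renaming vary
outside the names seen so far (`Filling.exists_renaming`). The discipline `S` enters through
`Filling.update_mem_admissible`: the target class is larger, and a simulated step must still end in
an admissible assignment.

For the running time, a small imperative language with exact step counts is compiled to multi-stack
machines, and the translations are written in it as passes over the code with unary counters. The
names `2 * d + 1` and `2 ^ (j + 1)` are chosen because their binary codes are easy to produce: a
prepended bit, and a row of zeros followed by a one. -/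

/-! ## A structured language for multi-stack machines -/

/-- Structured programs over stacks indexed by `K` with alphabet `Γ`. `pop k f` pops the stack `k` and
continues according to the result; `loop k exits body` pops the stack `k` and runs the body on the
popped symbol until the stack is empty or a stopping symbol has been popped. -/
inductive StackProg (K Γ : Type) : Type
  | skip : StackProg K Γ
  | push (k : K) (a : Γ) : StackProg K Γ
  | seq (p q : StackProg K Γ) : StackProg K Γ
  | pop (k : K) (f : Option Γ → StackProg K Γ) : StackProg K Γ
  | loop (k : K) (exits : Γ → Bool) (body : Γ → StackProg K Γ) : StackProg K Γ

namespace StackProg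

variable {K Γ : Type}

/-- `Runs p S S' n`: from the stacks `S`, the program `p` terminates with the stacks `S'` after `n`
primitive steps. -/
inductive Runs [DecidableEq K] :
    StackProg K Γ → (K → List Γ) → (K → List Γ) → ℕ → Prop
  | skip (S) : Runs skip S S 0
  | push (k a S) : Runs (push k a) S (Function.update S k (a :: S k)) 1
  | seq {p q S S' S'' m n} : Runs p S S' m → Runs q S' S'' n → Runs (seq p q) S S'' (m + n)
  | pop {k f S S' n} : Runs (f (S k).head?) (Function.update S k (S k).tail) S' n →
      Runs (pop k f) S S' (n + 1)
  | loop_nil {k exits body S} : S k = [] → Runs (loop k exits body) S S 1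
  | loop_exit {k exits body S a w} : S k = a :: w → exits a = true →
      Runs (loop k exits body) S (Function.update S k w) 1
  | loop_step {k exits body S S' S'' a w m n} : S k = a :: w → exits a = false →
      Runs (body a) (Function.update S k w) S' m → Runs (loop k exits body) S' S'' n →
      Runs (loop k exits body) S S'' (m + n + 1)

/-! ### Compilation of structured programs to multi-stack machines. -/

/-- Control points of a program. -/
def Point : StackProg K Γ → Type
  | skip => Empty
  | push _ _ => Unit
  | seq p q => Point p ⊕ Point q
  | pop _ f => Unit ⊕ (Σ o, Point (f o))
  | loop _ _ body => Unit ⊕ (Σ a, Point (body a))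

theorem finite_point [Finite Γ] : ∀ p : StackProg K Γ, Finite (Point p)
  | skip => inferInstanceAs (Finite Empty)
  | push _ _ => inferInstanceAs (Finite Unit)
  | seq p q =>
    have := finite_point p
    have := finite_point q
    inferInstanceAs (Finite (Point p ⊕ Point q))
  | pop _ f =>
    have := fun o => finite_point (f o)
    inferInstanceAs (Finite (Unit ⊕ (Σ o, Point (f o))))
  | loop _ _ body =>
    have := fun a => finite_point (body a)
    inferInstanceAs (Finite (Unit ⊕ (Σ a, Point (body a))))

/-- The label at which a program starts, if its control points are placed by `e` and control passes
to the label `x` in the end. -/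
def entry {L : Type} : (p : StackProg K Γ) → (Point p → L) → L → L
  | skip, _, x => x
  | push _ _, e, _ => e ()
  | seq p q, e, x => entry p (fun y => e (Sum.inl y)) (entry q (fun y => e (Sum.inr y)) x)
  | pop _ _, e, _ => e (Sum.inl ())
  | loop _ _ _, e, _ => e (Sum.inl ())

/-- The label to which a loop passes control after popping. -/
def loopTarget {L : Type} (exits : Γ → Bool) (body : Γ → L) (x : L) : Option Γ → L
  | none => x
  | some a => if exits a then x else body a

/-- The statement at a control point. -/
def stmt {L : Type} : (p : StackProg K Γ) → (Point p → L) → L → Point p →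
    Turing.TM2.Stmt (fun _ : K => Γ) L (Option Γ)
  | skip, _, _ => Empty.elim
  | push k a, _, x => fun _ => .push k (fun _ => a) (.goto fun _ => x)
  | seq p q, e, x => Sum.elim
      (stmt p (fun y => e (Sum.inl y)) (entry q (fun y => e (Sum.inr y)) x))
      (stmt q (fun y => e (Sum.inr y)) x)
  | pop k f, e, x => Sum.elim
      (fun _ => .pop k (fun _ o => o)
        (.goto fun o => entry (f o) (fun y => e (Sum.inr ⟨o, y⟩)) x))
      (fun y => stmt (f y.1) (fun z => e (Sum.inr ⟨y.1, z⟩)) x y.2)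
  | loop k exits body, e, x => Sum.elim
      (fun _ => .pop k (fun _ o => o) (.goto
        (loopTarget exits (fun a => entry (body a) (fun y => e (Sum.inr ⟨a, y⟩)) (e (Sum.inl ()))) x)))
      (fun y => stmt (body y.1) (fun z => e (Sum.inr ⟨y.1, z⟩)) (e (Sum.inl ())) y.2)

section

variable [DecidableEq K]

/-- `n`-fold iteration of a partial step function. -/
theorem iterate_bind_add {σ : Type} (f : σ → Option σ) {a b : σ} {c : Option σ} {m n : ℕ}
    (h₁ : (flip bind f)^[m] (some a) = some b) (h₂ : (flip bind f)^[n] (some b) = c) :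
    (flip bind f)^[m + n] (some a) = c := by
  rw [Nat.add_comm, Function.iterate_add_apply, h₁, h₂]

/-- Every primitive step is one machine step, so the counts agree exactly. The placement `e` and the
exit label `x` are universally quantified because a subprogram sits inside a larger machine with its
own exit. The final internal state is only asserted to exist, since it remembers the last popped
symbol. -/
theorem Runs.iterate_step {L : Type} (M : L → Turing.TM2.Stmt (fun _ : K => Γ) L (Option Γ))
    {p : StackProg K Γ} {S S' : K → List Γ} {n : ℕ} (h : Runs p S S' n) :
    ∀ (e : Point p → L) (x : L), (∀ y, M (e y) = stmt p e x y) → ∀ v, ∃ v',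
      (flip bind (Turing.TM2.step M))^[n] (some ⟨some (entry p e x), v, S⟩) =
        some ⟨some x, v', S'⟩ := by
  induction h with
  | skip S => exact fun e x _ v => ⟨v, rfl⟩
  | push k a S =>
    intro e x hM v
    refine ⟨v, ?_⟩
    have : M (e ()) = _ := hM ()
    simp [flip, entry, stmt, this]
  | seq _ _ ih₁ ih₂ =>
    intro e x hM v
    obtain ⟨v₁, h₁⟩ := ih₁ _ _ (fun y => hM (Sum.inl y)) v
    obtain ⟨v₂, h₂⟩ := ih₂ _ _ (fun y => hM (Sum.inr y)) v₁
    exact ⟨v₂, iterate_bind_add _ h₁ h₂⟩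
  | @pop k f S S' n _ ih =>
    intro e x hM v
    obtain ⟨v', h'⟩ := ih (fun y => e (Sum.inr ⟨_, y⟩)) x (fun y => hM (Sum.inr ⟨_, y⟩)) (S k).head?
    refine ⟨v', ?_⟩
    rw [Nat.add_comm]
    refine iterate_bind_add _ (m := 1) ?_ h'
    have : M (e (Sum.inl ())) = _ := hM (Sum.inl ())
    simp [flip, entry, stmt, this]
  | @loop_nil k exits body S hS =>
    intro e x hM v
    refine ⟨none, ?_⟩
    have : M (e (Sum.inl ())) = _ := hM (Sum.inl ())
    have hu : Function.update S k [] = S := by rw [← hS, Function.update_eq_self]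
    simp [flip, entry, stmt, this, hS, loopTarget, hu]
  | @loop_exit k exits body S a w hS ha =>
    intro e x hM v
    refine ⟨some a, ?_⟩
    have : M (e (Sum.inl ())) = _ := hM (Sum.inl ())
    simp [flip, entry, stmt, this, hS, loopTarget, ha]
  | @loop_step k exits body S S' S'' a w m n hS ha _ _ ih₁ ih₂ =>
    intro e x hM v
    obtain ⟨v₁, h₁⟩ := ih₁ (fun y => e (Sum.inr ⟨_, y⟩)) (e (Sum.inl ()))
      (fun y => hM (Sum.inr ⟨_, y⟩)) (some a)
    obtain ⟨v₂, h₂⟩ := ih₂ e x hM v₁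
    refine ⟨v₂, ?_⟩
    rw [Nat.add_comm]
    refine iterate_bind_add _ (m := 1) ?_ (iterate_bind_add _ h₁ h₂)
    have : M (e (Sum.inl ())) = _ := hM (Sum.inl ())
    simp [flip, entry, stmt, this, hS, loopTarget, ha]

end

/-- The machine of a program. -/
noncomputable def machine [DecidableEq K] [Fintype K] [Fintype Γ] (p : StackProg K Γ) (k₀ k₁ : K) :
    Turing.FinTM2 :=
  letI := finite_point p
  letI : Fintype (Point p) := Fintype.ofFinite _
  { K := K
    k₀ := k₀
    k₁ := k₁
    Γ := fun _ => Γ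
    Λ := Option (Point p)
    main := entry p some none
    σ := Option Γ
    initialState := none
    -- The exit label `none` resets the internal state, because the halting configuration required
    -- of the machine carries the initial one.
    m := fun l => l.elim (.load (fun _ => none) .halt) (stmt p some none) }

theorem initList_machine [DecidableEq K] [Fintype K] [Fintype Γ] (p : StackProg K Γ) (k₀ k₁ : K)
    (w : List Γ) : Turing.initList (machine p k₀ k₁) w =
      (⟨some (entry p some none), none, Function.update (fun _ => []) k₀ w⟩ :
        Turing.TM2.Cfg (fun _ : K => Γ) (Option (Point p)) (Option Γ)) := by
  unfold Turing.initList
  congr 1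
  funext k
  change K at k
  by_cases hk : k = k₀
  · exact (dif_pos hk).trans
      (show w = Function.update (fun _ => []) k₀ w k by rw [hk, Function.update_self])
  · exact (dif_neg hk).trans
      (show [] = Function.update (fun _ => []) k₀ w k by rw [Function.update_of_ne hk])

theorem haltList_machine [DecidableEq K] [Fintype K] [Fintype Γ] (p : StackProg K Γ) (k₀ k₁ : K)
    (w : List Γ) : Turing.haltList (machine p k₀ k₁) w =
      (⟨none, none, Function.update (fun _ => []) k₁ w⟩ :
        Turing.TM2.Cfg (fun _ : K => Γ) (Option (Point p)) (Option Γ)) := by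
  unfold Turing.haltList
  congr 1
  funext k
  change K at k
  by_cases hk : k = k₁
  · exact (dif_pos hk).trans
      (show w = Function.update (fun _ => []) k₁ w k by rw [hk, Function.update_self])
  · exact (dif_neg hk).trans
      (show [] = Function.update (fun _ => []) k₁ w k by rw [Function.update_of_ne hk])

/-- A function is computable in polynomial time if a structured program computes it in polynomial
time. -/
theorem computableInPolyTime [DecidableEq K] [Fintype K] [Fintype Γ] {α β : Type}
    {ea : α → List Γ} {eb : β → List Γ} {f : α → β} (p : StackProg K Γ) (k₀ k₁ : K)
    (P : Polynomial ℕ)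
    (h : ∀ a, ∃ n ≤ P.eval (ea a).length,
      Runs p (Function.update (fun _ => []) k₀ (ea a)) (Function.update (fun _ => []) k₁ (eb (f a))) n) :
    Nonempty (Turing.TM2ComputableInPolyTime ea eb f) := by
  choose n hn hr using h
  -- The additional step in `P + 1` and `n a + 1` executes the statement at the exit label.
  refine ⟨⟨⟨machine p k₀ k₁, Equiv.refl Γ, Equiv.refl Γ⟩, P + 1, fun a => ⟨⟨n a + 1, ?_⟩, ?_⟩⟩⟩
  · obtain ⟨v, hv⟩ := (hr a).iterate_step (L := Option (Point p)) (machine p k₀ k₁).m some none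
      (fun _ => rfl) none
    have hi := (congrArg (Turing.initList (machine p k₀ k₁)) (List.map_id (ea a))).trans
      (initList_machine p k₀ k₁ (ea a))
    have hh := (congrArg (Turing.haltList (machine p k₀ k₁)) (List.map_id (eb (f a)))).trans
      (haltList_machine p k₀ k₁ (eb (f a)))
    refine (congrArg (fun c => (flip bind (machine p k₀ k₁).step)^[n a + 1] (some c)) hi).trans
      (Eq.trans ?_ (congrArg some hh.symm))
    exact iterate_bind_add _ hv rfl
  · simpa using hn a

end StackProg

/-! ## Programs that transduce words -/

/-- Unary counters. -/
inductive Counter : Type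
  | rest | done | tag | dst | states | extra | tags | tmp
  deriving DecidableEq

instance : Fintype Counter :=
  ⟨{.rest, .done, .tag, .dst, .states, .extra, .tags, .tmp}, fun x => by cases x <;> simp⟩

/-- The stacks of the machines below: the unread input, two output stacks (last symbol on top), the
final result, and unary counters. -/
inductive Stk : Type
  | inp | out | buf | fin | ctr (x : Counter)
  deriving DecidableEq, Fintype

/-- Values of the counters. -/
structure Env : Type where
  rest : ℕ := 0
  done : ℕ := 0
  tag : ℕ := 0
  dst : ℕ := 0
  states : ℕ := 0
  extra : ℕ := 0
  tags : ℕ := 0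
  tmp : ℕ := 0

namespace Env

def get (e : Env) : Counter → ℕ
  | .rest => e.rest
  | .done => e.done
  | .tag => e.tag
  | .dst => e.dst
  | .states => e.states
  | .extra => e.extra
  | .tags => e.tags
  | .tmp => e.tmp

def set (e : Env) (x : Counter) (n : ℕ) : Env :=
  match x with
  | .rest => { e with rest := n }
  | .done => { e with done := n }
  | .tag => { e with tag := n }
  | .dst => { e with dst := n }
  | .states => { e with states := n }
  | .extra => { e with extra := n }
  | .tags => { e with tags := n }
  | .tmp => { e with tmp := n }

@[simp] theorem get_set_self (e : Env) (x : Counter) (n : ℕ) : (e.set x n).get x = n := by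
  cases x <;> rfl

theorem get_set_of_ne (e : Env) {x y : Counter} (h : y ≠ x) (n : ℕ) :
    (e.set x n).get y = e.get y := by
  cases x <;> cases y <;> first | rfl | exact absurd rfl h

@[simp] theorem set_set (e : Env) (x : Counter) (m n : ℕ) : (e.set x m).set x n = e.set x n := by
  cases x <;> rfl

theorem set_comm (e : Env) {x y : Counter} (h : x ≠ y) (m n : ℕ) :
    (e.set x m).set y n = (e.set y n).set x m := by
  cases x <;> cases y <;> first | rfl | exact absurd rfl h

@[simp] theorem set_get (e : Env) (x : Counter) : e.set x (e.get x) = e := by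
  cases x <;> rfl

end Env

namespace StackProg

open CodeSym

/-- The contents of the stacks. -/
def stk (i o b f : List CodeSym) (e : Env) : Stk → List CodeSym
  | .inp => i
  | .out => o
  | .buf => b
  | .fin => f
  | .ctr x => List.replicate (e.get x) one

section

variable (i o b f w : List CodeSym) (e : Env)

@[simp] theorem update_stk_inp :
    Function.update (stk i o b f e) .inp w = stk w o b f e := by
  funext k; cases k <;> simp [Function.update, stk]

@[simp] theorem update_stk_out :
    Function.update (stk i o b f e) .out w = stk i w b f e := by
  funext k; cases k <;> simp [Function.update, stk]

@[simp] theorem update_stk_buf :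
    Function.update (stk i o b f e) .buf w = stk i o w f e := by
  funext k; cases k <;> simp [Function.update, stk]

@[simp] theorem update_stk_fin :
    Function.update (stk i o b f e) .fin w = stk i o b w e := by
  funext k; cases k <;> simp [Function.update, stk]

theorem update_stk_ctr (x : Counter) (n : ℕ) :
    Function.update (stk i o b f e) (.ctr x) (List.replicate n one) =
      stk i o b f (e.set x n) := by
  funext k
  cases k with
  | ctr y =>
    by_cases h : y = x
    · subst h; simp [stk]
    · simp [Function.update, stk, h, Env.get_set_of_ne]
  | _ => simp [Function.update, stk]

end

/-! ### A calculus of specifications for transducing programs. -/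

/-- In at most `n` steps, `p` consumes the word `u` of the input, appends the words `v` and `c` to the
two outputs, and changes the counters from `e` to `e'`. -/
def Transduces (p : StackProg Stk CodeSym) (e : Env) (u v c : List CodeSym) (e' : Env) (n : ℕ) :
    Prop :=
  ∀ i o b f, ∃ m ≤ n, Runs p (stk (u ++ i) o b f e)
    (stk i (v.reverse ++ o) (c.reverse ++ b) f e') m

namespace Transduces

variable {p q : StackProg Stk CodeSym} {e e' e'' : Env} {u v c u' v' c' : List CodeSym} {m n : ℕ}

theorem mono (h : Transduces p e u v c e' m) (hmn : m ≤ n) : Transduces p e u v c e' n := by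
  intro i o b f
  obtain ⟨k, hk, hr⟩ := h i o b f
  exact ⟨k, hk.trans hmn, hr⟩

theorem skip (e : Env) : Transduces skip e [] [] [] e 0 :=
  fun _ _ _ _ => ⟨0, le_rfl, Runs.skip _⟩

theorem seq (h₁ : Transduces p e u v c e' m) (h₂ : Transduces q e' u' v' c' e'' n) :
    Transduces (seq p q) e (u ++ u') (v ++ v') (c ++ c') e'' (m + n) := by
  intro i o b f
  obtain ⟨k₁, hk₁, hr₁⟩ := h₁ (u' ++ i) o b f
  obtain ⟨k₂, hk₂, hr₂⟩ := h₂ i (v.reverse ++ o) (c.reverse ++ b) f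
  refine ⟨k₁ + k₂, add_le_add hk₁ hk₂, ?_⟩
  simpa using Runs.seq hr₁ hr₂

theorem pushOut (a : CodeSym) (e : Env) : Transduces (push .out a) e [] [a] [] e 1 :=
  fun i o b f => ⟨1, le_rfl, by simpa [stk] using Runs.push Stk.out a (stk i o b f e)⟩

theorem pushBuf (a : CodeSym) (e : Env) : Transduces (push .buf a) e [] [] [a] e 1 :=
  fun i o b f => ⟨1, le_rfl, by simpa [stk] using Runs.push Stk.buf a (stk i o b f e)⟩

theorem inc (x : Counter) (e : Env) :
    Transduces (push (.ctr x) one) e [] [] [] (e.set x (e.get x + 1)) 1 :=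
  fun i o b f => ⟨1, le_rfl, by
    have h := Runs.push (Stk.ctr x) one (stk i o b f e)
    rwa [show one :: stk i o b f e (.ctr x) = List.replicate (e.get x + 1) one from rfl,
      update_stk_ctr] at h⟩

theorem dec (x : Counter) (e : Env) :
    Transduces (pop (.ctr x) fun _ => .skip) e [] [] [] (e.set x (e.get x - 1)) 1 :=
  fun i o b f => ⟨1, le_rfl, by
    refine Runs.pop (n := 0) ?_
    rw [show (stk ([] ++ i) o b f e (.ctr x)).tail = List.replicate (e.get x - 1) one by
      simp [stk], update_stk_ctr]
    exact Runs.skip _⟩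

theorem popInp {g : Option CodeSym → StackProg Stk CodeSym} {a : CodeSym}
    (h : Transduces (g (some a)) e u v c e' n) :
    Transduces (pop .inp g) e (a :: u) v c e' (n + 1) := by
  intro i o b f
  obtain ⟨k, hk, hr⟩ := h i o b f
  refine ⟨k + 1, by omega, Runs.pop ?_⟩
  simpa [stk] using hr

theorem loopInp_done {exits : CodeSym → Bool} {body : CodeSym → StackProg Stk CodeSym} {a : CodeSym}
    (ha : exits a = true) (e : Env) : Transduces (loop .inp exits body) e [a] [] [] e 1 := by
  intro i o b f
  refine ⟨1, le_rfl, ?_⟩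
  have h := Runs.loop_exit (k := Stk.inp) (exits := exits) (body := body)
    (S := stk ([a] ++ i) o b f e) (a := a) (w := i) rfl ha
  simpa using h

theorem loopInp_step {exits : CodeSym → Bool} {body : CodeSym → StackProg Stk CodeSym} {a : CodeSym}
    (ha : exits a = false) (h₁ : Transduces (body a) e u v c e' m)
    (h₂ : Transduces (loop .inp exits body) e' u' v' c' e'' n) :
    Transduces (loop .inp exits body) e (a :: (u ++ u')) (v ++ v') (c ++ c') e'' (m + n + 1) := by
  intro i o b f
  obtain ⟨k₁, hk₁, hr₁⟩ := h₁ (u' ++ i) o b f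
  obtain ⟨k₂, hk₂, hr₂⟩ := h₂ i (v.reverse ++ o) (c.reverse ++ b) f
  refine ⟨k₁ + k₂ + 1, by omega, ?_⟩
  simpa using Runs.loop_step (S := stk (a :: (u ++ u') ++ i) o b f e) (a := a)
    (w := u ++ u' ++ i) rfl ha (by simpa using hr₁) hr₂

theorem loopCtr_zero {x : Counter} {body : CodeSym → StackProg Stk CodeSym} (h : e.get x = 0) :
    Transduces (loop (.ctr x) (fun _ => false) body) e [] [] [] e 1 :=
  fun _ _ _ _ => ⟨1, le_rfl, Runs.loop_nil (by simp [stk, h])⟩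

theorem loopCtr_succ {x : Counter} {body : CodeSym → StackProg Stk CodeSym} {k : ℕ}
    (h : e.get x = k + 1) (h₁ : Transduces (body one) (e.set x k) u v c e' m)
    (h₂ : Transduces (loop (.ctr x) (fun _ => false) body) e' u' v' c' e'' n) :
    Transduces (loop (.ctr x) (fun _ => false) body) e (u ++ u') (v ++ v') (c ++ c') e''
      (m + n + 1) := by
  intro i o b f
  obtain ⟨k₁, hk₁, hr₁⟩ := h₁ (u' ++ i) o b f
  obtain ⟨k₂, hk₂, hr₂⟩ := h₂ i (v.reverse ++ o) (c.reverse ++ b) f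
  refine ⟨k₁ + k₂ + 1, by omega, ?_⟩
  simpa using Runs.loop_step (S := stk (u ++ u' ++ i) o b f e) (a := one)
    (k := Stk.ctr x) (exits := fun _ => false)
    (w := List.replicate k one) (by simp [stk, h, List.replicate_succ]) rfl
    (by simpa [update_stk_ctr] using hr₁) hr₂

end Transduces

/-! ### Subroutines -/

/-- Appends a fixed word to the output. -/
def emit : List CodeSym → StackProg Stk CodeSym
  | [] => skip
  | a :: w => seq (push .out a) (emit w)

theorem Transduces.emit : ∀ (w : List CodeSym) (e : Env),
    Transduces (emit w) e [] w [] e w.length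
  | [], e => Transduces.skip e
  | a :: w, e => by
    simpa [StackProg.emit, Nat.add_comm] using (Transduces.pushOut a e).seq (Transduces.emit w e)

/-- Moves the counter `x` to the counter `y`, appending a fixed word to the output in each step. -/
def drain (x y : Counter) (w : List CodeSym) : StackProg Stk CodeSym :=
  loop (.ctr x) (fun _ => false) fun _ => seq (emit w) (push (.ctr y) one)

/-- A round costs `w.length` pushes, one increment and the pop of the loop; the final `1` is the pop
that finds the counter empty. -/
theorem Transduces.drain {x y : Counter} (hxy : x ≠ y) (w : List CodeSym) : ∀ (n : ℕ) (e : Env),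
    e.get x = n → Transduces (drain x y w) e [] (List.replicate n w).flatten []
      ((e.set x 0).set y (e.get y + n)) (n * (w.length + 2) + 1) := by
  intro n
  induction n with
  | zero =>
    intro e h
    rw [show (e.set x 0).set y (e.get y + 0) = e by
      rw [Env.set_comm _ hxy, Nat.add_zero, Env.set_get, ← h, Env.set_get]]
    simpa [StackProg.drain] using Transduces.loopCtr_zero h
  | succ n ih =>
    intro e h
    have h₁ := (Transduces.emit w (e.set x n)).seq (Transduces.inc y (e.set x n))
    have h₂ := ih ((e.set x n).set y ((e.set x n).get y + 1))
      (by rw [Env.get_set_of_ne _ hxy, Env.get_set_self])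
    have h₃ := Transduces.loopCtr_succ h h₁ h₂
    rw [Env.get_set_self, Env.get_set_of_ne _ hxy.symm, Env.set_comm _ hxy.symm, Env.set_set,
      Env.set_set, Nat.add_assoc, Nat.add_comm 1 n] at h₃
    exact (by simpa [StackProg.drain, List.replicate_succ] using h₃ : Transduces _ e _ _ _ _ _).mono (by ring_nf; omega)

/-- Appends as many copies of a fixed word as the counter `x` says. -/
def repeatEmit (x : Counter) (w : List CodeSym) : StackProg Stk CodeSym :=
  seq (drain x .tmp w) (drain .tmp x [])

/-- Looping on a counter destroys it, so its value is parked in `tmp` and then moved back with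
nothing emitted. The restoration is exact because `tmp` starts at zero. -/
theorem Transduces.repeatEmit {x : Counter} (hx : x ≠ .tmp) (w : List CodeSym) {e : Env}
    (h : e.tmp = 0) : Transduces (repeatEmit x w) e [] (List.replicate (e.get x) w).flatten [] e
      (e.get x * (w.length + 4) + 2) := by
  have h₁ := Transduces.drain hx w (e.get x) e rfl
  have h₂ := Transduces.drain hx.symm [] (e.get x) ((e.set x 0).set .tmp (e.get .tmp + e.get x))
    (by rw [Env.get_set_self, show e.get .tmp = 0 from h, Nat.zero_add])
  have h₃ := h₁.seq h₂
  rw [Env.get_set_of_ne _ hx, Env.get_set_self, Env.set_set, Nat.zero_add,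
    Env.set_comm _ hx.symm, Env.set_set, Env.set_get, ← h, show e.tmp = e.get .tmp from rfl,
    Env.set_get] at h₃
  exact (by simpa [StackProg.repeatEmit] using h₃ : Transduces _ e _ _ _ _ _).mono (by ring_nf; omega)

/-- Is a symbol the separator? -/
def isSep (a : CodeSym) : Bool := decide (a = sep)

/-- Copies a field up to the separator. -/
def copyField : StackProg Stk CodeSym :=
  seq (loop .inp isSep (push .out)) (push .out sep)

theorem Transduces.copyLoop : ∀ {w : List CodeSym}, (∀ a ∈ w, a ≠ sep) → ∀ e,
    Transduces (loop .inp isSep (push .out)) e (w ++ [sep]) w [] e (2 * w.length + 1)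
  | [], _, e => Transduces.loopInp_done rfl e
  | a :: w, h, e => by
    have h₁ := Transduces.loopInp_step (exits := isSep) (body := push .out) (a := a)
      (by simpa [isSep] using h a) (Transduces.pushOut a e)
      (Transduces.copyLoop (fun b hb => h b (List.mem_cons_of_mem _ hb)) e)
    exact (by simpa using h₁ : Transduces _ e _ _ _ _ _).mono (by simp; omega)

theorem Transduces.copyField {w : List CodeSym} (h : ∀ a ∈ w, a ≠ sep) (e : Env) :
    Transduces copyField e (w ++ [sep]) (w ++ [sep]) [] e (2 * w.length + 2) := by
  simpa [StackProg.copyField] using (Transduces.copyLoop h e).seq (Transduces.pushOut sep e)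

/-- Adds the length of the next field to a counter. -/
def readCounter (x : Counter) : StackProg Stk CodeSym :=
  loop .inp isSep fun _ => push (.ctr x) one

theorem Transduces.readCounter (x : Counter) : ∀ (n : ℕ) (e : Env),
    Transduces (readCounter x) e (Code.idx n) [] [] (e.set x (e.get x + n)) (2 * n + 1)
  | 0, e => by simpa [Code.idx, StackProg.readCounter] using Transduces.loopInp_done (exits := isSep) (a := sep) rfl e
  | n + 1, e => by
    have h₁ := Transduces.loopInp_step (exits := isSep) (body := fun _ => push (.ctr x) one)
      (a := one) rfl (Transduces.inc x e) (Transduces.readCounter x n _)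
    rw [Env.get_set_self, Env.set_set, Nat.add_assoc, Nat.add_comm 1 n] at h₁
    exact (by simpa [Code.idx, StackProg.readCounter, List.replicate_succ] using h₁ : Transduces _ e _ _ _ _ _).mono
      (by omega)

theorem ne_sep_of_mem_replicate_one {n : ℕ} : ∀ a ∈ List.replicate n one, a ≠ sep := by
  intro a ha
  rw [List.eq_of_mem_replicate ha]
  decide

theorem ne_sep_of_mem_ofFn_bits {n : ℕ} (X : Finset (Fin n)) :
    ∀ a ∈ List.ofFn (fun i => if i ∈ X then one else zero), a ≠ sep := by
  intro a ha
  obtain ⟨i, rfl⟩ := (List.mem_ofFn' _ _).1 ha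
  dsimp only
  split <;> decide

theorem ne_sep_of_mem_bits (l : List Bool) :
    ∀ a ∈ l.map (fun b => if b then one else zero), a ≠ sep := by
  intro a ha
  obtain ⟨b, -, rfl⟩ := List.mem_map.1 ha
  cases b <;> decide

theorem Transduces.copyIdx (n : ℕ) (e : Env) :
    Transduces StackProg.copyField e (Code.idx n) (Code.idx n) [] e (2 * n + 2) := by
  simpa [Code.idx] using Transduces.copyField (ne_sep_of_mem_replicate_one (n := n)) e

theorem Transduces.copySubset {n : ℕ} (X : Finset (Fin n)) (e : Env) :
    Transduces StackProg.copyField e (Code.subset X) (Code.subset X) [] e (2 * n + 2) := by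
  simpa [Code.subset] using Transduces.copyField (ne_sep_of_mem_ofFn_bits X) e

end StackProg

/-! ## Bisimilarity and simulations -/

theorem Bisimilar.forth {Act C : Type} {step : Act → C → C → Prop} {c₁ c₂ c₁' : C} {l : Act}
    (h : Bisimilar step c₁ c₂) (hs : step l c₁ c₁') : ∃ c₂', step l c₂ c₂' ∧ Bisimilar step c₁' c₂' := by
  obtain ⟨R, hR, h⟩ := h
  obtain ⟨c₂', h₁, h₂⟩ := (hR _ _ h l).1 _ hs
  exact ⟨c₂', h₁, R, hR, h₂⟩

theorem Bisimilar.symm {Act C : Type} {step : Act → C → C → Prop} {c₁ c₂ : C}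
    (h : Bisimilar step c₁ c₂) : Bisimilar step c₂ c₁ := by
  obtain ⟨R, hR, h⟩ := h
  exact ⟨fun a b => R b a, fun a b hab l => (hR b a hab l).symm, h⟩

/-- A symmetric simulation is a bisimulation. -/
theorem IsBisimulation.of_symm {Act C : Type} {step : Act → C → C → Prop} {R : C → C → Prop}
    (hs : ∀ a b, R a b → R b a)
    (h : ∀ a b, R a b → ∀ l a', step l a a' → ∃ b', step l b b' ∧ R a' b') :
    IsBisimulation step R := by
  refine fun a b hab l => ⟨fun a' ha => h a b hab l a' ha, fun b' hb => ?_⟩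
  obtain ⟨a', h₁, h₂⟩ := h b a (hs _ _ hab) l b' hb
  exact ⟨a', h₁, hs _ _ h₂⟩

/-- Bisimilarity is preserved and reflected by functional bisimulations. -/
theorem bisimilar_iff_of_functional {Act C C' : Type} {step : Act → C → C → Prop}
    {step' : Act → C' → C' → Prop} (g : C → C')
    (fwd : ∀ l c c', step l c c' → step' l (g c) (g c'))
    (bwd : ∀ l c x, step' l (g c) x → ∃ c', step l c c' ∧ g c' = x) (c₁ c₂ : C) :
    Bisimilar step c₁ c₂ ↔ Bisimilar step' (g c₁) (g c₂) := by
  constructor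
  · intro h
    refine ⟨fun x y => ∃ a b, g a = x ∧ g b = y ∧ Bisimilar step a b, .of_symm ?_ ?_,
      c₁, c₂, rfl, rfl, h⟩
    · rintro x y ⟨a, b, ha, hb, hab⟩
      exact ⟨b, a, hb, ha, hab.symm⟩
    · rintro x y ⟨a, b, rfl, rfl, hab⟩ l x' hx
      obtain ⟨a', ha, rfl⟩ := bwd _ _ _ hx
      obtain ⟨b', hb, hab'⟩ := hab.forth ha
      exact ⟨g b', fwd _ _ _ hb, a', b', rfl, rfl, hab'⟩
  · intro h
    refine ⟨fun a b => Bisimilar step' (g a) (g b), .of_symm (fun _ _ h => h.symm) ?_, h⟩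
    intro a b hab l a' ha
    obtain ⟨y, hy, hy'⟩ := hab.forth (fwd _ _ _ ha)
    obtain ⟨b', hb, rfl⟩ := bwd _ _ _ hy
    exact ⟨b', hb, hy'⟩

/-- From `x`, the only run is the one labelled by the given word, and it leads to `y`. -/
def Forced {Act C : Type} (step : Act → C → C → Prop) : List Act → C → C → Prop
  | [], x, y => x = y
  | l :: w, x, y => ∃ x', step l x x' ∧ (∀ l' x'', step l' x x'' → l' = l ∧ x'' = x') ∧
      Forced step w x' y

/-- The second side must answer the forced move of the first, and it has only one move to answer
with; hence bisimilarity travels along forced runs. -/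
theorem Forced.bisimilar {Act C : Type} {step : Act → C → C → Prop} : ∀ {w : List Act} {x₁ x₂ y₁ y₂},
    Forced step w x₁ y₁ → Forced step w x₂ y₂ → Bisimilar step x₁ x₂ → Bisimilar step y₁ y₂
  | [], _, _, _, _, h₁, h₂, h => by
    obtain rfl : _ = _ := h₁
    obtain rfl : _ = _ := h₂
    exact h
  | _ :: _, _, _, _, _, ⟨_, s₁, _, h₁⟩, ⟨_, _, u₂, h₂⟩, h => by
    obtain ⟨z, hz, hb⟩ := h.forth s₁
    obtain ⟨-, rfl⟩ := u₂ _ _ hz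
    exact h₁.bisimilar h₂ hb

/-- Bisimilarity is preserved and reflected by encodings, up to renamings in `E`, that simulate
each step by a step followed by a forced run. -/
theorem bisimilar_iff_of_encoding {Act Act' C C' E : Type} {step : Act → C → C → Prop}
    {step' : Act' → C' → C' → Prop} (enc : E → C → C') (ren : E → Act → Act')
    (w : Act → List Act')
    (fwd : ∀ e l c c', step l c c' →
      ∃ x, step' (ren e l) (enc e c) x ∧ Forced step' (w l) x (enc e c'))
    (bwd : ∀ e l c x, step' (ren e l) (enc e c) x →
      ∃ c', step l c c' ∧ Forced step' (w l) x (enc e c'))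
    (extend : ∀ e c₁ c₂ l' x, step' l' (enc e c₁) x →
      ∃ e' l, ren e' l = l' ∧ enc e' c₁ = enc e c₁ ∧ enc e' c₂ = enc e c₂)
    (e : E) (c₁ c₂ : C) :
    Bisimilar step c₁ c₂ ↔ Bisimilar step' (enc e c₁) (enc e c₂) := by
  constructor
  · intro h
    -- Related configurations are at the same stage of forced runs with the same remaining word `v`.
    -- The renaming is part of the witness and may change from step to step.
    refine ⟨fun x y => ∃ e a b v, Forced step' v x (enc e a) ∧ Forced step' v y (enc e b) ∧
      Bisimilar step a b, .of_symm ?_ ?_, e, c₁, c₂, [], rfl, rfl, h⟩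
    · rintro x y ⟨e, a, b, v, ha, hb, hab⟩
      exact ⟨e, b, a, v, hb, ha, hab.symm⟩
    · rintro x y ⟨e, a, b, v, ha, hb, hab⟩ l' x' hx
      cases v with
      | nil =>
        obtain rfl : x = _ := ha
        obtain rfl : y = _ := hb
        -- The letter need not be in the range of the current renaming; another one that gives the
        -- same two encodings reaches it.
        obtain ⟨e', l, rfl, h₁, h₂⟩ := extend e a b l' x' hx
        rw [← h₁] at hx
        obtain ⟨a', sa, fa⟩ := bwd _ _ _ _ hx
        obtain ⟨b', sb, hab'⟩ := hab.forth sa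
        obtain ⟨y', hy, fb⟩ := fwd e' _ _ _ sb
        exact ⟨y', h₂ ▸ hy, e', a', b', _, fa, fb, hab'⟩
      | cons l v =>
        obtain ⟨x₁, s₁, u₁, f₁⟩ := ha
        obtain ⟨y₁, s₂, u₂, f₂⟩ := hb
        obtain ⟨rfl, rfl⟩ := u₁ _ _ hx
        exact ⟨y₁, s₂, e, a, b, v, f₁, f₂, hab⟩
  · intro h
    -- For reflection one renaming suffices: the challenge is a renamed letter, and the answer
    -- carries the same label. The forced runs that follow have the same word and end in the two
    -- encodings.
    refine ⟨fun a b => Bisimilar step' (enc e a) (enc e b), .of_symm (fun _ _ h => h.symm) ?_, h⟩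
    intro a b hab l a' ha
    obtain ⟨x, hx, fx⟩ := fwd e _ _ _ ha
    obtain ⟨y, hy, hxy⟩ := hab.forth hx
    obtain ⟨b', hb, fy⟩ := bwd _ _ _ _ hy
    exact ⟨b', hb, fx.bisimilar fy hxy⟩

/-! ## Register automata as fresh-register automata -/

namespace FRA

variable {Q T D : Type} {r : ℕ} {A : Set (RegAssignment r D)}

/-- Forget the history. -/
def Config.toRA {𝒜 : FRA Q T D r A} (κ : 𝒜.Config) : 𝒜.RAConfig := ⟨κ.state, κ.reg, κ.reg_mem⟩

theorem update_range {τ : RegTransition Q T r} [DecidableEq D] {ρ : RegAssignment r D} {d : D}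
    {H : Finset D} (h : ∀ i d, ρ i = some d → d ∈ H) :
    ∀ i d', τ.update ρ d i = some d' → d' ∈ insert d H := by
  intro i d' hd
  unfold RegTransition.update at hd
  split_ifs at hd with h₁ h₂
  · simp_all
  · exact Finset.mem_insert_of_mem (h _ _ hd)

/-- Only `⊛`-guards inspect the history, and its new value is determined by the letter. Hence each
step of the projection lifts uniquely, and the projection is a functional bisimulation. -/
theorem bisimilar_toRA [DecidableEq D] {𝒜 : FRA Q T D r A} (h𝒜 : 𝒜.IsRA) (κ₁ κ₂ : 𝒜.Config) :
    Bisimilar 𝒜.Step κ₁ κ₂ ↔ Bisimilar 𝒜.RAStep κ₁.toRA κ₂.toRA := by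
  refine bisimilar_iff_of_functional Config.toRA ?_ ?_ κ₁ κ₂
  · rintro l c c' ⟨τ, hτ, h₁, h₂, h₃, h₄ | h₄, h₅, h₆⟩
    · exact ⟨τ, hτ, h₁, h₂, h₃, h₄, h₅⟩
    · exact absurd h₄.1 (h𝒜 τ hτ)
  · rintro l c ⟨q, ρ, hρ⟩ ⟨τ, hτ, h₁, h₂, h₃, h₄, h₅⟩
    obtain rfl : ρ = _ := h₅
    exact ⟨⟨q, _, insert l.2 c.hist, hρ, update_range c.range_subset⟩,
      ⟨τ, hτ, h₁, h₂, h₃, Or.inl h₄, rfl, rfl⟩, rfl⟩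

/-- Regard a configuration as one over another class of assignments. -/
def Config.cast {A' : Set (RegAssignment r D)} {𝒜 : FRA Q T D r A} (ℬ : FRA Q T D r A')
    (hA : A ⊆ A') (κ : 𝒜.Config) : ℬ.Config :=
  ⟨κ.state, κ.reg, κ.hist, hA κ.reg_mem, κ.range_subset⟩

/-- Regard a configuration as one over another class of assignments. -/
def RAConfig.cast {A' : Set (RegAssignment r D)} {𝒜 : FRA Q T D r A} (ℬ : FRA Q T D r A')
    (hA : A ⊆ A') (κ : 𝒜.RAConfig) : ℬ.RAConfig :=
  ⟨κ.state, κ.reg, hA κ.reg_mem⟩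

variable {A' : Set (RegAssignment r D)} {𝒜 : FRA Q T D r A} {ℬ : FRA Q T D r A'}

/-- The inclusion of configurations is a functional bisimulation: by `hc` the larger class admits no
further successor of an old configuration. -/
theorem bisimilar_cast [DecidableEq D] (ht : 𝒜.trans = ℬ.trans) (hA : A ⊆ A')
    (hc : ∀ τ ∈ 𝒜.trans, ∀ ρ ∈ A, ∀ d, τ.update ρ d ∈ A' → τ.update ρ d ∈ A) (κ₁ κ₂ : 𝒜.Config) :
    Bisimilar 𝒜.Step κ₁ κ₂ ↔ Bisimilar ℬ.Step (κ₁.cast ℬ hA) (κ₂.cast ℬ hA) := by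
  refine bisimilar_iff_of_functional (Config.cast ℬ hA) ?_ ?_ κ₁ κ₂
  · rintro l c c' ⟨τ, hτ, h⟩
    exact ⟨τ, ht ▸ hτ, h⟩
  · rintro l c ⟨q, ρ, H, hρ, hr⟩ ⟨τ, hτ, h₁, h₂, h₃, h₄, h₅, h₆⟩
    rw [← ht] at hτ
    obtain rfl : ρ = _ := h₅
    exact ⟨⟨q, _, H, hc τ hτ _ c.reg_mem _ hρ, hr⟩, ⟨τ, hτ, h₁, h₂, h₃, h₄, rfl, h₆⟩, rfl⟩

theorem bisimilar_castRA (ht : 𝒜.trans = ℬ.trans) (hA : A ⊆ A')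
    (hc : ∀ τ ∈ 𝒜.trans, ∀ ρ ∈ A, ∀ d, τ.update ρ d ∈ A' → τ.update ρ d ∈ A) (κ₁ κ₂ : 𝒜.RAConfig) :
    Bisimilar 𝒜.RAStep κ₁ κ₂ ↔ Bisimilar ℬ.RAStep (κ₁.cast ℬ hA) (κ₂.cast ℬ hA) := by
  refine bisimilar_iff_of_functional (RAConfig.cast ℬ hA) ?_ ?_ κ₁ κ₂
  · rintro l c c' ⟨τ, hτ, h⟩
    exact ⟨τ, ht ▸ hτ, h⟩
  · rintro l c ⟨q, ρ, hρ⟩ ⟨τ, hτ, h₁, h₂, h₃, h₄, h₅⟩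
    rw [← ht] at hτ
    obtain rfl : ρ = _ := h₅
    exact ⟨⟨q, _, hc τ hτ _ c.reg_mem _ hρ⟩, ⟨τ, hτ, h₁, h₂, h₃, h₄, rfl⟩, rfl⟩

end FRA

/-! ## Reductions that do not change the automaton -/

/-- The discipline `Y'` is the next more liberal one after `Y`. -/
def Emptiness.Next (Y Y' : Emptiness) : Prop := (Y = .F ∧ Y' = .E0) ∨ (Y = .E0 ∧ Y' = .E)

namespace Emptiness.Next

variable {Y Y' : Emptiness} {X : Storage}

theorem admissible_subset (h : Y.Next Y') (r : ℕ) (D : Type) :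
    admissible X Y r D ⊆ admissible X Y' r D := by
  rintro ρ ⟨h₁, -⟩
  refine ⟨h₁, ?_⟩
  rcases h with ⟨-, rfl⟩ | ⟨-, rfl⟩ <;> simp

theorem permitted (h : Y.Next Y') {Q T : Type} {r : ℕ} {τ : RegTransition Q T r}
    (hτ : τ.Permitted X Y) : τ.Permitted X Y' := by
  refine ⟨hτ.1, ?_⟩
  rcases h with ⟨rfl, rfl⟩ | ⟨-, rfl⟩
  · exact fun _ => hτ.2 (by simp)
  · simp

/-- Beyond the storage condition only `F` restricts assignments, and there nothing is erased, so a
filled register is kept or overwritten by a name. -/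
theorem update_mem {Q T D : Type} {r : ℕ} {τ : RegTransition Q T r}
    (hτ : τ.Permitted X Y) {ρ : RegAssignment r D} (hρ : ρ ∈ admissible X Y r D) (d : D)
    (hu : τ.update ρ d ∈ admissible X Y' r D) : τ.update ρ d ∈ admissible X Y r D := by
  refine ⟨hu.1, fun hY i => ?_⟩
  have h₁ := (hτ.2 (by simp [hY])).1
  have h₂ := hρ.2 hY i
  unfold RegTransition.update
  split_ifs <;> simp_all

end Emptiness.Next

namespace BisimInput

variable {k : Option ℕ} {X : Storage} {Y Y' : Emptiness}

/-- Regard an instance as one for a more liberal discipline. -/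
def relax (h : Y.Next Y') (x : BisimInput k X Y) : BisimInput k X Y' where
  aut := x.aut
  tags_eq := x.tags_eq
  initReg_mem := h.admissible_subset _ _ x.initReg_mem
  permitted := fun τ hτ => h.permitted (x.permitted τ hτ)
  q₁ := x.q₁
  ρ₁ := x.ρ₁
  q₂ := x.q₂
  ρ₂ := x.ρ₂
  ρ₁_mem := h.admissible_subset _ _ x.ρ₁_mem
  ρ₂_mem := h.admissible_subset _ _ x.ρ₂_mem

end BisimInput

/-- A function that does not change the code is computable in polynomial time. -/
theorem computableInPolyTime_of_code_eq {α β Γ : Type} [Fintype Γ] {ea : α → List Γ}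
    {eb : β → List Γ} {f : α → β} (h : ∀ a, eb (f a) = ea a) :
    Nonempty (Turing.TM2ComputableInPolyTime ea eb f) := by
  obtain rfl : ea = fun a => eb (f a) := funext fun a => (h a).symm
  exact ⟨⟨(Turing.idComputableInPolyTime fun a => eb (f a)).toTM2ComputableAux, 1,
    (Turing.idComputableInPolyTime fun a => eb (f a)).outputsFun⟩⟩

/-- The code of an instance records no trace of the discipline, so the reduction is the identity on
words. -/
theorem raBisim_reducesTo_relax (k : Option ℕ) (X : Storage) {Y Y' : Emptiness} (h : Y.Next Y') :
    (raBisim k X Y).ReducesTo (raBisim k X Y') := by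
  refine ⟨fun x : RAInput k X Y => ⟨x.toBisimInput.relax h, x.isRA⟩,
    computableInPolyTime_of_code_eq (Γ := CodeSym) fun _ => rfl, fun x => ?_⟩
  exact FRA.bisimilar_castRA (𝒜 := x.toFRA) (ℬ := (x.toBisimInput.relax h).toFRA) rfl (h.admissible_subset _ _)
    (fun τ hτ ρ hρ d => Emptiness.Next.update_mem (x.permitted τ hτ) hρ d) _ _

theorem fraBisim_reducesTo_relax (k : Option ℕ) (X : Storage) {Y Y' : Emptiness} (h : Y.Next Y') :
    (fraBisim k X Y).ReducesTo (fraBisim k X Y') := by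
  refine ⟨fun x : FRAInput k X Y => ⟨x.toBisimInput.relax h, x.hist, x.range₁_subset, x.range₂_subset⟩,
    computableInPolyTime_of_code_eq (Γ := CodeSym) fun _ => rfl, fun x => ?_⟩
  exact FRA.bisimilar_cast (𝒜 := x.toFRA) (ℬ := (x.toBisimInput.relax h).toFRA) rfl (h.admissible_subset _ _)
    (fun τ hτ ρ hρ d => Emptiness.Next.update_mem (x.permitted τ hτ) hρ d) _ _

/-! ## Simulating empty registers by filled ones

Register `j ≤ r` is represented by two cells, where the second one permanently holds a dummy name and
the first one holds the same dummy name if the register is empty; register `r` is auxiliary. After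
each transition, all dummy names are read in turn, and registers are emptied on this occasion. -/

namespace Filling

variable {n s r T : ℕ}

/-- The states of the simulating automaton: those of the given one, and for each transition one state
for each register to be reset. -/
def stateEquiv (n T r : ℕ) : Fin n ⊕ (Fin T × Fin (r + 1)) ≃ Fin (n + T * (r + 1)) :=
  (Equiv.sumCongr (Equiv.refl _) finProdFinEquiv).trans finSumFinEquiv

/-- The cells that represent a register. -/
def cell (j : Fin (r + 1)) (b : Fin 2) : Fin ((r + 1) * 2) := finProdFinEquiv (j, b)

theorem cell_inj {j j' : Fin (r + 1)} {b b' : Fin 2} : cell j b = cell j' b' ↔ j = j' ∧ b = b' := by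
  simp [cell]

theorem cell_cases {P : Fin ((r + 1) * 2) → Prop} (h₀ : ∀ j, P (cell j 0)) (h₁ : ∀ j, P (cell j 1)) :
    ∀ k, P k := by
  intro k
  obtain ⟨⟨j, b⟩, rfl⟩ := finProdFinEquiv.surjective k
  fin_cases b
  · exact h₀ j
  · exact h₁ j

/-- The dummy names. -/
def dummy (j : ℕ) : ℕ := 2 ^ (j + 1)

theorem dummy_inj {i j : ℕ} : dummy i = dummy j ↔ i = j := by
  simp [dummy]

/-- The assignment to the cells that represents an assignment to the registers. -/
def fill (e : ℕ → ℕ) (σ : RegAssignment (r + 1) ℕ) : RegAssignment ((r + 1) * 2) ℕ := fun k =>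
  let p := finProdFinEquiv.symm k
  if p.2 = 0 then some ((σ p.1).elim (dummy p.1) e) else some (dummy p.1)

@[simp] theorem fill_cell_zero (e : ℕ → ℕ) (σ : RegAssignment (r + 1) ℕ) (j : Fin (r + 1)) :
    fill e σ (cell j 0) = some ((σ j).elim (dummy j) e) := by
  simp [fill, cell]

@[simp] theorem fill_cell_one (e : ℕ → ℕ) (σ : RegAssignment (r + 1) ℕ) (j : Fin (r + 1)) :
    fill e σ (cell j 1) = some (dummy j) := by
  simp [fill, cell]

theorem fill_ne_none (e : ℕ → ℕ) (σ : RegAssignment (r + 1) ℕ) : ∀ k, fill e σ k ≠ none :=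
  cell_cases (by simp) (by simp)

/-- Adds an empty auxiliary register. -/
def widen (ρ : RegAssignment r ℕ) : RegAssignment (r + 1) ℕ :=
  Fin.lastCases none ρ

@[simp] theorem widen_last (ρ : RegAssignment r ℕ) : widen ρ (Fin.last r) = none := by
  simp [widen]

@[simp] theorem widen_castSucc (ρ : RegAssignment r ℕ) (i : Fin r) : widen ρ i.castSucc = ρ i := by
  simp [widen]

/-- The register in which the letter is stored. -/
def storeReg (o : Option (Fin r)) : Fin (r + 1) := o.elim (Fin.last r) Fin.castSucc

/-- Guards in terms of cells. -/
def cellGuard : Guard r → Guard ((r + 1) * 2)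
  | .fresh => .fresh
  | .exactly X => .exactly (X.image fun i => cell i.castSucc 0)

/-- The registers that are emptied after a transition. -/
def emptied (τ : RegTransition (Fin n) (Fin s) r) : Finset (Fin (r + 1)) :=
  insert (Fin.last r) (τ.erase.image Fin.castSucc)

theorem last_mem_emptied (τ : RegTransition (Fin n) (Fin s) r) : Fin.last r ∈ emptied τ := by
  simp [emptied]

@[simp] theorem castSucc_mem_emptied (τ : RegTransition (Fin n) (Fin s) r) (i : Fin r) :
    i.castSucc ∈ emptied τ ↔ i ∈ τ.erase := by
  simp [emptied, Fin.castSucc_ne_last]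

/-- The state after the reset of register `j`. -/
def nextState (t : Fin T) (τ : RegTransition (Fin n) (Fin s) r) (j : Fin (r + 1)) :
    Fin n ⊕ (Fin T × Fin (r + 1)) :=
  Fin.lastCases (motive := fun _ => Fin n ⊕ (Fin T × Fin (r + 1)))
    (Sum.inl τ.dst) (fun i => Sum.inr (t, i.succ)) j

/-- The transition that stores the letter. -/
def storeTrans (t : Fin T) (τ : RegTransition (Fin n) (Fin s) r) :
    RegTransition (Fin (n + T * (r + 1))) (Fin s) ((r + 1) * 2) where
  src := stateEquiv n T r (Sum.inl τ.src)
  tag := τ.tag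
  guard := cellGuard τ.guard
  target := some (cell (storeReg τ.target) 0)
  erase := ∅
  dst := stateEquiv n T r (Sum.inr (t, 0))
  target_notMem_erase := by simp

/-- The transition that empties or retains register `j`, which is empty already if `b` holds. -/
def resetTrans (t : Fin T) (τ : RegTransition (Fin n) (Fin s) r) (j : Fin (r + 1)) (b : Bool) :
    RegTransition (Fin (n + T * (r + 1))) (Fin s) ((r + 1) * 2) where
  src := stateEquiv n T r (Sum.inr (t, j))
  tag := τ.tag
  guard := .exactly (if b then {cell j 0, cell j 1} else {cell j 1})
  target := some (cell j (if j ∈ emptied τ then 0 else 1))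
  erase := ∅
  dst := stateEquiv n T r (nextState t τ j)
  target_notMem_erase := by simp

/-- The transitions that simulate a given one. -/
def simTrans (t : Fin T) (τ : RegTransition (Fin n) (Fin s) r) :
    List (RegTransition (Fin (n + T * (r + 1))) (Fin s) ((r + 1) * 2)) :=
  storeTrans t τ :: (List.finRange (r + 1)).flatMap fun j =>
    [resetTrans t τ j false, resetTrans t τ j true]

/-- All transitions of the simulating automaton. -/
def allTrans (l : List (RegTransition (Fin n) (Fin s) r)) :
    List (RegTransition (Fin (n + l.length * (r + 1))) (Fin s) ((r + 1) * 2)) :=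
  (List.finRange l.length).flatMap fun t => simTrans t (l.get t)

theorem mem_allTrans {l : List (RegTransition (Fin n) (Fin s) r)} {τ} :
    τ ∈ allTrans l ↔ ∃ t, τ = storeTrans t (l.get t) ∨ ∃ j b, τ = resetTrans t (l.get t) j b := by
  simp [allTrans, simTrans]

/-- The simulating automaton. -/
def aut (a : AutDesc) : AutDesc where
  tags := a.tags
  states := a.states + a.trans.length * (a.regs + 1)
  regs := (a.regs + 1) * 2
  init := stateEquiv _ _ _ (Sum.inl a.init)
  initReg := fill (fun d => 2 * d + 1) (widen a.initReg)
  final := a.final.image fun q => stateEquiv _ _ _ (Sum.inl q)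
  trans := allTrans a.trans

theorem fill_mem_admissible (e : ℕ → ℕ) (σ : RegAssignment (r + 1) ℕ) :
    fill e σ ∈ admissible .M .F ((r + 1) * 2) ℕ :=
  ⟨by simp, fun _ => fill_ne_none e σ⟩

/-- The simulating instance. -/
def input {k : Option ℕ} {X : Storage} {Y : Emptiness} (x : BisimInput k X Y) :
    BisimInput k .M .F where
  aut := aut x.aut
  tags_eq := x.tags_eq
  initReg_mem := fill_mem_admissible _ _
  permitted := by
    intro τ hτ
    obtain ⟨t, rfl | ⟨j, b, rfl⟩⟩ := mem_allTrans.1 hτ <;>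
      exact ⟨nofun, fun _ => ⟨rfl, Option.some_ne_none _⟩⟩
  q₁ := stateEquiv _ _ _ (Sum.inl x.q₁)
  ρ₁ := fill (fun d => 2 * d + 1) (widen x.ρ₁)
  q₂ := stateEquiv _ _ _ (Sum.inl x.q₂)
  ρ₂ := fill (fun d => 2 * d + 1) (widen x.ρ₂)
  ρ₁_mem := fill_mem_admissible _ _
  ρ₂_mem := fill_mem_admissible _ _

theorem isRA_input {k : Option ℕ} {X : Storage} {Y : Emptiness} {x : BisimInput k X Y}
    (h : x.toFRA.IsRA) : (input x).toFRA.IsRA := by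
  intro τ hτ
  obtain ⟨t, rfl | ⟨j, b, rfl⟩⟩ := mem_allTrans.1 hτ
  · have h' := h (x.aut.trans.get t) (List.get_mem _ _)
    simp only [storeTrans]
    cases hg : (x.aut.trans.get t).guard with
    | fresh => exact absurd hg h'
    | exactly X => exact nofun
  · exact nofun

/-! ### Guards and updates -/

/-- Injections of the names into the names that are not dummies. -/
def Renaming (r : ℕ) : Type :=
  {e : ℕ → ℕ // Function.Injective e ∧ ∀ d, ∀ j : Fin (r + 1), e d ≠ dummy j}

/-- The renaming that is used for the instance. -/
def double (r : ℕ) : Renaming r :=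
  ⟨fun d => 2 * d + 1, fun a b h => by simpa using h, fun d j h => by
    -- Parity separates the two kinds of names: `2 * d + 1` is odd, while the dummies `2 ^ (j + 1)`
    -- are even.
    have h' := congrArg (· % 2) h
    simp [dummy, pow_succ] at h'⟩

/-- The history that represents a given one. -/
def history (e : Renaming r) (H : Finset ℕ) : Finset ℕ :=
  H.image e.1 ∪ Finset.univ.image fun j : Fin (r + 1) => dummy j

theorem mem_history_renaming {e : Renaming r} {H : Finset ℕ} {d : ℕ} :
    e.1 d ∈ history e H ↔ d ∈ H := by
  simp only [history, Finset.mem_union, Finset.mem_image, Finset.mem_univ, true_and]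
  constructor
  · rintro (⟨a, ha, h⟩ | ⟨j, h⟩)
    · exact e.2.1 h ▸ ha
    · exact absurd h.symm (e.2.2 d j)
  · exact fun h => Or.inl ⟨d, h, rfl⟩

theorem dummy_mem_history (e : Renaming r) (H : Finset ℕ) (j : Fin (r + 1)) :
    dummy j ∈ history e H := by
  simp only [history, Finset.mem_union, Finset.mem_image, Finset.mem_univ, true_and]
  exact Or.inr ⟨j, rfl⟩

theorem insert_history (e : Renaming r) (H : Finset ℕ) (d : ℕ) :
    insert (e.1 d) (history e H) = history e (insert d H) := by
  simp [history, Finset.image_insert, Finset.insert_union]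

/-- The guard of `τ` holds for the letter `d`. -/
def GuardHolds (g : Guard r) (ρ : RegAssignment r ℕ) (H : Finset ℕ) (d : ℕ) : Prop :=
  (∃ X, g = Guard.exactly X ∧ ∀ j, j ∈ X ↔ ρ j = some d) ∨ (g = Guard.fresh ∧ d ∉ H)

theorem fill_zero_eq_some {e : Renaming r} {σ : RegAssignment (r + 1) ℕ} {j : Fin (r + 1)} {d : ℕ} :
    fill e.1 σ (cell j 0) = some (e.1 d) ↔ σ j = some d := by
  rw [fill_cell_zero, Option.some_inj]
  cases h : σ j with
  | none => simpa using (e.2.2 d j).symm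
  | some a => simpa using e.2.1.eq_iff

theorem fill_one_ne_some {e : Renaming r} {σ : RegAssignment (r + 1) ℕ} {j : Fin (r + 1)} {d : ℕ} :
    fill e.1 σ (cell j 1) ≠ some (e.1 d) := by
  rw [fill_cell_one, Ne, Option.some_inj]
  exact (e.2.2 d j).symm

theorem fill_zero_eq_dummy {e : Renaming r} {σ : RegAssignment (r + 1) ℕ} {i j : Fin (r + 1)} :
    fill e.1 σ (cell i 0) = some (dummy j) ↔ i = j ∧ σ i = none := by
  rw [fill_cell_zero, Option.some_inj]
  cases h : σ i with
  | none => simp [dummy_inj, Fin.ext_iff]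
  | some a => simpa using e.2.2 a j

/-- A renamed name is never a dummy, so it can occur only in first cells, and there exactly where
the original name is stored. The auxiliary register is empty and thus holds only dummies. -/
theorem guardHolds_cellGuard {e : Renaming r} {g : Guard r} {ρ : RegAssignment r ℕ} {H : Finset ℕ}
    {d : ℕ} : GuardHolds (cellGuard g) (fill e.1 (widen ρ)) (history e H) (e.1 d) ↔
      GuardHolds g ρ H d := by
  cases g with
  | fresh => simp [GuardHolds, cellGuard, mem_history_renaming]
  | exactly X =>
    simp only [GuardHolds, cellGuard, Guard.exactly.injEq, exists_eq_left', reduceCtorEq, false_and,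
      or_false]
    constructor
    · intro h i
      have := h (cell i.castSucc 0)
      rw [fill_zero_eq_some, widen_castSucc] at this
      simpa [cell_inj] using this
    · intro h
      refine cell_cases (fun j => ?_) (fun j => ?_)
      · rw [fill_zero_eq_some]
        induction j using Fin.lastCases with
        | last => simp [cell_inj, Fin.castSucc_ne_last]
        | cast i => simp [cell_inj, h]
      · simp [cell_inj, -fill_cell_one, fill_one_ne_some]

/-- A dummy is never fresh, being in the history, and it sits in a second cell, whereas the guards
of storing transitions list first cells only. Hence letters read between sweeps avoid the dummies,
as a renaming requires. -/
theorem ne_dummy_of_guardHolds {e : Renaming r} {g : Guard r} {σ : RegAssignment (r + 1) ℕ}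
    {H : Finset ℕ} {d : ℕ} (h : GuardHolds (cellGuard g) (fill e.1 σ) (history e H) d)
    (j : Fin (r + 1)) : d ≠ dummy j := by
  rintro rfl
  cases g with
  | fresh => simp [GuardHolds, cellGuard, dummy_mem_history] at h
  | exactly X =>
    simp only [GuardHolds, cellGuard, Guard.exactly.injEq, exists_eq_left', reduceCtorEq, false_and,
      or_false] at h
    simpa [cell_inj] using h (cell j 1)

/-- Dummy `j` occurs in no cell of another register, always in the second cell of `j`, and in the
first exactly when `j` is empty. So of the two transitions for `j` exactly one is enabled, on this
letter only; this makes the sweep deterministic. -/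
theorem guardHolds_reset {e : Renaming r} {t : Fin T} {τ : RegTransition (Fin n) (Fin s) r}
    {j : Fin (r + 1)} {b : Bool} {σ : RegAssignment (r + 1) ℕ} {H : Finset ℕ} {d : ℕ} :
    GuardHolds (resetTrans t τ j b).guard (fill e.1 σ) H d ↔
      d = dummy j ∧ (b = true ↔ σ j = none) := by
  simp only [GuardHolds, resetTrans, Guard.exactly.injEq, exists_eq_left', reduceCtorEq, false_and,
      or_false]
  constructor
  · intro h
    have h₁ : d = dummy j := by
      have := (h (cell j 1)).1 (by cases b <;> simp)
      simpa using this.symm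
    subst h₁
    refine ⟨rfl, ?_⟩
    have := h (cell j 0)
    rw [fill_zero_eq_dummy] at this
    cases b <;> simpa [cell_inj] using this
  · rintro ⟨rfl, hb⟩
    refine cell_cases (fun i => ?_) (fun i => ?_)
    · rw [fill_zero_eq_dummy]
      cases b
      · simp only [Bool.false_eq_true, if_false, Finset.mem_singleton, cell_inj]
        constructor
        · rintro ⟨-, h⟩
          exact absurd h (by decide)
        · rintro ⟨rfl, h⟩
          exact absurd (hb.2 h) (by decide)
      · simp only [if_true, Finset.mem_insert, Finset.mem_singleton, cell_inj]
        constructor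
        · rintro (⟨rfl, -⟩ | ⟨-, h⟩)
          · exact ⟨rfl, hb.1 rfl⟩
          · exact absurd h (by decide)
        · rintro ⟨rfl, -⟩
          exact Or.inl ⟨rfl, trivial⟩
    · rw [fill_cell_one, Option.some_inj, dummy_inj, Fin.val_inj]
      cases b <;> simp [cell_inj]

theorem update_storeTrans (e : ℕ → ℕ) (t : Fin T) (τ : RegTransition (Fin n) (Fin s) r)
    (σ : RegAssignment (r + 1) ℕ) (d : ℕ) :
    (storeTrans t τ).update (fill e σ) (e d) =
      fill e (Function.update σ (storeReg τ.target) (some d)) := by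
  funext k
  induction k using cell_cases with
  | h₀ j =>
    by_cases h : j = storeReg τ.target
    · subst h
      simp [RegTransition.update, storeTrans]
    · simp [RegTransition.update, storeTrans, cell_inj, h, Ne.symm h]
  | h₁ j => simp [RegTransition.update, storeTrans, cell_inj]

/-- Writing the dummy to the first cell empties the register; writing it to the second cell
overwrites the dummy by itself, which provides a retaining move that still has a target. -/
theorem update_resetTrans (e : ℕ → ℕ) (t : Fin T) (τ : RegTransition (Fin n) (Fin s) r)
    (j : Fin (r + 1)) (b : Bool) (σ : RegAssignment (r + 1) ℕ) :
    (resetTrans t τ j b).update (fill e σ) (dummy j) =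
      fill e (if j ∈ emptied τ then Function.update σ j none else σ) := by
  funext k
  induction k using cell_cases with
  | h₀ i =>
    by_cases h : i = j
    · subst h
      by_cases h' : i ∈ emptied τ <;> simp [RegTransition.update, resetTrans, h', cell_inj]
    · by_cases h' : j ∈ emptied τ <;>
        simp [RegTransition.update, resetTrans, h', cell_inj, h, Ne.symm h]
  | h₁ i =>
    by_cases h : i = j
    · subst h
      by_cases h' : i ∈ emptied τ <;> simp [RegTransition.update, resetTrans, h', cell_inj]
    · by_cases h' : j ∈ emptied τ <;>
        simp [RegTransition.update, resetTrans, h', cell_inj, Ne.symm h]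

/-- Storing first and erasing afterwards gives the same result as the simultaneous update because
the target is not among the erased registers. A letter with target `0` goes to the auxiliary
register, which every sweep empties. -/
theorem widen_update (τ : RegTransition (Fin n) (Fin s) r) (ρ : RegAssignment r ℕ) (d : ℕ) :
    (fun j => if j ∈ emptied τ then none
      else Function.update (widen ρ) (storeReg τ.target) (some d) j) = widen (τ.update ρ d) := by
  funext j
  induction j using Fin.lastCases with
  | last => simp [last_mem_emptied]
  | cast i =>
    simp only [castSucc_mem_emptied, widen_castSucc, RegTransition.update]
    cases h : τ.target with
    | none => simp [storeReg, Function.update, Fin.castSucc_ne_last]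
    | some i' =>
      have := τ.target_notMem_erase i' h
      by_cases hi : i' = i
      · subst hi
        simp [storeReg, this]
      · simp [storeReg, hi, Function.update, Ne.symm hi]

/-- The single assignment discipline is preserved by steps. -/
theorem update_mem_admissible {τ : RegTransition (Fin n) (Fin s) r} (hτ : τ.Permitted .S .E)
    {ρ : RegAssignment r ℕ} {H : Finset ℕ} {d : ℕ} (hρ : ρ ∈ admissible .S .E r ℕ)
    (hH : ∀ i d, ρ i = some d → d ∈ H) (hg : GuardHolds τ.guard ρ H d) :
    τ.update ρ d ∈ admissible .S .E r ℕ := by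
  -- Under `S` the letter is either fresh, hence stored nowhere, or stored in the target at most. So
  -- writing it to the target creates no duplicate.
  have hd : ∀ j, ρ j = some d → τ.target = some j := by
    intro j hj
    rcases hg with ⟨X, hX, hg⟩ | ⟨-, hg⟩
    · rcases hτ.1 rfl with h | ⟨G, hG, h⟩
      · simp [h] at hX
      · rw [hX] at hG
        cases hG
        exact h j ((hg j).2 hj)
    · exact absurd (hH _ _ hj) hg
  refine ⟨fun _ i j hij => ?_, by simp⟩
  have hρ' := hρ.1 rfl i j
  unfold RegTransition.update at hij ⊢
  by_cases hi : τ.target = some i <;> by_cases hj : τ.target = some j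
  · exact Or.inl (Option.some_inj.1 (hi.symm.trans hj))
  · rw [if_pos hi, if_neg hj] at hij
    split_ifs at hij
    exact absurd (hd j hij.symm) hj
  · rw [if_neg hi, if_pos hj] at hij
    split_ifs at hij
    exact absurd (hd i hij) hi
  · rw [if_neg hi, if_neg hj] at hij ⊢
    by_cases hi' : i ∈ τ.erase <;> by_cases hj' : j ∈ τ.erase
    · simp [hi', hj']
    · rw [if_pos hi', if_neg hj'] at hij
      simp [hi', hj', ← hij]
    · rw [if_neg hi', if_pos hj'] at hij
      simp [hi', hj', hij]
    · rw [if_neg hi', if_neg hj'] at hij ⊢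
      exact hρ' hij

end Filling

theorem FRA.Config.ext_of_eq {Q T D : Type} {r : ℕ} {A : Set (RegAssignment r D)} {𝒜 : FRA Q T D r A}
    {κ₁ κ₂ : 𝒜.Config} (h₁ : κ₁.state = κ₂.state) (h₂ : κ₁.reg = κ₂.reg) (h₃ : κ₁.hist = κ₂.hist) :
    κ₁ = κ₂ := by
  cases κ₁
  cases κ₂
  simp_all

/-! ### Encoded configurations and correctness of the filling simulation. -/

namespace Filling

variable {k : Option ℕ}

/-- A configuration of the simulating automaton. -/
def config (x : BisimInput k .S .E) (e : Renaming x.aut.regs)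
    (q : Fin x.aut.states ⊕ (Fin x.aut.trans.length × Fin (x.aut.regs + 1)))
    (σ : RegAssignment (x.aut.regs + 1) ℕ) (H : Finset ℕ) (h : ∀ i d, σ i = some d → d ∈ H) :
    (input x).toFRA.Config where
  state := stateEquiv _ _ _ q
  reg := fill e.1 σ
  hist := history e H
  reg_mem := fill_mem_admissible _ _
  range_subset := by
    intro c
    induction c using cell_cases with
    | h₀ j =>
      intro d hd
      rw [fill_cell_zero, Option.some_inj] at hd
      cases hj : σ j with
      | none =>
        rw [hj] at hd
        exact hd ▸ dummy_mem_history e H j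
      | some a =>
        rw [hj] at hd
        exact hd ▸ mem_history_renaming.2 (h j a hj)
    | h₁ j =>
      intro d hd
      rw [fill_cell_one, Option.some_inj] at hd
      exact hd ▸ dummy_mem_history e H j

theorem config_congr {x : BisimInput k .S .E} {e : Renaming x.aut.regs} {q}
    {σ σ' : RegAssignment (x.aut.regs + 1) ℕ} {H : Finset ℕ} {h h'} (hσ : σ = σ') :
    config x e q σ H h = config x e q σ' H h' := by
  subst hσ
  rfl

theorem widen_range {r : ℕ} {ρ : RegAssignment r ℕ} {H : Finset ℕ} (h : ∀ i d, ρ i = some d → d ∈ H) :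
    ∀ i d, widen ρ i = some d → d ∈ H := by
  intro i d
  induction i using Fin.lastCases with
  | last => simp
  | cast i => simpa using h i d

/-- The configuration that represents a given one. -/
def enc (x : BisimInput k .S .E) (e : Renaming x.aut.regs) (κ : x.toFRA.Config) :
    (input x).toFRA.Config :=
  config x e (Sum.inl κ.state) (widen κ.reg) κ.hist (widen_range κ.range_subset)

/-- The dummy names from the `j`-th one on, with the tag `t`. -/
def resetWord (r : ℕ) {s : ℕ} (t : Fin s) (j : ℕ) : List (Fin s × ℕ) :=
  ((List.finRange (r + 1)).drop j).map fun i : Fin (r + 1) => (t, dummy i)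

theorem resetWord_cast (r : ℕ) {s : ℕ} (t : Fin s) (i : Fin (r + 1)) :
    resetWord r t i = (t, dummy i) :: resetWord r t (i + 1) := by
  unfold resetWord
  rw [List.drop_eq_getElem_cons (by simpa using i.is_le)]
  simp

theorem step_input_iff {x : BisimInput k .S .E} {l} {κ κ' : (input x).toFRA.Config} :
    (input x).toFRA.Step l κ κ' ↔ ∃ τ ∈ allTrans x.aut.trans, τ.src = κ.state ∧ τ.tag = l.1 ∧
      τ.dst = κ'.state ∧ GuardHolds τ.guard κ.reg κ.hist l.2 ∧ κ'.reg = τ.update κ.reg l.2 ∧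
      κ'.hist = insert l.2 κ.hist :=
  Iff.rfl

theorem step_iff {X : Storage} {Y : Emptiness} {x : BisimInput k X Y} {l} {κ κ' : x.toFRA.Config} :
    x.toFRA.Step l κ κ' ↔ ∃ τ ∈ x.aut.trans, τ.src = κ.state ∧ τ.tag = l.1 ∧
      τ.dst = κ'.state ∧ GuardHolds τ.guard κ.reg κ.hist l.2 ∧ κ'.reg = τ.update κ.reg l.2 ∧
      κ'.hist = insert l.2 κ.hist :=
  Iff.rfl

/-- The configuration reached by resetting register `j`. -/
theorem step_config_inr {x : BisimInput k .S .E} {e : Renaming x.aut.regs} {t j σ H h}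
    {l} {y : (input x).toFRA.Config} :
    (input x).toFRA.Step l (config x e (Sum.inr (t, j)) σ H h) y ↔
      l = ((x.aut.trans.get t).tag, dummy j) ∧
      y = config x e (nextState t (x.aut.trans.get t) j)
        (if j ∈ emptied (x.aut.trans.get t) then Function.update σ j none else σ) H (by
          intro i d hi
          split_ifs at hi
          · by_cases hij : i = j
            · simp [hij] at hi
            · exact h i d (by simpa [hij] using hi)
          · exact h i d hi) := by
  -- The dummies belong to the history from the start, so the sweep leaves the history unchanged.
  have hins : insert (dummy j) (history e H) = history e H :=
    Finset.insert_eq_self.2 (dummy_mem_history e H j)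
  rw [step_input_iff]
  constructor
  · rintro ⟨τ, hτ, h₁, h₂, h₃, h₄, h₅, h₆⟩
    obtain ⟨t', rfl | ⟨j', b, rfl⟩⟩ := mem_allTrans.1 hτ
    · exact absurd ((stateEquiv _ _ _).injective h₁) nofun
    · obtain ⟨rfl, rfl⟩ : t' = t ∧ j' = j := by
        simpa using (stateEquiv _ _ _).injective h₁
      obtain ⟨hd, hb⟩ := guardHolds_reset.1 h₄
      refine ⟨Prod.ext h₂.symm hd, FRA.Config.ext_of_eq h₃.symm ?_ ?_⟩
      · rw [h₅, hd]
        exact update_resetTrans ..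
      · rw [h₆, hd]
        exact hins
  · rintro ⟨rfl, rfl⟩
    -- The Boolean is chosen according to whether the register is empty, which selects the enabled
    -- one of the two transitions.
    exact ⟨resetTrans t _ j (decide (σ j = none)), mem_allTrans.2 ⟨t, Or.inr ⟨j, _, rfl⟩⟩, rfl, rfl,
      rfl, guardHolds_reset.2 ⟨rfl, by simp⟩, (update_resetTrans ..).symm, hins.symm⟩

/-- After a transition, the dummy names are read in turn. -/
theorem forced_resetWord {x : BisimInput k .S .E} {e : Renaming x.aut.regs} {t}
    {H : Finset ℕ} (j : Fin (x.aut.regs + 1)) : ∀ (σ : RegAssignment (x.aut.regs + 1) ℕ) (h) (σ') (h'),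
      σ' = (fun i => if i ∈ emptied (x.aut.trans.get t) ∧ j ≤ i then none else σ i) →
      Forced (input x).toFRA.Step (resetWord (s := x.aut.tags) x.aut.regs (x.aut.trans.get t).tag j)
        (config x e (Sum.inr (t, j)) σ H h)
        (config x e (Sum.inl (x.aut.trans.get t).dst) σ' H h') := by
  -- The sweep proceeds upwards, so the induction runs down from the auxiliary register, whose reset
  -- leads back to a proper state.
  induction j using Fin.reverseInduction with
  | last =>
    intro σ h σ' h' hσ
    rw [resetWord_cast (s := x.aut.tags)]
    refine ⟨_, step_config_inr.2 ⟨rfl, rfl⟩, fun l' x'' hs => step_config_inr.1 hs, ?_⟩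
    have : resetWord (s := x.aut.tags) x.aut.regs (x.aut.trans.get t).tag (Fin.last x.aut.regs + 1) = [] := by
      unfold resetWord
      rw [List.drop_eq_nil_of_le (by simp), List.map_nil]
    rw [this]
    change config x e _ _ H _ = _
    have hn : nextState t (x.aut.trans.get t) (Fin.last x.aut.regs) =
      Sum.inl (x.aut.trans.get t).dst := by simp [nextState]
    simp only [hn]
    apply config_congr
    subst hσ
    rw [if_pos (last_mem_emptied _)]
    funext i
    by_cases hi : i = Fin.last _
    · subst hi
      simp [last_mem_emptied]
    · have : ¬ Fin.last x.aut.regs ≤ i := fun h => hi (Fin.last_le_iff.1 h)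
      simp [hi, this]
  | cast j ih =>
    intro σ h σ' h' hσ
    rw [resetWord_cast (s := x.aut.tags)]
    refine ⟨_, step_config_inr.2 ⟨rfl, rfl⟩, fun l' x'' hs => step_config_inr.1 hs, ?_⟩
    have hn : nextState t (x.aut.trans.get t) j.castSucc = Sum.inr (t, j.succ) := by
      simp [nextState]
    simp only [hn]
    refine ih _ _ _ _ ?_
    subst hσ
    funext i
    by_cases hi : i = j.castSucc
    · subst hi
      by_cases hj : j.castSucc ∈ emptied (x.aut.trans.get t)
      · simp only [hj, le_refl, and_self, if_true, Function.update_self, ite_self]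
      · simp only [hj, false_and, if_false]
    · have : j.castSucc ≤ i ↔ j.succ ≤ i := by
        rw [Fin.le_def, Fin.le_def]
        have : (i : ℕ) ≠ j := fun h => hi (Fin.ext h)
        simp
        omega
      by_cases hj : j.castSucc ∈ emptied (x.aut.trans.get t) 
      · simp only [hj, if_true, this, Function.update_of_ne hi]
      · simp only [hj, if_false, this]

/-- The configuration reached by storing the letter. -/
theorem step_config_inl {x : BisimInput k .S .E} {e : Renaming x.aut.regs} {q σ H h}
    {l} {y : (input x).toFRA.Config}
    (hs : (input x).toFRA.Step l (config x e (Sum.inl q) σ H h) y) :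
    ∃ t, (x.aut.trans.get t).src = q ∧ (x.aut.trans.get t).tag = l.1 ∧
      GuardHolds (cellGuard (x.aut.trans.get t).guard) (fill e.1 σ) (history e H) l.2 ∧
      y.state = stateEquiv _ _ _ (Sum.inr (t, 0)) ∧
      y.reg = (storeTrans t (x.aut.trans.get t)).update (fill e.1 σ) l.2 ∧
      y.hist = insert l.2 (history e H) := by
  obtain ⟨τ, hτ, h₁, h₂, h₃, h₄, h₅, h₆⟩ := step_input_iff.1 hs
  obtain ⟨t', rfl | ⟨j', b, rfl⟩⟩ := mem_allTrans.1 hτ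
  · exact ⟨t', by simpa using (stateEquiv _ _ _).injective h₁, h₂, h₄, h₃.symm, h₅, h₆⟩
  · exact absurd ((stateEquiv _ _ _).injective h₁) nofun

theorem store_range {r n s : ℕ} {τ : RegTransition (Fin n) (Fin s) r} {ρ : RegAssignment r ℕ}
    {H : Finset ℕ} (h : ∀ i d, ρ i = some d → d ∈ H) (d : ℕ) :
    ∀ i d', Function.update (widen ρ) (storeReg τ.target) (some d) i = some d' → d' ∈ insert d H := by
  intro i d' hd
  by_cases hi : i = storeReg τ.target
  · subst hi
    simp_all
  · rw [Function.update_of_ne hi] at hd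
    exact Finset.mem_insert_of_mem (widen_range h i d' hd)

/-- The configuration after the letter has been stored leads to the expected configuration. -/
theorem forced_store {x : BisimInput k .S .E} {e : Renaming x.aut.regs} {t}
    {κ κ' : x.toFRA.Config} {d : ℕ} (hs : (x.aut.trans.get t).dst = κ'.state)
    (hr : κ'.reg = (x.aut.trans.get t).update κ.reg d) (hh : κ'.hist = insert d κ.hist) :
    Forced (input x).toFRA.Step (resetWord (s := x.aut.tags) x.aut.regs (x.aut.trans.get t).tag 0)
      (config x e (Sum.inr (t, 0))
        (Function.update (widen κ.reg) (storeReg (x.aut.trans.get t).target) (some d))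
        (insert d κ.hist) (store_range κ.range_subset d)) (enc x e κ') := by
  obtain ⟨q, ρ, H, hρ, hH⟩ := κ'
  dsimp only at hs hr hh
  subst hs hr hh
  refine forced_resetWord 0 _ _ _ _ ?_
  rw [← widen_update]
  simp

/-- A renaming that agrees with a given one on a finite set and takes a given value. -/
theorem exists_renaming {r : ℕ} (e : Renaming r) (H : Finset ℕ) (d' : ℕ)
    (hd : ∀ j : Fin (r + 1), d' ≠ dummy j) :
    ∃ (e' : Renaming r) (d : ℕ), e'.1 d = d' ∧ ∀ a ∈ H, e'.1 a = e.1 a := by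
  by_cases h : ∃ d, e.1 d = d'
  · obtain ⟨d, rfl⟩ := h
    exact ⟨e, d, rfl, fun _ _ => rfl⟩
  -- A name `m` outside `H` is redirected to `d'`; injectivity survives because `d'` was not a value
  -- of `e`.
  · obtain ⟨m, hm⟩ := Infinite.exists_notMem_finset H
    refine ⟨⟨Function.update e.1 m d', ?_, ?_⟩, m, by simp, fun a ha => ?_⟩
    · intro a b hab
      by_cases ha : a = m <;> by_cases hb : b = m
      · rw [ha, hb]
      · exact absurd ⟨b, by simpa [ha, hb] using hab.symm⟩ h
      · exact absurd ⟨a, by simpa [ha, hb] using hab⟩ h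
      · exact e.2.1 (by simpa [ha, hb] using hab)
    · intro a j
      by_cases ha : a = m
      · simpa [ha] using hd j
      · simpa [ha] using e.2.2 a j
    · exact Function.update_of_ne (fun h : a = m => hm (h ▸ ha)) _ _

theorem enc_congr {x : BisimInput k .S .E} {e e' : Renaming x.aut.regs} {κ : x.toFRA.Config}
    (h : ∀ a ∈ κ.hist, e'.1 a = e.1 a) : enc x e' κ = enc x e κ := by
  refine FRA.Config.ext_of_eq rfl ?_ ?_
  · funext c
    change fill e'.1 (widen κ.reg) c = fill e.1 (widen κ.reg) c
    induction c using cell_cases with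
    | h₀ j =>
      rw [fill_cell_zero, fill_cell_zero]
      cases hj : widen κ.reg j with
      | none => rfl
      | some a => exact congrArg some (h a (widen_range κ.range_subset j a hj))
    | h₁ j => rw [fill_cell_one, fill_cell_one]
  · change history e' κ.hist = history e κ.hist
    unfold history
    rw [Finset.image_congr (f := e'.1) (g := e.1) h]

/-- A simulated step is a storing step followed by a sweep whose word depends only on the tag, hence
is the same on both sides of a match. Letters of storing steps are never dummies, so a renaming that
agrees with `e` on both histories reaches them. -/
theorem bisimilar_enc (x : BisimInput k .S .E) (e : Renaming x.aut.regs) (κ₁ κ₂ : x.toFRA.Config) :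
    Bisimilar x.toFRA.Step κ₁ κ₂ ↔ Bisimilar (input x).toFRA.Step (enc x e κ₁) (enc x e κ₂) := by
  refine bisimilar_iff_of_encoding (enc x) (fun e l => (l.1, e.1 l.2))
    (fun l => resetWord (s := x.aut.tags) x.aut.regs l.1 0) ?_ ?_ ?_ e κ₁ κ₂
  · rintro e ⟨a, d⟩ κ κ' hs
    obtain ⟨τ, hτ, h₁, rfl, h₃, h₄, h₅, h₆⟩ := step_iff.1 hs
    obtain ⟨t, rfl⟩ := List.get_of_mem hτ
    refine ⟨_, step_input_iff.2 ⟨storeTrans t (x.aut.trans.get t), mem_allTrans.2 ⟨t, Or.inl rfl⟩,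
      congrArg (fun q => stateEquiv _ _ _ (Sum.inl q)) h₁, rfl, rfl, guardHolds_cellGuard.2 h₄,
      (update_storeTrans ..).symm, (insert_history ..).symm⟩, forced_store h₃ h₅ h₆⟩
  · rintro e ⟨a, d⟩ κ y hs
    obtain ⟨t, h₁, rfl, h₃, h₄, h₅, h₆⟩ := step_config_inl hs
    have hg := guardHolds_cellGuard.1 h₃
    let κ' : x.toFRA.Config := ⟨(x.aut.trans.get t).dst, (x.aut.trans.get t).update κ.reg d,
      insert d κ.hist,
      -- The class `MF` says nothing about injectivity, so the admissibility of the decoded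
      -- assignment has to be derived from the guard.
      update_mem_admissible (x.permitted _ (List.get_mem _ _)) κ.reg_mem κ.range_subset hg,
      FRA.update_range κ.range_subset⟩
    refine ⟨κ', step_iff.2 ⟨x.aut.trans.get t, List.get_mem _ _, h₁, rfl, rfl, hg, rfl, rfl⟩, ?_⟩
    have hy := forced_store (e := e) (t := t) (κ := κ) (κ' := κ') rfl rfl rfl
    convert! hy using 1
    exact FRA.Config.ext_of_eq h₄ (h₅.trans (update_storeTrans ..))
      (h₆.trans (insert_history ..))
  · rintro e κ₁ κ₂ ⟨a, d'⟩ y hs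
    obtain ⟨t, -, -, h₃, -⟩ := step_config_inl hs
    obtain ⟨e', d, rfl, he⟩ := exists_renaming e (κ₁.hist ∪ κ₂.hist) d' (ne_dummy_of_guardHolds h₃)
    exact ⟨e', (a, d), rfl, enc_congr fun b hb => he b (Finset.mem_union_left _ hb),
      enc_congr fun b hb => he b (Finset.mem_union_right _ hb)⟩

end Filling

/-! ## The instances computed by the reductions -/

/-- The names in an assignment, register by register. -/
def RegAssignment.names {r : ℕ} (ρ : RegAssignment r ℕ) : List ℕ := (List.ofFn ρ).reduceOption

theorem RegAssignment.mem_names {r : ℕ} {ρ : RegAssignment r ℕ} {i : Fin r} {d : ℕ}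
    (h : ρ i = some d) : d ∈ names ρ := by
  rw [names, List.reduceOption_mem_iff, List.mem_ofFn']
  exact ⟨i, h⟩

/-- An instance for RA as an instance for FRA, with the names in the assignments as history. -/
def RAInput.toFRAInput {k : Option ℕ} {X : Storage} {Y : Emptiness} (x : RAInput k X Y) :
    FRAInput k X Y where
  toBisimInput := x.toBisimInput
  hist := RegAssignment.names x.ρ₁ ++ RegAssignment.names x.ρ₂
  range₁_subset := fun _ _ h => List.mem_append_left _ (RegAssignment.mem_names h)
  range₂_subset := fun _ _ h => List.mem_append_right _ (RegAssignment.mem_names h)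

/-- Any common history that contains both ranges will do, which leaves the choice to the
application. -/
theorem RAInput.yes_iff_of_hist {k : Option ℕ} {X : Storage} {Y : Emptiness} (x : RAInput k X Y)
    (H : Finset ℕ) (h₁ : ∀ i d, x.ρ₁ i = some d → d ∈ H) (h₂ : ∀ i d, x.ρ₂ i = some d → d ∈ H) :
    x.Yes ↔ Bisimilar x.toFRA.Step ⟨x.q₁, x.ρ₁, H, x.ρ₁_mem, h₁⟩ ⟨x.q₂, x.ρ₂, H, x.ρ₂_mem, h₂⟩ :=
  (FRA.bisimilar_toRA x.isRA ⟨x.q₁, x.ρ₁, H, x.ρ₁_mem, h₁⟩ ⟨x.q₂, x.ρ₂, H, x.ρ₂_mem, h₂⟩).symm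

theorem RAInput.yes_iff_toFRAInput {k : Option ℕ} {X : Storage} {Y : Emptiness} (x : RAInput k X Y) :
    x.Yes ↔ x.toFRAInput.Yes :=
  x.yes_iff_of_hist _ _ _

namespace Filling

variable {k : Option ℕ}

/-- The simulating instance for RA. -/
def raInput (x : RAInput k .S .E) : RAInput k .M .F where
  toBisimInput := input x.toBisimInput
  isRA := isRA_input x.isRA

/-- The history of the simulating instance. -/
def histList (r : ℕ) (H : List ℕ) : List ℕ :=
  H.map (fun d => 2 * d + 1) ++ (List.range (r + 1)).map dummy

theorem toFinset_histList (r : ℕ) (H : List ℕ) :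
    (histList r H).toFinset = history (double r) H.toFinset := by
  ext a
  simp only [histList, history, double, List.toFinset_append, Finset.mem_union, List.mem_toFinset,
    List.mem_map, List.mem_range, Finset.mem_image, Finset.mem_univ, true_and]
  refine or_congr Iff.rfl ⟨?_, ?_⟩
  · rintro ⟨j, hj, rfl⟩
    exact ⟨⟨j, hj⟩, rfl⟩
  · rintro ⟨j, rfl⟩
    exact ⟨j, j.2, rfl⟩

/-- The simulating instance for FRA. -/
def fraInput (x : FRAInput k .S .E) : FRAInput k .M .F where
  toBisimInput := input x.toBisimInput
  hist := histList x.aut.regs x.hist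
  range₁_subset := fun i d h => by
    rw [← List.mem_toFinset, toFinset_histList]
    exact (config x.toBisimInput (double _) (Sum.inl x.q₁) (widen x.ρ₁) x.hist.toFinset
      (widen_range fun i d h => List.mem_toFinset.2 (x.range₁_subset i d h))).range_subset i d h
  range₂_subset := fun i d h => by
    rw [← List.mem_toFinset, toFinset_histList]
    exact (config x.toBisimInput (double _) (Sum.inl x.q₂) (widen x.ρ₂) x.hist.toFinset
      (widen_range fun i d h => List.mem_toFinset.2 (x.range₂_subset i d h))).range_subset i d h

theorem yes_fraInput (x : FRAInput k .S .E) : x.Yes ↔ (fraInput x).Yes := by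
  unfold FRAInput.Yes
  rw [bisimilar_enc x.toBisimInput (double _)]
  refine iff_of_eq (congrArg₂ (Bisimilar _) ?_ ?_) <;>
    exact FRA.Config.ext_of_eq rfl rfl (toFinset_histList _ _).symm

/-- A history is added only for the argument: the encoding is applied at the level of FRA, and then
the history of the simulating RA is forgotten. -/
theorem yes_raInput (x : RAInput k .S .E) : x.Yes ↔ (raInput x).Yes := by
  have h := fun H h₁ h₂ => x.yes_iff_of_hist H h₁ h₂
  have h₁ : ∀ i d, x.ρ₁ i = some d →
      d ∈ (RegAssignment.names x.ρ₁ ++ RegAssignment.names x.ρ₂).toFinset := fun i d h =>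
    List.mem_toFinset.2 (List.mem_append_left _ (RegAssignment.mem_names h))
  have h₂ : ∀ i d, x.ρ₂ i = some d →
      d ∈ (RegAssignment.names x.ρ₁ ++ RegAssignment.names x.ρ₂).toFinset := fun i d h =>
    List.mem_toFinset.2 (List.mem_append_right _ (RegAssignment.mem_names h))
  rw [x.yes_iff_of_hist _ h₁ h₂, bisimilar_enc x.toBisimInput (double _)]
  exact FRA.bisimilar_toRA (raInput x).isRA _ _

end Filling

namespace StackProg

open CodeSym

/-! ### Whole runs -/

/-- Moves the contents of a stack to another one, in reverse order. -/
def move (k k' : Stk) : StackProg Stk CodeSym :=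
  loop k (fun _ => false) (push k')

theorem runs_move_out_fin (i b : List CodeSym) (e : Env) : ∀ o f,
    Runs (move .out .fin) (stk i o b f e) (stk i [] b (o.reverse ++ f) e) (2 * o.length + 1)
  | [], f => Runs.loop_nil rfl
  | a :: o, f => by
    have h := runs_move_out_fin i b e o (a :: f)
    have h' := Runs.loop_step (k := Stk.out) (exits := fun _ => false) (body := push .fin)
      (S := stk i (a :: o) b f e) (a := a) (w := o) (m := 1) rfl rfl
      (S' := stk i o b (a :: f) e)
      (by simpa [stk] using Runs.push Stk.fin a (stk i o b f e)) h
    rw [show 1 + (2 * o.length + 1) + 1 = 2 * (a :: o).length + 1 by simp; ring] at h'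
    simpa [move] using h'

theorem runs_move_buf_fin (i o : List CodeSym) (e : Env) : ∀ b f,
    Runs (move .buf .fin) (stk i o b f e) (stk i o [] (b.reverse ++ f) e) (2 * b.length + 1)
  | [], f => Runs.loop_nil rfl
  | a :: b, f => by
    have h := runs_move_buf_fin i o e b (a :: f)
    have h' := Runs.loop_step (k := Stk.buf) (exits := fun _ => false) (body := push .fin)
      (S := stk i o (a :: b) f e) (a := a) (w := b) (m := 1) rfl rfl
      (S' := stk i o b (a :: f) e)
      (by simpa [stk] using Runs.push Stk.fin a (stk i o b f e)) h
    rw [show 1 + (2 * b.length + 1) + 1 = 2 * (a :: b).length + 1 by simp; ring] at h'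
    simpa [move] using h'

theorem runs_move_fin_buf (i o : List CodeSym) (e : Env) : ∀ f b,
    Runs (move .fin .buf) (stk i o b f e) (stk i o (f.reverse ++ b) [] e) (2 * f.length + 1)
  | [], b => Runs.loop_nil rfl
  | a :: f, b => by
    have h := runs_move_fin_buf i o e f (a :: b)
    have h' := Runs.loop_step (k := Stk.fin) (exits := fun _ => false) (body := push .buf)
      (S := stk i o b (a :: f) e) (a := a) (w := f) (m := 1) rfl rfl
      (S' := stk i o (a :: b) f e)
      (by simpa [stk] using Runs.push Stk.buf a (stk i o b f e)) h
    rw [show 1 + (2 * f.length + 1) + 1 = 2 * (a :: f).length + 1 by simp; ring] at h'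
    simpa [move] using h'

theorem runs_push_fin (i o b f : List CodeSym) (e : Env) (a : CodeSym) :
    Runs (push .fin a) (stk i o b f e) (stk i o b (a :: f) e) 1 := by
  simpa [stk] using Runs.push Stk.fin a (stk i o b f e)

/-- Clears a counter, putting as many copies of a symbol in front of the final result. -/
def unload (x : Counter) (a : CodeSym) : StackProg Stk CodeSym :=
  loop (.ctr x) (fun _ => false) fun _ => push .fin a

theorem runs_unload (i o b : List CodeSym) (x : Counter) (a : CodeSym) : ∀ (n : ℕ) (e : Env) (f),
    e.get x = n → Runs (unload x a) (stk i o b f e)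
      (stk i o b (List.replicate n a ++ f) (e.set x 0)) (2 * n + 1)
  | 0, e, f, h => by
    rw [← h, Env.set_get, h]
    exact Runs.loop_nil (by simp [stk, h])
  | n + 1, e, f, h => by
    have h₁ := runs_unload i o b x a n (e.set x n) (a :: f) (by simp)
    rw [Env.set_set] at h₁
    have h' := Runs.loop_step (k := Stk.ctr x) (exits := fun _ => false)
      (body := fun _ => push .fin a) (S := stk i o b f e) (a := one) (w := List.replicate n one)
      (m := 1) (by simp [stk, h, List.replicate_succ]) rfl (S' := stk i o b (a :: f) (e.set x n))
      (by
        rw [update_stk_ctr]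
        simpa [stk] using Runs.push Stk.fin a (stk i o b f (e.set x n))) h₁
    rw [show 1 + (2 * n + 1) + 1 = 2 * (n + 1) + 1 by ring] at h'
    simpa [unload, List.replicate_succ'] using h'

/-- Clears a counter. -/
def clear (x : Counter) : StackProg Stk CodeSym :=
  loop (.ctr x) (fun _ => false) fun _ => skip

theorem Transduces.clear (x : Counter) : ∀ (n : ℕ) (e : Env), e.get x = n →
    Transduces (clear x) e [] [] [] (e.set x 0) (n + 1)
  | 0, e, h => by
    rw [← h, Env.set_get, h]
    exact Transduces.loopCtr_zero h
  | n + 1, e, h => by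
    have h₁ := Transduces.loopCtr_succ h (Transduces.skip _)
      (Transduces.clear x n (e.set x n) (by simp))
    rw [Env.set_set] at h₁
    exact h₁.mono (by omega)

theorem update_inp_eq (w : List CodeSym) :
    Function.update (fun _ => []) Stk.inp w = stk w [] [] [] {} := by
  funext k
  cases k with
  | ctr x => cases x <;> rfl
  | _ => rfl

theorem update_fin_eq (w : List CodeSym) :
    Function.update (fun _ => []) Stk.fin w = stk [] [] [] w {} := by
  funext k
  cases k with
  | ctr x => cases x <;> rfl
  | _ => rfl

theorem Transduces.congr {p : StackProg Stk CodeSym} {e e' : Env} {u v c u' v' c' : List CodeSym}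
    {n : ℕ} (h : Transduces p e u v c e' n) (hu : u = u') (hv : v = v') (hc : c = c') :
    Transduces p e u' v' c' e' n :=
  hu ▸ hv ▸ hc ▸ h

/-! ### Copying instances and collecting names -/

/-- Appends a symbol to the first output, and to the second one if `rec` holds. -/
def put (rec : Bool) (a : CodeSym) : StackProg Stk CodeSym :=
  if rec then seq (push .out a) (push .buf a) else push .out a

/-- The word if `rec` holds, the empty word otherwise. -/
def onlyIf (rec : Bool) (w : List CodeSym) : List CodeSym := if rec then w else []

theorem onlyIf_append (rec : Bool) (v w : List CodeSym) :
    onlyIf rec (v ++ w) = onlyIf rec v ++ onlyIf rec w := by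
  cases rec <;> rfl

theorem onlyIf_nil (rec : Bool) : onlyIf rec [] = [] := by
  cases rec <;> rfl

theorem Transduces.put (rec : Bool) (a : CodeSym) (e : Env) :
    Transduces (put rec a) e [] [a] (onlyIf rec [a]) e 2 := by
  cases rec
  · exact (Transduces.pushOut a e).mono (by omega)
  · exact (Transduces.pushOut a e).seq (Transduces.pushBuf a e)

/-- Copies the rest of a name. -/
def copyName (rec : Bool) : StackProg Stk CodeSym :=
  seq (loop .inp isSep (put rec)) (put rec sep)

theorem Transduces.copyNameLoop (rec : Bool) : ∀ {w : List CodeSym}, (∀ a ∈ w, a ≠ sep) → ∀ e,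
    Transduces (loop .inp isSep (StackProg.put rec)) e (w ++ [sep]) w (onlyIf rec w) e
      (3 * w.length + 1)
  | [], _, e => by
    rw [onlyIf_nil]
    exact Transduces.loopInp_done rfl e
  | a :: w, h, e => by
    have h₁ := Transduces.loopInp_step (exits := isSep) (body := StackProg.put rec) (a := a)
      (by simpa [isSep] using h a) (Transduces.put rec a e)
      (Transduces.copyNameLoop rec (fun b hb => h b (List.mem_cons_of_mem _ hb)) e)
    rw [← onlyIf_append] at h₁
    exact (by simpa using h₁ : Transduces _ e _ _ _ _ _).mono (by simp; omega)

theorem Transduces.copyName (rec : Bool) {w : List CodeSym} (h : ∀ a ∈ w, a ≠ sep) (e : Env) :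
    Transduces (copyName rec) e (w ++ [sep]) (w ++ [sep]) (onlyIf rec (w ++ [sep])) e
      (3 * w.length + 3) := by
  rw [onlyIf_append]
  simpa [StackProg.copyName] using (Transduces.copyNameLoop rec h e).seq (Transduces.put rec sep e)

/-- Marks the beginning of a name on the second output. -/
def mark (rec : Bool) : StackProg Stk CodeSym := if rec then push .buf hash else skip

theorem Transduces.mark (rec : Bool) (e : Env) :
    Transduces (mark rec) e [] [] (onlyIf rec [hash]) e 1 := by
  cases rec
  · exact (Transduces.skip e).mono (by omega)
  · exact Transduces.pushBuf hash e

/-- Copies the contents of a register. -/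
def copyContent (rec : Bool) : StackProg Stk CodeSym :=
  pop .inp fun o => match o with
    | none => skip
    | some .hash => push .out hash
    | some .sep => seq (mark rec) (put rec sep)
    | some a => seq (mark rec) (seq (put rec a) (copyName rec))

/-- The contribution of a register to the history. -/
def recorded : Option ℕ → List CodeSym
  | none => []
  | some d => hash :: Code.name d

theorem Transduces.copyContent (rec : Bool) (o : Option ℕ) (e : Env) :
    Transduces (copyContent rec) e (Code.content o) (Code.content o) (onlyIf rec (recorded o)) e
      (6 * (Code.content o).length) := by
  cases o with
  | none =>
    rw [recorded, onlyIf_nil]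
    exact (Transduces.popInp (Transduces.pushOut hash e)).mono (by simp [Code.content])
  | some d =>
    rw [recorded, Code.content, Code.name]
    cases h : Computability.encodeNat d with
    -- The binary expansion is empty for the name `0`, whose code is the bare separator.
    | nil =>
      have h₁ := (Transduces.mark rec e).seq (Transduces.put rec sep e)
      rw [← onlyIf_append] at h₁
      exact (Transduces.popInp h₁).mono (by simp)
    | cons b l =>
      have h₁ := (Transduces.mark rec e).seq ((Transduces.put rec (if b then one else zero) e).seq
        (Transduces.copyName rec (ne_sep_of_mem_bits l) e))
      rw [← onlyIf_append, ← onlyIf_append] at h₁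
      cases b
      · exact (Transduces.popInp (a := zero) h₁).mono (by simp; omega)
      · exact (Transduces.popInp (a := one) h₁).mono (by simp; omega)

/-- Copies an assignment to `rest` registers. -/
def copyAssignment (rec : Bool) : StackProg Stk CodeSym :=
  seq (loop (.ctr .rest) (fun _ => false) fun _ => seq (copyContent rec) (push (.ctr .done) one))
    (drain .done .rest [])

theorem Code.one_le_length_content (o : Option ℕ) : 1 ≤ (Code.content o).length := by
  cases o <;> simp [Code.content, Code.name]

theorem Transduces.copyAssignmentLoop (rec : Bool) : ∀ (l : List (Option ℕ)) (e : Env),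
    e.rest = l.length →
    Transduces (loop (.ctr .rest) (fun _ => false) fun _ =>
      StackProg.seq (StackProg.copyContent rec) (push (.ctr .done) one)) e (l.flatMap Code.content)
      (l.flatMap Code.content) (onlyIf rec (l.flatMap recorded))
      { e with rest := 0, done := e.done + l.length } (8 * (l.flatMap Code.content).length + 1)
  | [], e, h => by
    have : e = { e with rest := 0, done := e.done + 0 } := by
      cases e
      simp_all
    simp only [List.flatMap_nil, onlyIf_nil, List.length_nil]
    rw [← this]
    exact Transduces.loopCtr_zero h
  | o :: l, e, h => by
    have h₁ := (Transduces.copyContent rec o (e.set .rest l.length)).seq (Transduces.inc .done _)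
    have h₂ := Transduces.copyAssignmentLoop rec l
      ((e.set .rest l.length).set .done ((e.set .rest l.length).get .done + 1)) rfl
    have h₃ := Transduces.loopCtr_succ (k := l.length) (by simpa [Env.get] using h) h₁ h₂
    rw [List.append_nil, List.append_nil, ← onlyIf_append] at h₃
    have h₄ := Code.one_le_length_content o
    have he : ({ e with rest := 0, done := e.done + (o :: l).length } : Env) =
        { (e.set .rest l.length).set .done ((e.set .rest l.length).get .done + 1) with
          rest := 0
          done := ((e.set .rest l.length).set .done
            ((e.set .rest l.length).get .done + 1)).done + l.length } := by
      simp [Env.set, Env.get]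
      omega
    rw [he]
    simp only [List.flatMap_cons]
    exact h₃.mono (by simp only [List.length_append]; omega)

theorem Code.length_le_length_assignment : ∀ l : List (Option ℕ),
    l.length ≤ (l.flatMap Code.content).length
  | [] => le_rfl
  | o :: l => by
    have := Code.length_le_length_assignment l
    have := Code.one_le_length_content o
    simp only [List.flatMap_cons, List.length_append, List.length_cons]
    omega

/-- The code of an assignment has no terminator, so its end is found by counting registers. The loop
consumes `rest` into `done`, and draining back makes the program reusable for the next assignment.
-/
theorem Transduces.copyAssignment (rec : Bool) {r : ℕ} (ρ : RegAssignment r ℕ) {e : Env}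
    (hr : e.rest = r) (hd : e.done = 0) :
    Transduces (copyAssignment rec) e (Code.assignment ρ) (Code.assignment ρ)
      (onlyIf rec ((List.ofFn ρ).flatMap recorded)) e (10 * (Code.assignment ρ).length + 2) := by
  have h₁ := Transduces.copyAssignmentLoop rec (List.ofFn ρ) e (by simpa using hr)
  have h₂ := Transduces.drain (x := .done) (y := .rest) (by decide) [] r
    { e with rest := 0, done := e.done + (List.ofFn ρ).length } (by simp [Env.get, hd])
  have h₃ := h₁.seq h₂
  have h₄ := Code.length_le_length_assignment (List.ofFn ρ)
  rw [List.length_ofFn] at h₄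
  have he : (({ e with rest := 0, done := e.done + (List.ofFn ρ).length } : Env).set .done 0).set
      .rest (({ e with rest := 0, done := e.done + (List.ofFn ρ).length } : Env).get .rest + r) =
      e := by
    cases e
    simp_all [Env.set, Env.get]
  rw [he] at h₃
  have h₅ : (List.replicate r ([] : List CodeSym)).flatten = [] := by simp
  rw [h₅, List.append_nil, List.append_nil] at h₃
  exact h₃.mono (by simp only [Code.assignment, List.length_nil]; omega)

/-- Copies a guard. -/
def copyGuard : StackProg Stk CodeSym :=
  pop .inp fun o => match o with
    | none => skip
    | some .star => push .out star
    | some .sep => push .out sep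
    | some a => seq (push .out a) copyField

theorem Transduces.copyGuard {r : ℕ} (g : Guard r) (e : Env) :
    Transduces copyGuard e (Code.guard g) (Code.guard g) [] e (3 * (Code.guard g).length) := by
  cases g with
  | fresh => exact (Transduces.popInp (Transduces.pushOut star e)).mono (by simp [Code.guard])
  | exactly X =>
    have hX := ne_sep_of_mem_ofFn_bits X
    simp only [Code.guard, Code.subset]
    have hb : ∀ a ∈ List.ofFn (fun i => if i ∈ X then one else zero), a = one ∨ a = zero := by
      intro a ha
      obtain ⟨i, rfl⟩ := (List.mem_ofFn' _ _).1 ha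
      dsimp only
      split <;> simp
    generalize List.ofFn (fun i => if i ∈ X then one else zero) = w at hX hb
    cases w with
    -- An automaton without registers has the empty bit vector, coded by the separator alone.
    | nil => exact (Transduces.popInp (Transduces.pushOut sep e)).mono (by simp)
    | cons a w =>
      have h₁ := (Transduces.pushOut a e).seq
        (Transduces.copyField (fun b hb => hX b (List.mem_cons_of_mem _ hb)) e)
      rcases hb a (by simp) with rfl | rfl
      · exact (Transduces.popInp (a := one) h₁).mono (by simp; omega)
      · exact (Transduces.popInp (a := zero) h₁).mono (by simp; omega)

theorem Transduces.copyTarget {r : ℕ} (o : Option (Fin r)) (e : Env) :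
    Transduces StackProg.copyField e (Code.target o) (Code.target o) [] e
      (3 * (Code.target o).length) := by
  cases o <;> exact (Transduces.copyIdx _ e).mono (by simp [Code.target, Code.idx]; try omega)

/-- Copies a transition. -/
def copyTransition : StackProg Stk CodeSym :=
  seq copyField (seq copyField (seq copyGuard (seq copyField (seq copyField copyField))))

theorem Transduces.copyTransition {n s r : ℕ} (τ : RegTransition (Fin n) (Fin s) r) (e : Env) :
    Transduces copyTransition e (Code.transition τ) (Code.transition τ) [] e
      (3 * (Code.transition τ).length) := by
  have h := (Transduces.copyIdx τ.src.val e).seq ((Transduces.copyIdx τ.tag.val e).seq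
    ((Transduces.copyGuard τ.guard e).seq ((Transduces.copyTarget τ.target e).seq
    ((Transduces.copySubset τ.erase e).seq (Transduces.copyIdx τ.dst.val e)))))
  refine h.mono ?_
  simp only [Code.transition, List.length_append, Code.idx, Code.subset, List.length_replicate,
    List.length_ofFn, List.length_singleton]
  omega

/-- Processes a list. -/
def mapList (p : StackProg Stk CodeSym) : StackProg Stk CodeSym :=
  loop .inp isSep fun _ => seq (push .out hash) p

/-- The closing separator is consumed but not written; the caller supplies it. -/
theorem Transduces.mapList {α : Type} {c c' : α → List CodeSym} {p : StackProg Stk CodeSym} {e : Env}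
    {m : ℕ} (h : ∀ a, Transduces p e (c a) (c' a) [] e (m * (c a).length)) : ∀ l : List α,
    Transduces (mapList p) e (Code.list c l) (l.flatMap fun a => hash :: c' a) [] e
      ((m + 2) * (Code.list c l).length)
  | [] => (Transduces.loopInp_done rfl e).mono (by simp [Code.list])
  | a :: l => by
    have h₁ := Transduces.loopInp_step (a := hash) (exits := isSep) rfl
      ((Transduces.pushOut hash e).seq (h a)) (Transduces.mapList h l)
    have h₂ : Code.list c (a :: l) = hash :: ([] ++ c a ++ Code.list c l) := by simp [Code.list]
    rw [h₂]
    refine h₁.mono ?_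
    simp only [List.length_cons, List.length_append, List.nil_append]
    ring_nf
    omega

/-- Copies the number of registers, adding it to the counter `rest`. -/
def copyRegs : StackProg Stk CodeSym :=
  seq (loop .inp isSep fun _ => seq (push .out one) (push (.ctr .rest) one)) (push .out sep)

theorem Transduces.copyRegsLoop : ∀ (n : ℕ) (e : Env),
    Transduces (loop .inp isSep fun _ => StackProg.seq (push .out one) (push (.ctr .rest) one)) e (Code.idx n)
      (List.replicate n one) [] { e with rest := e.rest + n } (3 * n + 1)
  | 0, e => Transduces.loopInp_done rfl e
  | n + 1, e => by
    have h := Transduces.loopInp_step (a := one) (exits := isSep) rfl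
      ((Transduces.pushOut one e).seq (Transduces.inc .rest e)) (Transduces.copyRegsLoop n _)
    have he : ({ e with rest := e.rest + (n + 1) } : Env) =
        { e.set .rest (e.get .rest + 1) with rest := (e.set .rest (e.get .rest + 1)).rest + n } := by
      simp [Env.set, Env.get]
      omega
    rw [he]
    exact h.mono (by omega)

theorem Transduces.copyRegs (n : ℕ) (e : Env) :
    Transduces copyRegs e (Code.idx n) (Code.idx n) [] { e with rest := e.rest + n } (3 * n + 2) := by
  simpa [Code.idx, StackProg.copyRegs] using (Transduces.copyRegsLoop n e).seq (Transduces.pushOut sep _)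

/-- Copies an instance and collects the names in its two assignments. -/
def copyInput : StackProg Stk CodeSym :=
  seq (seq copyField (seq copyField (seq copyRegs (seq copyField (seq (copyAssignment false)
    (seq copyField (seq (mapList copyTransition) (push .out sep))))))))
    (seq copyField (seq (copyAssignment true) (seq copyField (copyAssignment true))))

theorem Transduces.copyInput {k : Option ℕ} {X : Storage} {Y : Emptiness} (x : BisimInput k X Y) :
    Transduces copyInput {} (Code.bisimInput x) (Code.bisimInput x)
      ((List.ofFn x.ρ₁).flatMap recorded ++ (List.ofFn x.ρ₂).flatMap recorded)
      { rest := x.aut.regs } (10 * (Code.bisimInput x).length + 10) := by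
  let e : Env := { rest := x.aut.regs }
  have h₁ := (Transduces.copyIdx x.aut.tags {}).seq ((Transduces.copyIdx x.aut.states {}).seq
    ((Transduces.copyRegs x.aut.regs {}).seq ((Transduces.copyIdx x.aut.init.val _).seq
    ((Transduces.copyAssignment false x.aut.initReg (by simp) rfl).seq
    ((Transduces.copySubset x.aut.final _).seq
    ((Transduces.mapList (fun τ => Transduces.copyTransition τ _) x.aut.trans).seq
    (Transduces.pushOut sep _)))))))
  have h₂ := (Transduces.copyIdx x.q₁.val e).seq
    ((Transduces.copyAssignment true x.ρ₁ rfl rfl).seq ((Transduces.copyIdx x.q₂.val e).seq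
    (Transduces.copyAssignment true x.ρ₂ rfl rfl)))
  have he : ({ rest := ({} : Env).rest + x.aut.regs } : Env) = e := by simp [e]
  simp only [he] at h₁
  have h := h₁.seq h₂
  have hi : ∀ n, (Code.idx n).length = n + 1 := by simp [Code.idx]
  have hs : (Code.subset x.aut.final).length = x.aut.states + 1 := by simp [Code.subset]
  refine (h.congr (by simp [Code.bisimInput, Code.aut])
    (by simp [Code.bisimInput, Code.aut, Code.list]) (by simp [onlyIf])).mono ?_
  simp only [Code.bisimInput, Code.aut, List.length_append, hi, hs]
  omega

end StackProg

/-! ### The program that adds a history to an instance for RA. -/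

namespace StackProg

open CodeSym

theorem flatMap_recorded (l : List (Option ℕ)) :
    l.flatMap recorded = l.reduceOption.flatMap fun d => hash :: Code.name d := by
  induction l with
  | nil => rfl
  | cons o l ih => cases o <;> simp [recorded, ih]

theorem length_flatMap_recorded : ∀ l : List (Option ℕ),
    (l.flatMap recorded).length ≤ 2 * (l.flatMap Code.content).length
  | [] => le_rfl
  | o :: l => by
    have := length_flatMap_recorded l
    have : (recorded o).length ≤ 2 * (Code.content o).length := by
      cases o <;> simp [recorded, Code.content, Code.name]
    simp only [List.flatMap_cons, List.length_append]
    omega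

/-- The program that adds a history to an instance for RA. -/
def addHistory : StackProg Stk CodeSym :=
  seq copyInput (seq (push .fin sep) (seq (move .buf .fin) (seq (move .out .fin) (clear .rest))))

/-- The output stacks have their last symbol on top, so the result is built from its end: the
terminator of the history, then the collected names, then the copied instance. Each move reverses a
stack and thereby restores the reading order. -/
theorem runs_addHistory {k : Option ℕ} {X : Storage} {Y : Emptiness} (x : RAInput k X Y) :
    ∃ n ≤ 17 * (Code.raInput x).length + 14,
      Runs addHistory (stk (Code.raInput x) [] [] [] {}) (stk [] [] [] (Code.fraInput x.toFRAInput) {})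
        n := by
  obtain ⟨n₁, hn₁, h₁⟩ := Transduces.copyInput x.toBisimInput [] [] [] []
  simp only [List.append_nil] at h₁
  have h₂ := runs_push_fin [] (Code.bisimInput x.toBisimInput).reverse
    ((List.ofFn x.ρ₁).flatMap recorded ++ (List.ofFn x.ρ₂).flatMap recorded).reverse []
    { rest := x.aut.regs } sep
  have h₃ := runs_move_buf_fin [] (Code.bisimInput x.toBisimInput).reverse { rest := x.aut.regs }
    ((List.ofFn x.ρ₁).flatMap recorded ++ (List.ofFn x.ρ₂).flatMap recorded).reverse [sep]
  rw [List.reverse_reverse] at h₃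
  have h₄ := runs_move_out_fin [] [] { rest := x.aut.regs } (Code.bisimInput x.toBisimInput).reverse
    ((List.ofFn x.ρ₁).flatMap recorded ++ (List.ofFn x.ρ₂).flatMap recorded ++ [sep])
  rw [List.reverse_reverse] at h₄
  obtain ⟨n₅, hn₅, h₅⟩ := Transduces.clear .rest x.aut.regs { rest := x.aut.regs } rfl [] [] []
    (Code.bisimInput x.toBisimInput ++
      ((List.ofFn x.ρ₁).flatMap recorded ++ (List.ofFn x.ρ₂).flatMap recorded ++ [sep]))
  have h₆ : Code.fraInput x.toFRAInput = Code.bisimInput x.toBisimInput ++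
      ((List.ofFn x.ρ₁).flatMap recorded ++ (List.ofFn x.ρ₂).flatMap recorded ++ [sep]) := by
    simp only [Code.fraInput, RAInput.toFRAInput, Code.list, RegAssignment.names,
      List.flatMap_append, flatMap_recorded]
  rw [h₆]
  refine ⟨_, ?_, Runs.seq h₁ (Runs.seq h₂ (Runs.seq h₃ (Runs.seq h₄ h₅)))⟩
  have hr₁ := length_flatMap_recorded (List.ofFn x.ρ₁)
  have hr₂ := length_flatMap_recorded (List.ofFn x.ρ₂)
  have hl : x.aut.regs + (Code.assignment x.ρ₁).length + (Code.assignment x.ρ₂).length ≤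
      (Code.raInput x).length := by
    simp only [Code.raInput, Code.bisimInput, Code.aut, List.length_append, Code.idx,
      List.length_replicate]
    omega
  simp only [List.length_reverse, List.length_append, Code.raInput, Code.assignment] at *
  omega

theorem computableInPolyTime_of_runs_stk {α β : Type} {ea : α → List CodeSym}
    {eb : β → List CodeSym} {f : α → β} (p : StackProg Stk CodeSym) (P : Polynomial ℕ)
    (h : ∀ a, ∃ n ≤ P.eval (ea a).length, Runs p (stk (ea a) [] [] [] {}) (stk [] [] [] (eb (f a)) {}) n) :
    Nonempty (Turing.TM2ComputableInPolyTime ea eb f) := by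
  refine computableInPolyTime p .inp .fin P fun a => ?_
  rw [update_inp_eq, update_fin_eq]
  exact h a

end StackProg

theorem raBisim_reducesTo_fraBisim (k : Option ℕ) (X : Storage) (Y : Emptiness) :
    (raBisim k X Y).ReducesTo (fraBisim k X Y) := by
  refine ⟨fun x : RAInput k X Y => x.toFRAInput, ?_, fun x => x.yes_iff_toFRAInput⟩
  refine StackProg.computableInPolyTime_of_runs_stk StackProg.addHistory
    (17 * Polynomial.X + 14) fun x => ?_
  obtain ⟨n, hn, h⟩ := StackProg.runs_addHistory x
  refine ⟨n, hn.trans (le_of_eq ?_), h⟩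
  simp only [Polynomial.eval_add, Polynomial.eval_mul, Polynomial.eval_X, Polynomial.eval_ofNat]
  rfl

namespace StackProg

open CodeSym

/-! ### The program for filling registers -/

theorem Transduces.conv {p : StackProg Stk CodeSym} {e e' e'' : Env}
    {u v u' v' : List CodeSym} {m n : ℕ} (h : Transduces p e u v [] e' m) (hu : u = u') (hv : v = v')
    (he : e' = e'') (hn : m ≤ n) : Transduces p e u' v' [] e'' n :=
  (hu ▸ hv ▸ he ▸ h : Transduces p e u' v' [] e'' m).mono hn

theorem flatten_replicate_one (m n : ℕ) :
    (List.replicate n (List.replicate m one)).flatten = List.replicate (m * n) one := by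
  rw [List.flatten_replicate_replicate, Nat.mul_comm]

/-- Appends the unary number `m * x + k` to the output, where `x` is a counter. -/
def emitIdx (x : Counter) (m k : ℕ) : StackProg Stk CodeSym :=
  seq (repeatEmit x (List.replicate m one)) (seq (emit (List.replicate k one)) (push .out sep))

theorem Transduces.emitIdx {x : Counter} (hx : x ≠ .tmp) (m k : ℕ) {e : Env} (h : e.tmp = 0) :
    Transduces (emitIdx x m k) e [] (Code.idx (m * e.get x + k)) [] e
      (e.get x * (m + 4) + k + 3) := by
  refine ((Transduces.repeatEmit hx (List.replicate m one) h).seq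
    ((Transduces.emit (List.replicate k one) e).seq (Transduces.pushOut sep e))).conv rfl ?_ rfl ?_
  · rw [flatten_replicate_one, Code.idx, List.replicate_add, List.append_assoc]
  · simp only [List.length_replicate]
    omega

/-- A bit vector for cells with the bits `a` and `b` for register `j`, and `k` registers after it. -/
def vecText (j k : ℕ) (a b : CodeSym) : List CodeSym :=
  (List.replicate j [zero, zero]).flatten ++ ([a, b] ++
    ((List.replicate k [zero, zero]).flatten ++ [sep]))

/-- Appends a bit vector for cells to the output. -/
def emitVec (a b : CodeSym) : StackProg Stk CodeSym :=
  seq (repeatEmit .done [zero, zero]) (seq (emit [a, b])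
    (seq (repeatEmit .rest [zero, zero]) (push .out sep)))

theorem Transduces.emitVec (a b : CodeSym) {e : Env} (h : e.tmp = 0) :
    Transduces (emitVec a b) e [] (vecText e.done e.rest a b) [] e
      (6 * e.done + 6 * e.rest + 7) :=
  ((Transduces.repeatEmit (by decide) [zero, zero] h).seq
    ((Transduces.emit [a, b] e).seq ((Transduces.repeatEmit (by decide) [zero, zero] h).seq
      (Transduces.pushOut sep e)))).conv rfl rfl rfl (by simp [Env.get]; omega)

/-- The code of a transition that resets or retains register `j`, where `a` is the bit for the first
cell in the guard and `z` tells whether the register is reset. -/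
def resetText (c t j k : ℕ) (z : Bool) (d : ℕ) (a : CodeSym) : List CodeSym :=
  hash :: (Code.idx c ++ (Code.idx t ++ (vecText j k a one ++
    (Code.idx (2 * j + if z then 1 else 2) ++ (vecText j k zero zero ++ Code.idx d)))))

/-- Appends the code of a transition that resets or retains a register to the output. -/
def emitReset (z : Bool) (p : StackProg Stk CodeSym) (a : CodeSym) : StackProg Stk CodeSym :=
  seq (push .out hash) (seq (emitIdx .states 1 0) (seq (emitIdx .tag 1 0) (seq (emitVec a one)
    (seq (emitIdx .done 2 (if z then 1 else 2)) (seq (emitVec zero zero) p)))))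

/-- The counters are at most `B`. -/
structure Env.BoundedBy (e : Env) (B : ℕ) : Prop where
  states : e.states + 1 ≤ B
  tag : e.tag ≤ B
  cells : e.done + e.rest + 1 ≤ B
  dst : e.dst ≤ B

theorem Transduces.emitReset (z : Bool) {p : StackProg Stk CodeSym} (a : CodeSym) {e : Env} {d B : ℕ}
    (h : e.tmp = 0) (hB : Env.BoundedBy e B)
    (hp : Transduces p e [] (Code.idx d) [] e (9 * B)) :
    Transduces (emitReset z p a) e [] (resetText e.states e.tag e.done e.rest z d a) [] e
      (70 * B) := by
  refine ((Transduces.pushOut hash e).seq ((Transduces.emitIdx (by decide) 1 0 h).seq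
    ((Transduces.emitIdx (by decide) 1 0 h).seq ((Transduces.emitVec a one h).seq
    ((Transduces.emitIdx (by decide) 2 (if z then 1 else 2) h).seq
    ((Transduces.emitVec zero zero h).seq hp)))))).conv rfl ?_ rfl ?_
  · simp [resetText, Env.get]
  · have h₁ := hB.states
    have h₂ := hB.tag
    have h₃ := hB.cells
    have h₄ : (if z = true then 1 else 2) ≤ 2 := by split <;> omega
    simp only [Env.get]
    omega

/-- The codes of the two transitions for register `j`. -/
def resetTexts (c t j k : ℕ) (z : Bool) (d : ℕ) : List CodeSym :=
  resetText c t j k z d zero ++ resetText c t j k z d one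

/-- Appends the codes of the two transitions for a register to the output, and counts the state. -/
def emitResets (z : Bool) (p : StackProg Stk CodeSym) : StackProg Stk CodeSym :=
  seq (pop (.ctr .rest) fun _ => skip) (seq (emitReset z p zero) (seq (emitReset z p one)
    (seq (push (.ctr .done) one) (seq (push (.ctr .states) one) (push (.ctr .extra) one)))))

/-- The counters after one more register has been treated. -/
def Env.advance (e : Env) (m : ℕ) : Env :=
  { e with rest := e.rest - m, done := e.done + m, states := e.states + m, extra := e.extra + m }

/-- Decrementing `rest` at the beginning makes it the number of registers after the current one,
which is the padding needed in the bit vectors. The counter `states` is the source state of both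
transitions. -/
theorem Transduces.emitResets (z : Bool) {p : StackProg Stk CodeSym} {e : Env} {d B : ℕ}
    (h : e.tmp = 0) (hB : Env.BoundedBy e B)
    (hp : Transduces p (e.set .rest (e.rest - 1)) [] (Code.idx d) [] (e.set .rest (e.rest - 1)) (9 * B)) :
    Transduces (emitResets z p) e [] (resetTexts e.states e.tag e.done (e.rest - 1) z d) []
      (Env.advance e 1) (144 * B) := by
  have hB' : Env.BoundedBy (e.set .rest (e.rest - 1)) B :=
    ⟨hB.states, hB.tag, le_trans (by simp [Env.set]) hB.cells, hB.dst⟩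
  refine ((Transduces.dec .rest e).seq ((Transduces.emitReset z zero (e := e.set .rest (e.rest - 1)) h hB' hp).seq
    ((Transduces.emitReset z one
    (e := e.set .rest (e.rest - 1)) h hB' hp).seq ((Transduces.inc .done _).seq
    ((Transduces.inc .states _).seq (Transduces.inc .extra _)))))).conv rfl ?_ rfl ?_
  · simp [resetTexts, Env.set]
  · have := hB.states
    omega

/-- The codes of the transitions for the registers from the `j`-th one on, where `w` tells which
registers are reset, `c` is the state for the first register, and `r` is the auxiliary register. -/
def eraseText (c t r j : ℕ) (w : List CodeSym) : List CodeSym :=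
  (w.zipIdx j).flatMap fun p =>
    resetTexts (c + p.2) t p.2 (r - p.2) (decide (p.1 = one)) (c + p.2 + 1)

/-- Treats the registers according to the bit vector in the input. -/
def emitErase : StackProg Stk CodeSym :=
  loop .inp isSep fun a => emitResets (decide (a = one)) (emitIdx .states 1 1)

/-- Throughout the loop `done` is the current register and `states` is its reset state, so the
successor is `states + 1`. The bound `w.length + 1 ≤ rest` leaves the auxiliary register to be
treated after the loop. -/
theorem Transduces.emitErase {B c r : ℕ} : ∀ {w : List CodeSym} {e : Env}, (∀ a ∈ w, a ≠ sep) →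
    e.tmp = 0 → e.rest + e.done = r + 1 → e.states = c + e.done → e.states + w.length + 1 ≤ B →
    e.tag ≤ B → r + 2 ≤ B → e.dst ≤ B → w.length + 1 ≤ e.rest →
    Transduces emitErase e (w ++ [sep]) (eraseText c e.tag r e.done w) [] (Env.advance e w.length)
      (145 * B * w.length + 1)
  | [], e, _, _, _, _, _, _, _, _, _ => Transduces.loopInp_done rfl e
  | a :: w, e, hw, h, hr, hc, hs, ht, hB, hd, hl => by
    rw [List.length_cons] at hs hl
    have hB' : Env.BoundedBy e B := ⟨by omega, ht, by omega, hd⟩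
    have h₁ := (Transduces.emitIdx (x := .states) (by decide) 1 1
      (e := e.set .rest (e.rest - 1)) h).mono (n := 9 * B) (by
        simp only [Env.get, Env.set]
        omega)
    have h₂ := Transduces.emitErase (B := B) (c := c) (r := r) (w := w) (e := Env.advance e 1)
      (fun b hb => hw b (List.mem_cons_of_mem _ hb)) h (by simp [Env.advance]; omega)
      (by simp [Env.advance]; omega) (by simp [Env.advance]; omega) ht hB hd
      (by simp [Env.advance]; omega)
    refine (Transduces.loopInp_step (a := a) (by simpa [isSep] using hw a)
      (Transduces.emitResets (decide (a = one)) h hB' h₁) h₂).conv rfl ?_ ?_ ?_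
    · have : r - e.done = e.rest - 1 := by omega
      simp only [eraseText, List.zipIdx_cons, List.flatMap_cons, this, hc]
      simp [Env.get, Env.set, Env.advance, hc]
    · simp [Env.advance]
      omega
    · simp only [List.length_cons]
      ring_nf
      omega

end StackProg

namespace StackProg

open CodeSym

/-! #### Transitions -/

/-- The code of a guard in terms of cells. -/
def cellGuardText {r : ℕ} : Guard r → List CodeSym
  | .fresh => [star]
  | .exactly X => (List.ofFn fun i => if i ∈ X then one else zero).flatMap (fun a => [a, zero]) ++
      [zero, zero, sep]

/-- Translates the rest of a bit vector for registers to one for cells. -/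
def doubleBits : StackProg Stk CodeSym :=
  seq (loop .inp isSep fun a => emit [a, zero]) (emit [zero, zero, sep])

theorem Transduces.doubleBitsLoop : ∀ {w : List CodeSym}, (∀ a ∈ w, a ≠ sep) → ∀ e,
    Transduces (loop .inp isSep fun a => StackProg.emit [a, zero]) e (w ++ [sep])
      (w.flatMap fun a => [a, zero]) [] e (3 * w.length + 1)
  | [], _, e => Transduces.loopInp_done rfl e
  | a :: w, h, e =>
    (Transduces.loopInp_step (exits := isSep) (a := a) (by simpa [isSep] using h a)
      (Transduces.emit [a, zero] e)
      (Transduces.doubleBitsLoop (fun b hb => h b (List.mem_cons_of_mem _ hb)) e)).conv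
      (by simp) (by simp) rfl (by simp; omega)

theorem Transduces.doubleBits {w : List CodeSym} (h : ∀ a ∈ w, a ≠ sep) (e : Env) :
    Transduces doubleBits e (w ++ [sep]) (w.flatMap (fun a => [a, zero]) ++ [zero, zero, sep]) [] e
      (3 * w.length + 4) :=
  ((Transduces.doubleBitsLoop h e).seq (Transduces.emit _ e)).conv (by simp) rfl rfl (by simp)

/-- Translates a guard. -/
def convertGuard : StackProg Stk CodeSym :=
  pop .inp fun o => match o with
    | none => skip
    | some .star => push .out star
    | some .sep => emit [zero, zero, sep]
    | some a => seq (emit [a, zero]) doubleBits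

theorem Transduces.convertGuard {r : ℕ} (g : Guard r) (e : Env) :
    Transduces convertGuard e (Code.guard g) (cellGuardText g) [] e (7 * (Code.guard g).length) := by
  cases g with
  | fresh => exact (Transduces.popInp (Transduces.pushOut star e)).mono (by simp [Code.guard])
  | exactly X =>
    have hX := ne_sep_of_mem_ofFn_bits X
    simp only [Code.guard, Code.subset, cellGuardText]
    have hb : ∀ a ∈ List.ofFn (fun i => if i ∈ X then one else zero), a = one ∨ a = zero := by
      intro a ha
      obtain ⟨i, rfl⟩ := (List.mem_ofFn' _ _).1 ha
      dsimp only
      split <;> simp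
    generalize List.ofFn (fun i => if i ∈ X then one else zero) = w at hX hb
    cases w with
    -- Without registers only the two cells of the auxiliary one remain, and they never occur in a
    -- guard of a storing transition.
    | nil => exact (Transduces.popInp (Transduces.emit _ e)).mono (by simp)
    | cons a w =>
      have h₁ := (Transduces.emit [a, zero] e).seq
        (Transduces.doubleBits (fun b hb => hX b (List.mem_cons_of_mem _ hb)) e)
      rcases hb a (by simp) with rfl | rfl
      · exact (Transduces.popInp (a := one) h₁).mono (by simp; omega)
      · exact (Transduces.popInp (a := zero) h₁).mono (by simp; omega)

/-- Translates a target. -/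
def convertTarget : StackProg Stk CodeSym :=
  pop .inp fun o => match o with
    | some .sep => seq (pop (.ctr .rest) fun _ => skip)
        (seq (emitIdx .rest 2 1) (push (.ctr .rest) one))
    | _ => seq (push .out one) (seq (loop .inp isSep fun _ => emit [one, one]) (push .out sep))

theorem Transduces.doubleOnes : ∀ (n : ℕ) (e : Env),
    Transduces (loop .inp isSep fun _ => StackProg.emit [one, one]) e (Code.idx n)
      (List.replicate (2 * n) one) [] e (3 * n + 1)
  | 0, e => Transduces.loopInp_done rfl e
  | n + 1, e =>
    (Transduces.loopInp_step (exits := isSep) (a := one) rfl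
      (Transduces.emit [one, one] e) (Transduces.doubleOnes n e)).conv
      rfl (by simp [Nat.mul_add, List.replicate_succ]) rfl (by simp; omega)

/-- Targets are coded with offset one. Target `0` becomes the first cell of register `r`, so `rest`
is lowered to `r` for the moment. For register `i` the first `one` of the input accounts for the
offset, and the other `i` are doubled. -/
theorem Transduces.convertTarget {r : ℕ} (o : Option (Fin r)) {e : Env} (h : e.tmp = 0)
    (hr : e.rest = r + 1) :
    Transduces convertTarget e (Code.target o) (Code.idx (2 * (Filling.storeReg o).val + 1)) [] e
      (6 * r + 6 * (Code.target o).length + 7) := by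
  cases o with
  | none =>
    refine (Transduces.popInp (a := sep) ((Transduces.dec .rest e).seq
      ((Transduces.emitIdx (x := .rest) (by decide) 2 1 (e := e.set .rest (e.get .rest - 1)) h).seq
      (Transduces.inc .rest _)))).conv rfl ?_ ?_ ?_
    · simp [Filling.storeReg, Env.get, Env.set, hr]
    · rw [Env.get_set_self, Env.set_set]
      have : e.get .rest - 1 + 1 = e.get .rest := by simp [Env.get, hr]
      rw [this, Env.set_get]
    · simp [Env.get, Env.set, hr]
      omega
  | some i =>
    refine (Transduces.popInp (a := one) ((Transduces.pushOut one e).seq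
      ((Transduces.doubleOnes i.val e).seq (Transduces.pushOut sep e)))).conv ?_ ?_ rfl ?_
    · simp [Code.target, Code.idx, List.replicate_succ]
    · simp [Filling.storeReg, Code.idx, List.replicate_succ]
    · simp only [Code.target, Code.idx, List.length_append, List.length_replicate,
        List.length_singleton]
      omega

/-- The bits of a set of registers. -/
def bits {r : ℕ} (X : Finset (Fin r)) : List CodeSym :=
  List.ofFn fun i => if i ∈ X then one else zero

/-- The codes of the transitions that simulate `τ`, where the auxiliary states start with `c`. -/
def transText {n s r : ℕ} (c : ℕ) (τ : RegTransition (Fin n) (Fin s) r) : List CodeSym :=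
  hash :: (Code.idx τ.src.val ++ (Code.idx τ.tag.val ++ (cellGuardText τ.guard ++
    (Code.idx (2 * (Filling.storeReg τ.target).val + 1) ++
    ((List.replicate (r + 1) [zero, zero]).flatten ++ (sep :: (Code.idx c ++
    (eraseText c τ.tag.val r 0 (bits τ.erase) ++
    resetTexts (c + r) τ.tag.val r 0 true τ.dst.val))))))))

/-- Translates the parts of a transition up to the target, and appends the other parts of the
transition that stores the letter. -/
def convertHead : StackProg Stk CodeSym :=
  seq (push .out hash) (seq copyField (seq (readCounter .tag) (seq (emitIdx .tag 1 0)
    (seq convertGuard (seq convertTarget (seq (repeatEmit .rest [zero, zero])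
    (seq (push .out sep) (emitIdx .states 1 0))))))))

/-- Treats the parts of a transition from the set of erased registers on. -/
def convertTail : StackProg Stk CodeSym :=
  seq emitErase (seq (readCounter .dst) (seq (emitResets true (emitIdx .dst 1 0))
    (seq (clear .tag) (seq (clear .dst) (drain .done .rest [])))))

/-- The storing transition erases nothing and leads to the first reset state of its transition,
which is the current value of `states`; so it is complete before the erased set is read. -/
theorem Transduces.convertHead {n s r B : ℕ} (τ : RegTransition (Fin n) (Fin s) r) {e : Env}
    (h : e.tmp = 0) (hr : e.rest = r + 1) (ht : e.tag = 0) (hc : e.states + 1 ≤ B) (hB : r + 2 ≤ B)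
    (hs : s ≤ B) :
    Transduces convertHead e (Code.idx τ.src.val ++ (Code.idx τ.tag.val ++ (Code.guard τ.guard ++
        Code.target τ.target)))
      (hash :: (Code.idx τ.src.val ++ (Code.idx τ.tag.val ++ (cellGuardText τ.guard ++
        (Code.idx (2 * (Filling.storeReg τ.target).val + 1) ++
        ((List.replicate (r + 1) [zero, zero]).flatten ++ (sep :: (Code.idx e.states)))))))) []
      { e with tag := τ.tag.val }
      (7 * (Code.idx τ.src.val ++ (Code.idx τ.tag.val ++ (Code.guard τ.guard ++
        Code.target τ.target))).length + 30 * B) := by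
  refine ((Transduces.pushOut hash e).seq ((Transduces.copyIdx τ.src.val e).seq
    ((Transduces.readCounter .tag τ.tag.val e).seq
    ((Transduces.emitIdx (x := .tag) (by decide) 1 0 (e := e.set .tag (e.get .tag + τ.tag.val)) h).seq
    ((Transduces.convertGuard τ.guard _).seq ((Transduces.convertTarget τ.target (e := e.set .tag (e.get .tag + τ.tag.val)) h hr).seq
    ((Transduces.repeatEmit (x := .rest) (by decide) [zero, zero]
      (e := e.set .tag (e.get .tag + τ.tag.val)) h).seq
    ((Transduces.pushOut sep _).seq
    (Transduces.emitIdx (x := .states) (by decide) 1 0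
      (e := e.set .tag (e.get .tag + τ.tag.val)) h))))))))).conv ?_ ?_ ?_ ?_
  · simp
  · simp [Env.get, Env.set, ht, hr]
  · simp [Env.get, Env.set, ht]
  · have h₁ := τ.tag.isLt
    simp only [Env.get, Env.set, ht, hr, List.length_append, Code.idx, List.length_replicate,
      List.length_cons, List.length_nil]
    omega

/-- The bit vector in the input covers only the `r` proper registers. The auxiliary one comes after
it and is always reset, and only its successor requires the destination, which is read at that
moment. -/
theorem Transduces.convertTail {n s r B : ℕ} (τ : RegTransition (Fin n) (Fin s) r) {e : Env}
    (h : e.tmp = 0) (hr : e.rest = r + 1) (h₀ : e.done = 0) (ht : e.tag = τ.tag.val) (hd : e.dst = 0)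
    (hc : e.states + r + 1 ≤ B) (hB : r + 2 ≤ B) (hs : s ≤ B) (hn : n ≤ B) :
    Transduces convertTail e (Code.subset τ.erase ++ Code.idx τ.dst.val)
      (eraseText e.states τ.tag.val r 0 (bits τ.erase) ++
        resetTexts (e.states + r) τ.tag.val r 0 true τ.dst.val) []
      { e with tag := 0, states := e.states + (r + 1), extra := e.extra + (r + 1) }
      (160 * B * (Code.subset τ.erase ++ Code.idx τ.dst.val).length) := by
  have hl : (bits τ.erase).length = r := by simp [bits]
  have h₁ := τ.tag.isLt
  have h₂ := τ.dst.isLt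
  have e₁ := Transduces.emitErase (B := B) (c := e.states) (r := r) (w := bits τ.erase) (e := e)
    (ne_sep_of_mem_ofFn_bits _) h (by omega) (by omega) (by omega) (by omega) hB (by omega) (by omega)
  rw [hl, h₀, ht] at e₁
  have e₂ := Transduces.readCounter .dst τ.dst.val (Env.advance e r)
  generalize hf : (Env.advance e r).set .dst ((Env.advance e r).get .dst + τ.dst.val) = f at e₂
  have hf' : f = { e with rest := 1, done := r, states := e.states + r, extra := e.extra + r,
                          dst := τ.dst.val } := by
    subst hf
    simp [Env.advance, Env.set, Env.get, hr, h₀, hd]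
  clear hf
  have e₃ := Transduces.emitResets (B := B) true (p := StackProg.emitIdx .dst 1 0) (d := τ.dst.val) (e := f)
    (by simp [hf', h])
    (by
      subst hf'
      exact ⟨hc, by simp only [ht]; omega, by simp; omega, by simp; omega⟩)
    ((Transduces.emitIdx (x := .dst) (by decide) 1 0 (by simp [hf', h, Env.set])).conv rfl
      (by simp [Env.get, Env.set, hf']) rfl (by
        simp only [Env.get, Env.set, hf']
        omega))
  have e₄ := Transduces.clear .tag _ (Env.advance f 1) rfl
  have e₅ := Transduces.clear .dst _ ((Env.advance f 1).set .tag 0) rfl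
  have e₆ := Transduces.drain (x := .done) (y := .rest) (by decide) [] _
    (((Env.advance f 1).set .tag 0).set .dst 0) rfl
  refine (e₁.seq (e₂.seq (e₃.seq (e₄.seq (e₅.seq e₆))))).conv ?_ ?_ ?_ ?_
  · simp [Code.subset, bits]
  · subst hf'
    simp [ht]
  · subst hf'
    simp [Env.advance, Env.get, Env.set]
    omega
  · subst hf'
    simp only [Env.advance, Env.get, Env.set, Code.subset, Code.idx, List.length_append,
      List.length_replicate, List.length_singleton, List.length_ofFn, List.length_nil]
    have : 160 * B * (r + 1 + (τ.dst.val + 1)) = 145 * B * r + 15 * (B * r) + 160 * B +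
      160 * (B * τ.dst.val) + 160 * B := by ring
    have h₃ : 2 * r ≤ B * r := Nat.mul_le_mul_right _ (by omega)
    have h₄ : 2 * τ.dst.val ≤ B * τ.dst.val := Nat.mul_le_mul_right _ (by omega)
    omega

/-- Translates the list of transitions. -/
def convertTrans : StackProg Stk CodeSym :=
  loop .inp isSep fun _ => seq convertHead convertTail

/-- The counter `states` serves as the next free state: each transition uses up `r + 1` of them, in
agreement with the numbering by `Filling.stateEquiv`. The additions are also recorded in `extra`,
for the final states. -/
theorem Transduces.convertTrans {n s r B : ℕ} {c : ℕ} :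
    ∀ (l : List (RegTransition (Fin n) (Fin s) r)) (t : ℕ) (e : Env),
    e.tmp = 0 → e.rest = r + 1 → e.done = 0 → e.tag = 0 → e.dst = 0 →
    e.states = c + t * (r + 1) → e.states + l.length * (r + 1) + 1 ≤ B → r + 2 ≤ B → s ≤ B → n ≤ B →
    Transduces convertTrans e (Code.list Code.transition l)
      ((l.zipIdx t).flatMap fun p => transText (c + p.2 * (r + 1)) p.1) []
      { e with states := e.states + l.length * (r + 1), extra := e.extra + l.length * (r + 1) }
      (200 * B * (Code.list Code.transition l).length)
  | [], t, e, _, _, _, _, _, _, _, hB, _, _ => by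
    refine (Transduces.loopInp_done rfl e).conv rfl rfl (by simp) ?_
    simp [Code.list]
    omega
  | τ :: l, t, e, h, hr, h₀, ht, hd, hc, hl, hB, hs, hn => by
    have hl' : (τ :: l).length * (r + 1) = (r + 1) + l.length * (r + 1) := by
      simp only [List.length_cons]
      ring
    rw [hl'] at hl
    have h₁ := Transduces.convertHead (B := B) τ h hr ht (by omega) hB hs
    have h₂ := Transduces.convertTail (B := B) τ (e := { e with tag := τ.tag.val }) h hr h₀ rfl hd
      (by simp; omega) hB hs hn
    have h₃ := Transduces.convertTrans (B := B) (c := c) l (t + 1)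
      { e with tag := 0, states := e.states + (r + 1), extra := e.extra + (r + 1) } h hr h₀ rfl hd
      (by simp only [hc]; ring) (by simp; omega) hB hs hn
    refine (Transduces.loopInp_step (a := hash) (exits := isSep) rfl (h₁.seq h₂) h₃).conv ?_ ?_ ?_ ?_
    · simp [Code.list, Code.transition]
    · simp [transText, List.zipIdx_cons, hc]
    · rw [hl']
      simp [ht, Nat.add_assoc]
    · have hcode : (Code.list Code.transition (τ :: l)).length = 1 +
          (Code.idx τ.src.val ++ (Code.idx τ.tag.val ++ (Code.guard τ.guard ++
            Code.target τ.target))).length + (Code.subset τ.erase ++ Code.idx τ.dst.val).length +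
          (Code.list Code.transition l).length := by
        simp only [Code.list, Code.transition, List.flatMap_cons, List.length_append,
          List.length_cons]
        omega
      rw [hcode]
      generalize (Code.idx τ.src.val ++ (Code.idx τ.tag.val ++ (Code.guard τ.guard ++
        Code.target τ.target))).length = x
      generalize (Code.subset τ.erase ++ Code.idx τ.dst.val).length = y
      generalize (Code.list Code.transition l).length = z
      have h₄ : 1 * x ≤ B * x := Nat.mul_le_mul_right _ (by omega)
      have : 200 * B * (1 + x + y + z) = 200 * B + 200 * (B * x) + 160 * B * y + 40 * (B * y) +
        200 * B * z := by ring
      omega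

end StackProg

namespace StackProg

open CodeSym

/-! #### Assignments and histories -/

/-- The code of a dummy name. -/
def dummyText (j : ℕ) : List CodeSym := List.replicate (j + 1) zero ++ [one, sep]

/-- Appends a dummy name to the output. -/
def emitDummy : StackProg Stk CodeSym := seq (repeatEmit .done [zero]) (emit [zero, one, sep])

theorem Transduces.emitDummy {e : Env} (h : e.tmp = 0) :
    Transduces emitDummy e [] (dummyText e.done) [] e (5 * e.done + 5) :=
  ((Transduces.repeatEmit (x := .done) (by decide) [zero] h).seq (Transduces.emit _ e)).conv rfl
    (by
      have : ∀ n, (List.replicate n [zero]).flatten = List.replicate n zero := fun n => by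
        simp
      rw [this, dummyText, List.replicate_succ', List.append_assoc]
      rfl)
    rfl (by simp [Env.get]; omega)

/-- The new contents of the first cell of register `j`. -/
def contentText (j : ℕ) : Option ℕ → List CodeSym
  | none => dummyText j
  | some d => one :: Code.name d

/-- Translates the contents of a register. -/
def convertContent : StackProg Stk CodeSym :=
  pop .inp fun o => match o with
    | none => skip
    | some .hash => emitDummy
    | some .sep => emit [one, sep]
    | some a => seq (emit [one, a]) copyField

theorem Transduces.convertContent (o : Option ℕ) {e : Env} (h : e.tmp = 0) :
    Transduces convertContent e (Code.content o) (contentText e.done o) [] e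
      (5 * e.done + 6 + 3 * (Code.content o).length) := by
  cases o with
  | none => exact (Transduces.popInp (Transduces.emitDummy h)).mono (by omega)
  | some d =>
    rw [contentText, Code.content, Code.name]
    cases hd : Computability.encodeNat d with
    -- The name `0` is renamed to `1`, whose code is a single bit and the separator.
    | nil => exact (Transduces.popInp (Transduces.emit _ e)).mono (by simp)
    | cons b l =>
      have h₁ := (Transduces.emit [one, if b then one else zero] e).seq
        (Transduces.copyField (ne_sep_of_mem_bits l) e)
      cases b
      · exact (Transduces.popInp (a := zero) h₁).mono (by simp; omega)
      · exact (Transduces.popInp (a := one) h₁).mono (by simp; omega)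

/-- The code of the assignment to the cells that represents a given assignment. -/
def assignText {r : ℕ} (ρ : RegAssignment r ℕ) : List CodeSym :=
  ((List.ofFn ρ).zipIdx.flatMap fun p => contentText p.2 p.1 ++ dummyText p.2) ++
    (dummyText r ++ dummyText r)

/-- Translates an assignment to `rest - 1` registers. -/
def convertAssignment : StackProg Stk CodeSym :=
  seq (pop (.ctr .rest) fun _ => skip)
    (seq (loop (.ctr .rest) (fun _ => false) fun _ =>
        seq convertContent (seq emitDummy (push (.ctr .done) one)))
      (seq emitDummy (seq emitDummy (seq (drain .done .rest []) (push (.ctr .rest) one)))))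

theorem Transduces.convertAssignmentLoop {B : ℕ} : ∀ (l : List (Option ℕ)) (e : Env), e.tmp = 0 →
    e.rest = l.length → e.done + l.length + 1 ≤ B →
    Transduces (loop (.ctr .rest) (fun _ => false) fun _ =>
      StackProg.seq StackProg.convertContent (StackProg.seq StackProg.emitDummy (push (.ctr .done) one)))
      e (l.flatMap Code.content)
      ((l.zipIdx e.done).flatMap fun p => contentText p.2 p.1 ++ dummyText p.2) []
      { e with rest := 0, done := e.done + l.length } (26 * B * (l.flatMap Code.content).length + 1)
  | [], e, _, h, _ => by
    have : e = { e with rest := 0, done := e.done + 0 } := by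
      cases e
      simp_all
    exact (Transduces.loopCtr_zero (x := .rest) h).conv rfl rfl this le_rfl
  | o :: l, e, ht, h, hB => by
    rw [List.length_cons] at h hB
    have h₂ := Transduces.convertAssignmentLoop (B := B) l
      ((e.set .rest l.length).set .done ((e.set .rest l.length).get .done + 1)) ht rfl
      (by simp [Env.set, Env.get]; omega)
    refine (Transduces.loopCtr_succ (x := .rest) (k := l.length) h
      ((Transduces.convertContent o (e := e.set .rest l.length) ht).seq
        ((Transduces.emitDummy (e := e.set .rest l.length) ht).seq (Transduces.inc .done _)))
      h₂).conv ?_ ?_ ?_ ?_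
    · simp
    · simp [Env.set, Env.get, List.zipIdx_cons]
    · simp [Env.set, Env.get]
      omega
    · have h₃ := Code.one_le_length_content o
      simp only [Env.set, List.flatMap_cons, List.length_append]
      generalize (Code.content o).length = x at *
      generalize (l.flatMap Code.content).length = y at *
      have h₄ : B * 1 ≤ B * x := Nat.mul_le_mul_left _ h₃
      have h₅ : 1 * x ≤ B * x := Nat.mul_le_mul_right _ (by omega)
      have : 26 * B * (x + y) = 26 * (B * x) + 26 * B * y := by ring
      omega

/-- The counter `rest` includes the auxiliary register, which the input lacks; hence the initial
decrement. After the loop `done` equals `r`, so the two additional dummies are those of the empty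
auxiliary register. -/
theorem Transduces.convertAssignment {r B : ℕ} (ρ : RegAssignment r ℕ) {e : Env} (ht : e.tmp = 0)
    (hr : e.rest = r + 1) (hd : e.done = 0) (hB : r + 2 ≤ B) :
    Transduces convertAssignment e (Code.assignment ρ) (assignText ρ) [] e
      (26 * B * (Code.assignment ρ).length + 20 * B) := by
  have e₁ := Transduces.dec .rest e
  rw [show e.get .rest - 1 = r by simp [Env.get, hr]] at e₁
  have e₂ := Transduces.convertAssignmentLoop (B := B) (List.ofFn ρ) (e.set .rest r) ht
    (by simp [Env.set]) (by simp [Env.set, hd]; omega)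
  generalize hf : ({ e.set .rest r with
    rest := 0, done := (e.set .rest r).done + (List.ofFn ρ).length } : Env) = f at e₂
  have hf' : f = { e with rest := 0, done := r } := by
    subst hf
    simp [Env.set, hd]
  clear hf
  have e₃ := Transduces.emitDummy (e := f) (by simp [hf', ht])
  have e₄ := Transduces.drain (x := .done) (y := .rest) (by decide) [] _ f rfl
  have e₅ := Transduces.inc .rest ((f.set .done 0).set .rest (f.get .rest + f.get .done))
  refine (e₁.seq (e₂.seq (e₃.seq (e₃.seq (e₄.seq e₅))))).conv ?_ ?_ ?_ ?_
  · simp [Code.assignment]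
  · simp [assignText, hf', Env.set, hd]
  · cases e
    simp_all [Env.set, Env.get]
  · simp only [hf', Env.get, Code.assignment, List.length_nil]
    omega

/-- Appends the dummy names, as elements of a list, to the output. -/
def emitDummies : StackProg Stk CodeSym :=
  loop (.ctr .rest) (fun _ => false) fun _ =>
    seq (push .out hash) (seq emitDummy (push (.ctr .done) one))

theorem Transduces.emitDummies {B : ℕ} : ∀ (n : ℕ) (e : Env), e.tmp = 0 → e.rest = n →
    e.done + n ≤ B →
    Transduces emitDummies e [] ((List.range' e.done n).flatMap fun j => hash :: dummyText j) []
      { e with rest := 0, done := e.done + n } (n * (5 * B + 8) + 1)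
  | 0, e, _, h, _ => by
    have : e = { e with rest := 0, done := e.done + 0 } := by
      cases e
      simp_all
    exact (Transduces.loopCtr_zero (x := .rest) h).conv rfl rfl this (by omega)
  | n + 1, e, ht, h, hB => by
    have h₂ := Transduces.emitDummies (B := B) n
      ((e.set .rest n).set .done ((e.set .rest n).get .done + 1)) ht rfl
      (by simp [Env.set, Env.get]; omega)
    refine (Transduces.loopCtr_succ (x := .rest) (k := n) h ((Transduces.pushOut hash _).seq
        ((Transduces.emitDummy (e := e.set .rest n) ht).seq (Transduces.inc .done _)))
      h₂).conv ?_ ?_ ?_ ?_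
    · simp
    · simp [Env.set, Env.get, List.range'_succ]
    · simp [Env.set, Env.get]
      omega
    · simp only [Env.set, Nat.add_mul]
      omega

/-- Translates a history. -/
def convertHist : StackProg Stk CodeSym :=
  seq (loop .inp isSep fun _ => seq (emit [hash, one]) copyField)
    (seq emitDummies (seq (drain .done .rest []) (push .out sep)))

theorem Transduces.convertNames : ∀ (l : List ℕ) (e : Env),
    Transduces (loop .inp isSep fun _ => StackProg.seq (StackProg.emit [hash, one]) StackProg.copyField)
      e (Code.list Code.name l) (l.flatMap fun d => hash :: one :: Code.name d) [] e
      (5 * (Code.list Code.name l).length)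
  | [], e => (Transduces.loopInp_done rfl e).mono (by simp [Code.list])
  | d :: l, e => by
    refine (Transduces.loopInp_step (a := hash) (exits := isSep) rfl
      ((Transduces.emit [hash, one] e).seq
        (Transduces.copyField (ne_sep_of_mem_bits (Computability.encodeNat d)) e))
      (Transduces.convertNames l e)).conv ?_ ?_ rfl ?_
    · simp [Code.list, Code.name]
    · simp [Code.name]
    · simp only [Code.list, Code.name, List.flatMap_cons, List.length_append, List.length_cons,
        List.length_map, List.length_nil]
      omega

/-- The code of the translated history. -/
def histText (r : ℕ) (H : List ℕ) : List CodeSym :=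
  (H.flatMap fun d => hash :: one :: Code.name d) ++
    (((List.range (r + 1)).flatMap fun j => hash :: dummyText j) ++ [sep])

/-- The quadratic term pays for the `r + 1` dummies, each of length linear in `B`. -/
theorem Transduces.convertHist {r B : ℕ} (H : List ℕ) {e : Env} (ht : e.tmp = 0)
    (hr : e.rest = r + 1) (hd : e.done = 0) (hB : r + 2 ≤ B) :
    Transduces convertHist e (Code.list Code.name H) (histText r H) [] e
      (20 * B * (Code.list Code.name H).length + 20 * B * B) := by
  have e₂ := Transduces.emitDummies (B := B) (r + 1) e ht hr (by omega)
  have e₃ := Transduces.drain (x := .done) (y := .rest) (by decide) [] _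
    { e with rest := 0, done := e.done + (r + 1) } rfl
  refine ((Transduces.convertNames H e).seq (e₂.seq (e₃.seq (Transduces.pushOut sep _)))).conv
    ?_ ?_ ?_ ?_
  · simp
  · simp [histText, hd, List.range_eq_range']
  · cases e
    simp_all [Env.set, Env.get]
  · simp only [Env.get, hd, List.length_nil]
    have h₁ : (r + 1) * (5 * B + 8) ≤ B * (5 * B + 8) := Nat.mul_le_mul_right _ (by omega)
    have h₂ : B * (5 * B + 8) = 5 * (B * B) + 8 * B := by ring
    have h₃ : 2 * B ≤ B * B := Nat.mul_le_mul_right _ (by omega)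
    have h₄ : 20 * B * B = 20 * (B * B) := by ring
    generalize (Code.list Code.name H).length = x
    have h₅ : 1 * x ≤ B * x := Nat.mul_le_mul_right _ (by omega)
    have h₆ : 20 * B * x = 20 * (B * x) := by ring
    omega

/-! #### The whole program -/

/-- Translates an instance up to the final states. -/
def convertHeader : StackProg Stk CodeSym :=
  seq (readCounter .tags) (seq (readCounter .states) (seq (readCounter .rest)
    (seq (push (.ctr .rest) one) (seq (emitIdx .rest 2 0) (seq copyField (seq convertAssignment
    (loop .inp isSep (push .out))))))))

/-- The program on the rest of an instance. -/
def convertRest (p : StackProg Stk CodeSym) : StackProg Stk CodeSym :=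
  seq convertTrans (seq (push .out sep) (seq copyField (seq convertAssignment
    (seq copyField (seq convertAssignment p)))))

/-- Puts the parts of the result together. -/
def assemble : StackProg Stk CodeSym :=
  seq (move .out .fin) (seq (push .fin sep) (seq (unload .extra zero) (seq (move .buf .fin)
    (seq (push .fin sep) (seq (unload .states one) (seq (push .fin sep) (seq (unload .tags one)
    (clear .rest))))))))

/-- The program that translates instances, where `p` translates what follows after the common part
of the instances. -/
def convert (p : StackProg Stk CodeSym) : StackProg Stk CodeSym :=
  seq convertHeader (seq (move .out .fin) (seq (move .fin .buf) (seq (convertRest p) assemble)))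

/-- The code of the number of registers, the initial state and assignment and the final states. -/
def headerText (a : AutDesc) : List CodeSym :=
  Code.idx (2 * (a.regs + 1)) ++ (Code.idx a.init.val ++ (assignText a.initReg ++ bits a.final))

/-- The code of the rest of the instance. -/
def restText {k : Option ℕ} {X : Storage} {Y : Emptiness} (x : BisimInput k X Y) : List CodeSym :=
  (x.aut.trans.zipIdx.flatMap fun p => transText (x.aut.states + p.2 * (x.aut.regs + 1)) p.1) ++
    (sep :: (Code.idx x.q₁.val ++ (assignText x.ρ₁ ++ (Code.idx x.q₂.val ++ assignText x.ρ₂))))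

/-- The counters after the header has been read. -/
def headerEnv (a : AutDesc) : Env := { tags := a.tags, states := a.states, rest := a.regs + 1 }

/-- The counters after the transitions have been read. -/
def transEnv (a : AutDesc) : Env :=
  { tags := a.tags
    states := a.states + a.trans.length * (a.regs + 1)
    rest := a.regs + 1
    extra := a.trans.length * (a.regs + 1) }

/-- The final-state vector is left unterminated, because the bits for the reset states are missing
and their number is known only after the transitions have been read. For the same reason the number
of states is only counted here and written at the end. -/
theorem Transduces.convertHeader {B : ℕ} (a : AutDesc) (hB : a.regs + 2 ≤ B) :
    Transduces convertHeader {} (Code.idx a.tags ++ (Code.idx a.states ++ (Code.idx a.regs ++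
      (Code.idx a.init.val ++ (Code.assignment a.initReg ++ Code.subset a.final)))))
      (headerText a) [] (headerEnv a)
      (26 * B * (Code.idx a.tags ++ (Code.idx a.states ++ (Code.idx a.regs ++
      (Code.idx a.init.val ++ (Code.assignment a.initReg ++ Code.subset a.final))))).length +
        40 * B) := by
  have e₁ := Transduces.readCounter .tags a.tags {}
  have e₂ := Transduces.readCounter .states a.states (Env.set {} .tags a.tags)
  have e₃ := Transduces.readCounter .rest a.regs { tags := a.tags, states := a.states }
  have e₄ := Transduces.inc .rest { tags := a.tags, states := a.states, rest := a.regs }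
  have e₅ := Transduces.emitIdx (x := .rest) (by decide) 2 0 (e := headerEnv a) rfl
  have e₆ := Transduces.copyIdx a.init.val (headerEnv a)
  have e₇ := Transduces.convertAssignment a.initReg (e := headerEnv a) rfl rfl rfl hB
  have e₈ := Transduces.copyLoop (ne_sep_of_mem_ofFn_bits a.final) (headerEnv a)
  simp only [Env.set, Env.get, Nat.zero_add] at e₁ e₂ e₃ e₄
  refine (e₁.seq (e₂.seq (e₃.seq (e₄.seq (e₅.seq (e₆.seq (e₇.seq e₈))))))).conv ?_ ?_ rfl ?_
  · simp [Code.subset]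
  · simp [headerText, headerEnv, Env.get, bits]
  · simp only [headerEnv, Env.get, List.length_append, Code.idx, Code.subset, List.length_replicate,
      List.length_singleton, List.length_ofFn]
    generalize (Code.assignment a.initReg).length = x
    have h : ∀ y, 2 * y ≤ B * y := fun y => Nat.mul_le_mul_right _ (by omega)
    have := h a.tags
    have := h a.states
    have := h a.regs
    have := h a.init.val
    have := h x
    have : 26 * B * (a.tags + 1 + (a.states + 1 + (a.regs + 1 + (a.init.val + 1 +
      (x + (a.states + 1)))))) = 26 * (B * a.tags) + 52 * (B * a.states) + 26 * (B * a.regs) +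
      26 * (B * a.init.val) + 26 * B * x + 130 * B := by ring
    omega

theorem Transduces.convertRest {k : Option ℕ} {X : Storage} {Y : Emptiness} (x : BisimInput k X Y)
    {p : StackProg Stk CodeSym} {u v : List CodeSym} {m B : ℕ}
    (hp : Transduces p (transEnv x.aut) u v [] (transEnv x.aut) m)
    (hB : x.aut.states + x.aut.trans.length * (x.aut.regs + 1) + 1 ≤ B) (hB' : x.aut.regs + 2 ≤ B)
    (hs : x.aut.tags ≤ B) :
    Transduces (convertRest p) (headerEnv x.aut) (Code.list Code.transition x.aut.trans ++
        (Code.idx x.q₁.val ++ (Code.assignment x.ρ₁ ++ (Code.idx x.q₂.val ++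
          (Code.assignment x.ρ₂ ++ u))))) (restText x ++ v) [] (transEnv x.aut)
      (200 * B * (Code.list Code.transition x.aut.trans ++
        (Code.idx x.q₁.val ++ (Code.assignment x.ρ₁ ++ (Code.idx x.q₂.val ++
          (Code.assignment x.ρ₂ ++ u))))).length + 50 * B + m) := by
  have e₁ := Transduces.convertTrans (B := B) (c := x.aut.states) x.aut.trans 0 (headerEnv x.aut)
    rfl rfl rfl rfl rfl (by simp [headerEnv]) hB hB' hs (by omega)
  have e₂ := Transduces.copyIdx x.q₁.val (transEnv x.aut)
  have e₃ := Transduces.convertAssignment x.ρ₁ (e := transEnv x.aut) rfl rfl rfl hB'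
  have e₄ := Transduces.copyIdx x.q₂.val (transEnv x.aut)
  have e₅ := Transduces.convertAssignment x.ρ₂ (e := transEnv x.aut) rfl rfl rfl hB'
  have he : ({ headerEnv x.aut with
      states := (headerEnv x.aut).states + x.aut.trans.length * (x.aut.regs + 1)
      extra := (headerEnv x.aut).extra + x.aut.trans.length * (x.aut.regs + 1) } : Env) =
      transEnv x.aut := by
    simp [headerEnv, transEnv]
  rw [he] at e₁
  refine (e₁.seq ((Transduces.pushOut sep _).seq (e₂.seq (e₃.seq (e₄.seq (e₅.seq hp)))))).conv
    ?_ ?_ rfl ?_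
  · simp
  · simp [restText]
  · simp only [List.length_append]
    generalize (Code.list Code.transition x.aut.trans).length = y₁
    generalize (Code.assignment x.ρ₁).length = y₂
    generalize (Code.assignment x.ρ₂).length = y₃
    generalize u.length = y₄
    simp only [Code.idx, List.length_append, List.length_replicate, List.length_singleton]
    have h : ∀ y, 2 * y ≤ B * y := fun y => Nat.mul_le_mul_right _ (by omega)
    have h₁ := h x.q₁.val
    have h₂ := h x.q₂.val
    have : 200 * B * (y₁ + (x.q₁.val + 1 + (y₂ + (x.q₂.val + 1 + (y₃ + y₄))))) =
      200 * B * y₁ + 200 * (B * x.q₁.val) + (26 * B * y₂ + 174 * (B * y₂)) + 200 * (B * x.q₂.val) +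
        (26 * B * y₃ + 174 * (B * y₃)) + 200 * (B * y₄) + 400 * B := by ring
    omega

/-- A primitive step pushes at most one symbol. This bounds the length of the produced texts by the
running time already known, and hence the cost of moving them. -/
theorem Runs.length_le {K Γ : Type} [DecidableEq K] {p : StackProg K Γ} {S S' : K → List Γ} {n : ℕ}
    (h : Runs p S S' n) (k : K) : (S' k).length ≤ (S k).length + n := by
  have aux : ∀ (S : K → List Γ) (k' : K) (w : List Γ), w.length ≤ (S k').length →
      (Function.update S k' w k).length ≤ (S k).length := by
    intro S k' w hw
    by_cases hk : k = k'
    · subst hk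
      simpa using hw
    · rw [Function.update_of_ne hk]
  induction h with
  | skip S => omega
  | push k' a S =>
    by_cases hk : k = k'
    · subst hk
      simp
    · rw [Function.update_of_ne hk]
      omega
  | seq _ _ ih₁ ih₂ => omega
  | @pop k' f S S' n _ ih =>
    have := aux S k' (S k').tail (by simp)
    omega
  | loop_nil => omega
  | @loop_exit k' exits body S a w hS ha =>
    have := aux S k' w (by simp [hS])
    omega
  | @loop_step k' exits body S S' S'' a w m n hS ha _ _ ih₁ ih₂ =>
    have := aux S k' w (by simp [hS])
    omega

/-- The code of the translated instance. -/
def resultText {k : Option ℕ} {X : Storage} {Y : Emptiness} (x : BisimInput k X Y) : List CodeSym :=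
  Code.idx x.aut.tags ++ (Code.idx (x.aut.states + x.aut.trans.length * (x.aut.regs + 1)) ++
    (headerText x.aut ++ (List.replicate (x.aut.trans.length * (x.aut.regs + 1)) zero ++
      (sep :: restText x))))

/-- Pushing from the end inserts the non-final bits of the reset states and the total number of
states in front of texts already produced. All counters are cleared on the way, as the halting
configuration requires. -/
theorem runs_assemble {a : AutDesc} (v w : List CodeSym) :
    ∃ n ≤ 2 * v.length + 2 * w.length + 2 * a.tags +
        4 * (a.states + a.trans.length * (a.regs + 1)) + a.regs + 20,
      Runs assemble (stk [] w.reverse v.reverse [] (transEnv a))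
        (stk [] [] [] (Code.idx a.tags ++ (Code.idx (a.states + a.trans.length * (a.regs + 1)) ++
          (v ++ (List.replicate (a.trans.length * (a.regs + 1)) zero ++ (sep :: w))))) {}) n := by
  have e₁ := runs_move_out_fin [] v.reverse (transEnv a) w.reverse []
  have e₂ := runs_push_fin [] [] v.reverse w (transEnv a) sep
  have e₃ := runs_unload [] [] v.reverse .extra zero _ (transEnv a) (sep :: w) rfl
  have e₄ := runs_move_buf_fin [] [] ((transEnv a).set .extra 0) v.reverse
    (List.replicate ((transEnv a).get .extra) zero ++ (sep :: w))
  rw [List.reverse_reverse, List.append_nil] at e₁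
  rw [List.reverse_reverse] at e₄
  have e₅ := runs_push_fin [] [] [] (v ++ (List.replicate ((transEnv a).get .extra) zero ++
    (sep :: w))) ((transEnv a).set .extra 0) sep
  have e₆ := runs_unload [] [] [] .states one _ ((transEnv a).set .extra 0)
    (sep :: (v ++ (List.replicate ((transEnv a).get .extra) zero ++ (sep :: w)))) rfl
  have e₇ := runs_push_fin [] [] [] (List.replicate (((transEnv a).set .extra 0).get .states) one ++
    (sep :: (v ++ (List.replicate ((transEnv a).get .extra) zero ++ (sep :: w)))))
    (((transEnv a).set .extra 0).set .states 0) sep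
  have e₈ := runs_unload [] [] [] .tags one _ (((transEnv a).set .extra 0).set .states 0)
    (sep :: (List.replicate (((transEnv a).set .extra 0).get .states) one ++
    (sep :: (v ++ (List.replicate ((transEnv a).get .extra) zero ++ (sep :: w)))))) rfl
  obtain ⟨n, hn, e₉⟩ := Transduces.clear .rest _ ((((transEnv a).set .extra 0).set .states 0).set .tags 0)
    rfl [] [] [] (List.replicate ((((transEnv a).set .extra 0).set .states 0).get .tags) one ++
    (sep :: (List.replicate (((transEnv a).set .extra 0).get .states) one ++
    (sep :: (v ++ (List.replicate ((transEnv a).get .extra) zero ++ (sep :: w)))))))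
  have h := Runs.seq e₁ (Runs.seq e₂ (Runs.seq e₃ (Runs.seq e₄ (Runs.seq e₅ (Runs.seq e₆
    (Runs.seq e₇ (Runs.seq e₈ e₉)))))))
  refine ⟨_, ?_, Eq.subst (motive := fun S => Runs assemble
    (stk [] w.reverse v.reverse [] (transEnv a)) S _) ?_ h⟩
  · simp only [transEnv, Env.get, Env.set, List.length_reverse] at *
    omega
  · simp [Code.idx, transEnv, Env.get, Env.set]

/-- The header text is moved twice, so that it waits on `buf` in its original orientation while
`out` is used for the rest of the instance. -/
theorem runs_convert {k : Option ℕ} {X : Storage} {Y : Emptiness} (x : BisimInput k X Y)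
    {p : StackProg Stk CodeSym} {u v : List CodeSym} {m B : ℕ}
    (hp : Transduces p (transEnv x.aut) u v [] (transEnv x.aut) m)
    (hB : x.aut.states + x.aut.trans.length * (x.aut.regs + 1) + 1 ≤ B) (hB' : x.aut.regs + 2 ≤ B)
    (hs : x.aut.tags ≤ B) :
    ∃ n ≤ 1000 * B * ((Code.bisimInput x ++ u).length + 1) + 3 * m,
      Runs (convert p) (stk (Code.bisimInput x ++ u) [] [] [] {})
        (stk [] [] [] (resultText x ++ v) {}) n := by
  obtain ⟨n₁, hn₁, e₁⟩ := Transduces.convertHeader x.aut hB'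
    (Code.list Code.transition x.aut.trans ++ (Code.idx x.q₁.val ++ (Code.assignment x.ρ₁ ++
      (Code.idx x.q₂.val ++ (Code.assignment x.ρ₂ ++ u))))) [] [] []
  have e₂ := runs_move_out_fin (Code.list Code.transition x.aut.trans ++ (Code.idx x.q₁.val ++
    (Code.assignment x.ρ₁ ++ (Code.idx x.q₂.val ++ (Code.assignment x.ρ₂ ++ u)))))
    [] (headerEnv x.aut) (headerText x.aut).reverse []
  have e₃ := runs_move_fin_buf (Code.list Code.transition x.aut.trans ++ (Code.idx x.q₁.val ++
    (Code.assignment x.ρ₁ ++ (Code.idx x.q₂.val ++ (Code.assignment x.ρ₂ ++ u)))))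
    [] (headerEnv x.aut) (headerText x.aut) []
  obtain ⟨n₄, hn₄, e₄⟩ := Transduces.convertRest x hp hB hB' hs [] [] (headerText x.aut).reverse []
  obtain ⟨n₅, hn₅, e₅⟩ := runs_assemble (a := x.aut) (headerText x.aut) (restText x ++ v)
  simp only [List.reverse_reverse, List.append_nil, List.reverse_nil, List.nil_append] at e₁ e₂ e₃ e₄
  have l₁ : (headerText x.aut).length ≤ n₁ := by simpa [stk] using e₁.length_le .out
  have l₄ : (restText x ++ v).length ≤ n₄ := by simpa [stk, Nat.add_comm] using e₄.length_le .out
  refine ⟨n₁ + (2 * (headerText x.aut).length + 1 + (2 * (headerText x.aut).length + 1 +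
    (n₄ + n₅))), ?_, ?_⟩
  · have hc : (Code.bisimInput x ++ u).length = (Code.idx x.aut.tags ++ (Code.idx x.aut.states ++
        (Code.idx x.aut.regs ++ (Code.idx x.aut.init.val ++ (Code.assignment x.aut.initReg ++
        Code.subset x.aut.final))))).length + (Code.list Code.transition x.aut.trans ++
        (Code.idx x.q₁.val ++ (Code.assignment x.ρ₁ ++ (Code.idx x.q₂.val ++
        (Code.assignment x.ρ₂ ++ u))))).length := by
      simp only [Code.bisimInput, Code.aut, List.length_append]
      omega
    rw [hc]
    generalize (Code.idx x.aut.tags ++ (Code.idx x.aut.states ++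
        (Code.idx x.aut.regs ++ (Code.idx x.aut.init.val ++ (Code.assignment x.aut.initReg ++
        Code.subset x.aut.final))))).length = y at *
    generalize (Code.list Code.transition x.aut.trans ++
        (Code.idx x.q₁.val ++ (Code.assignment x.ρ₁ ++ (Code.idx x.q₂.val ++
        (Code.assignment x.ρ₂ ++ u))))).length = z at *
    have : 1000 * B * (y + z + 1) = 182 * (B * y) + 818 * (B * y) + 1000 * (B * z) + 1000 * B := by
      ring
    have : 26 * B * y = 26 * (B * y) := by ring
    have : 200 * B * z = 200 * (B * z) := by ring
    have : ∀ y, 0 ≤ B * y := fun y => Nat.zero_le _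
    simp only [List.length_append] at *
    omega
  · have h := Runs.seq e₁ (Runs.seq (by simpa using e₂) (Runs.seq (by simpa using e₃)
      (Runs.seq (by simpa using e₄) (by simpa using e₅))))
    simpa [convert, Code.bisimInput, Code.aut, resultText, List.append_assoc] using h

end StackProg

/-! ### The text of the simulating instance -/

/-- The least significant bit comes first, so the renaming prepends a symbol and a name need not be
stored in order to be translated. -/
theorem Computability.encodeNat_double_add_one (d : ℕ) :
    Computability.encodeNat (2 * d + 1) = true :: Computability.encodeNat d := by
  have h : ((2 * d + 1 : ℕ) : Num) = (d : Num).bit1 := by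
    rw [← Num.bit1_of_bit1]
    push_cast
    ring
  rw [Computability.encodeNat, h, Computability.encodeNat]
  cases (d : Num) <;> rfl

theorem Computability.encodeNat_two_pow (j : ℕ) :
    Computability.encodeNat (2 ^ j) = List.replicate j false ++ [true] := by
  induction j with
  | zero => rfl
  | succ j ih =>
    have h : ((2 ^ (j + 1) : ℕ) : Num) = ((2 ^ j : ℕ) : Num).bit0 := by
      rw [← Num.bit0_of_bit0, pow_succ]
      push_cast
      ring
    rw [Computability.encodeNat] at ih
    rw [Computability.encodeNat, h]
    revert ih
    cases ((2 ^ j : ℕ) : Num) with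
    | zero => simp [Computability.encodeNum]
    | pos p =>
      intro ih
      exact congrArg (false :: ·) ih

theorem List.zipIdx_ofFn_eq {α : Type*} {n : ℕ} (g : Fin n → α) :
    (List.ofFn g).zipIdx = List.ofFn fun i => (g i, i.val) :=
  List.ext_getElem (by simp) (by simp)

theorem List.flatMap_zipIdx_ofFn {α β : Type*} {n : ℕ} (g : Fin n → α) (F : α × ℕ → List β) :
    (List.ofFn g).zipIdx.flatMap F = (List.ofFn fun i => F (g i, i.val)).flatten := by
  rw [List.zipIdx_ofFn_eq, List.flatMap_def, List.map_ofFn]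
  rfl

theorem List.ofFn_ite_eq {α : Type*} {n : ℕ} (j : Fin (n + 1)) (x y : α) :
    (List.ofFn fun i : Fin (n + 1) => if i = j then x else y) =
      List.replicate j.val y ++ x :: List.replicate (n - j.val) y := by
  refine List.ext_getElem (by simp; omega) fun i h₁ h₂ => ?_
  rw [List.getElem_ofFn, List.getElem_append]
  simp only [List.length_replicate, List.getElem_replicate, Fin.ext_iff]
  split_ifs with h₃ h₄ h₄
  · omega
  · simp [h₃]
  · rfl
  · obtain ⟨m, hm⟩ : ∃ m, i - j.val = m + 1 := ⟨i - j.val - 1, by omega⟩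
    simp [hm]

namespace StackProg

open CodeSym Filling

theorem name_double_add_one (d : ℕ) : Code.name (2 * d + 1) = one :: Code.name d := by
  simp [Code.name, Computability.encodeNat_double_add_one]

theorem name_dummy (j : ℕ) : Code.name (dummy j) = dummyText j := by
  simp [Code.name, dummy, Computability.encodeNat_two_pow, dummyText]

/-- Cell `b` of register `j` has number `2 * j + b`, so the two cells of a register are adjacent in
every listing. -/
theorem ofFn_cell {α : Type} {r : ℕ} (f : Fin ((r + 1) * 2) → α) :
    List.ofFn f = (List.ofFn fun j : Fin (r + 1) => [f (cell j 0), f (cell j 1)]).flatten := by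
  rw [List.ofFn_mul]
  refine congrArg (fun g => (List.ofFn g).flatten) (funext fun j => ?_)
  simp only [List.ofFn_succ, List.ofFn_zero, List.cons.injEq, and_true]
  refine ⟨congrArg f (Fin.ext ?_), congrArg f (Fin.ext ?_)⟩ <;>
    simp [cell, finProdFinEquiv_apply_val] <;> omega

theorem assignment_fill_widen {r : ℕ} (ρ : RegAssignment r ℕ) :
    Code.assignment (fill (fun d => 2 * d + 1) (widen ρ)) = assignText ρ := by
  have h : ∀ (j : ℕ) (o : Option ℕ),
      Code.name (o.elim (dummy j) fun d => 2 * d + 1) = contentText j o := by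
    intro j o
    cases o with
    | none => exact name_dummy j
    | some d => exact name_double_add_one d
  rw [Code.assignment, ofFn_cell, List.ofFn_succ', assignText, List.flatMap_zipIdx_ofFn]
  simp [Code.content, h, name_dummy, List.flatMap_def, List.map_flatten, List.flatten_flatten,
    List.map_ofFn, Function.comp_def, contentText]

/-- This covers both bit vectors of a resetting transition: the guard, which lives on the cells of
one register, and the empty set of erased cells. -/
theorem subset_cells {r : ℕ} (S : Finset (Fin ((r + 1) * 2))) (j : Fin (r + 1)) (a b : CodeSym)
    (h : ∀ i, [if cell i 0 ∈ S then one else zero, if cell i 1 ∈ S then one else zero] =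
      if i = j then [a, b] else [zero, zero]) :
    Code.subset S = vecText j.val (r - j.val) a b := by
  rw [Code.subset, ofFn_cell]
  simp only [h]
  rw [List.ofFn_ite_eq]
  simp [vecText]

theorem subset_empty_cells (r : ℕ) :
    Code.subset (∅ : Finset (Fin ((r + 1) * 2))) =
      (List.replicate (r + 1) [zero, zero]).flatten ++ [sep] := by
  rw [Code.subset, ofFn_cell]
  simp [List.replicate_succ]

theorem guard_cellGuard {r : ℕ} (g : Guard r) : Code.guard (cellGuard g) = cellGuardText g := by
  cases g with
  | fresh => rfl
  | exactly X =>
    rw [cellGuard, Code.guard, Code.subset, ofFn_cell, List.ofFn_succ']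
    simp [cell_inj, Fin.castSucc_ne_last, cellGuardText,
      List.flatMap_def, List.map_ofFn, Function.comp_def]

theorem target_cell {r : ℕ} (j : Fin (r + 1)) (b : Fin 2) :
    Code.target (some (cell j b)) = Code.idx (2 * j.val + b.val + 1) := by
  rw [Code.target, cell, finProdFinEquiv_apply_val]
  congr 1
  simp only
  omega

theorem val_stateEquiv_inl {n T r : ℕ} (q : Fin n) : (stateEquiv n T r (Sum.inl q)).val = q.val := by
  simp [stateEquiv]

theorem val_stateEquiv_inr {n T r : ℕ} (t : Fin T) (j : Fin (r + 1)) :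
    (stateEquiv n T r (Sum.inr (t, j))).val = n + t.val * (r + 1) + j.val := by
  simp [stateEquiv, finProdFinEquiv_apply_val]
  ring

theorem transition_storeTrans {n s r T : ℕ} (t : Fin T) (τ : RegTransition (Fin n) (Fin s) r) :
    Code.transition (storeTrans t τ) = Code.idx τ.src.val ++ (Code.idx τ.tag.val ++
      (cellGuardText τ.guard ++ (Code.idx (2 * (storeReg τ.target).val + 1) ++
      ((List.replicate (r + 1) [zero, zero]).flatten ++
        (sep :: Code.idx (n + t.val * (r + 1))))))) := by
  simp [Code.transition, storeTrans, val_stateEquiv_inl, val_stateEquiv_inr, guard_cellGuard,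
    target_cell, subset_empty_cells]

theorem transition_resetTrans {n s r T : ℕ} (t : Fin T) (τ : RegTransition (Fin n) (Fin s) r)
    (j : Fin (r + 1)) (b : Bool) :
    hash :: Code.transition (resetTrans t τ j b) = resetText (n + t.val * (r + 1) + j.val) τ.tag.val
      j.val (r - j.val) (decide (j ∈ emptied τ)) (stateEquiv n T r (nextState t τ j)).val
      (if b then one else zero) := by
  have h₁ : Code.subset (if b then {cell j 0, cell j 1} else {cell j 1}) =
      vecText j.val (r - j.val) (if b then one else zero) one := by
    apply subset_cells
    intro i
    cases b <;> by_cases hi : i = j <;> simp [cell_inj, hi]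
  have h₂ : Code.subset ∅ = vecText j.val (r - j.val) zero zero :=
    subset_cells _ _ _ _ (by simp)
  have h₃ : Code.target (some (cell j (if j ∈ emptied τ then 0 else 1))) =
      Code.idx (2 * j.val + if decide (j ∈ emptied τ) then 1 else 2) := by
    rw [target_cell]
    by_cases h : j ∈ emptied τ <;> simp [h]
  rw [Code.transition]
  simp only [resetTrans, val_stateEquiv_inr, Code.guard, h₁, h₂, h₃, resetText]

theorem simTrans_text {n s r T : ℕ} (t : Fin T) (τ : RegTransition (Fin n) (Fin s) r) :
    (simTrans t τ).flatMap (fun τ' => hash :: Code.transition τ') =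
      transText (n + t.val * (r + 1)) τ := by
  have h : ∀ j, [resetTrans t τ j false, resetTrans t τ j true].flatMap
      (fun τ' => hash :: Code.transition τ') =
      resetTexts (n + t.val * (r + 1) + j.val) τ.tag.val j.val (r - j.val)
        (decide (j ∈ emptied τ)) (stateEquiv n T r (nextState t τ j)).val := by
    intro j
    simp [List.flatMap_cons, transition_resetTrans, resetTexts, -List.cons_append]
  rw [simTrans, List.flatMap_cons, List.flatMap_assoc, transition_storeTrans]
  simp only [h]
  -- Splitting off the last register matches the program, which treats the auxiliary register after
  -- the loop over the erased set.
  rw [List.flatMap_def, ← List.ofFn_eq_map, List.ofFn_succ', transText, eraseText, bits,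
    List.flatMap_zipIdx_ofFn]
  have h' : ∀ i : Fin r, decide (i ∈ τ.erase) =
      decide ((if i ∈ τ.erase then one else zero) = one) := by
    intro i
    by_cases hi : i ∈ τ.erase <;> simp [hi]
  simp [last_mem_emptied, nextState, val_stateEquiv_inl, val_stateEquiv_inr, h', Nat.add_assoc]

theorem allTrans_text {n s r : ℕ} (l : List (RegTransition (Fin n) (Fin s) r)) :
    Code.list Code.transition (allTrans l) =
      (l.zipIdx.flatMap fun p => transText (n + p.2 * (r + 1)) p.1) ++ [sep] := by
  rw [Code.list, allTrans, List.flatMap_assoc]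
  simp only [simTrans_text]
  conv_rhs => rw [← List.ofFn_get l, List.flatMap_zipIdx_ofFn]
  rw [List.flatMap_def, ← List.ofFn_eq_map]

/-- Old states keep their numbers, and all reset states come after them and are not final, so the
vector is only padded with zeros. -/
theorem subset_final {n T r : ℕ} (S : Finset (Fin n)) :
    Code.subset (S.image fun q => stateEquiv n T r (Sum.inl q)) =
      bits S ++ (List.replicate (T * (r + 1)) zero ++ [sep]) := by
  rw [Code.subset, List.ofFn_add, bits, List.append_assoc]
  congr 2
  · funext i
    have : (Fin.castLE (by omega) i : Fin (n + T * (r + 1))) = stateEquiv n T r (Sum.inl i) := rfl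
    simp [this]
  · rw [← List.ofFn_const]
    refine congrArg List.ofFn (funext fun i => ?_)
    have : Fin.natAdd n i = stateEquiv n T r (Sum.inr (finProdFinEquiv.symm i)) := by
      simp [stateEquiv, -finProdFinEquiv_symm_apply]
    simp [this]

theorem bisimInput_input {k : Option ℕ} {X : Storage} {Y : Emptiness} (x : BisimInput k X Y) :
    Code.bisimInput (input x) = resultText x := by
  simp only [Code.bisimInput, Code.aut, input, aut, val_stateEquiv_inl, assignment_fill_widen,
    subset_final, allTrans_text, resultText, headerText, restText, Nat.mul_comm _ 2]
  simp

theorem list_histList (r : ℕ) (H : List ℕ) :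
    Code.list Code.name (histList r H) = histText r H := by
  simp [Code.list, histList, histText, List.flatMap_append, List.flatMap_map, name_double_add_one,
    name_dummy]

/-- Tags, states and registers are written in unary and every transition contributes to the code, so
all these numbers are at most the code length. Only the number of reset states is a product, whence
the square. -/
theorem counters_le {k : Option ℕ} {X : Storage} {Y : Emptiness} (x : BisimInput k X Y) {N : ℕ}
    (hN : (Code.bisimInput x).length ≤ N) :
    x.aut.states + x.aut.trans.length * (x.aut.regs + 1) + 1 ≤ (N + 2) ^ 2 ∧
      x.aut.regs + 2 ≤ (N + 2) ^ 2 ∧ x.aut.tags ≤ (N + 2) ^ 2 := by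
  have hT : ∀ l : List (RegTransition (Fin x.aut.states) (Fin x.aut.tags) x.aut.regs),
      l.length ≤ (Code.list Code.transition l).length := by
    intro l
    induction l with
    | nil => exact Nat.zero_le _
    | cons τ l ih =>
      simp only [Code.list, List.flatMap_cons, List.length_append, List.length_cons] at ih ⊢
      omega
  have hT := hT x.aut.trans
  simp only [Code.bisimInput, Code.aut, Code.idx, List.length_append, List.length_replicate,
    List.length_singleton] at hN
  have h : x.aut.trans.length * (x.aut.regs + 1) ≤ N * N :=
    Nat.mul_le_mul (by omega) (by omega)
  have h' : (N + 2) ^ 2 = N * N + 4 * N + 4 := by ring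
  rw [h']
  refine ⟨?_, ?_, ?_⟩ <;> omega

end StackProg

/-! ### The reductions from `S#` to `MF`, and the theorem. -/

open Polynomial in
theorem raBisim_single_reducesTo_multiple (k : Option ℕ) :
    (raBisim k .S .E).ReducesTo (raBisim k .M .F) := by
  refine ⟨Filling.raInput, ?_, Filling.yes_raInput⟩
  -- An instance for RA ends with the common part, so nothing is left to translate after it.
  refine StackProg.computableInPolyTime_of_runs_stk (StackProg.convert StackProg.skip)
    (1000 * (X + 2) ^ 2 * (X + 1)) fun x => ?_
  obtain ⟨h₁, h₂, h₃⟩ := StackProg.counters_le x.toBisimInput le_rfl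
  obtain ⟨n, hn, h⟩ := StackProg.runs_convert x.toBisimInput
    (StackProg.Transduces.skip _) h₁ h₂ h₃
  rw [List.append_nil, List.append_nil, ← StackProg.bisimInput_input] at h
  refine ⟨n, hn.trans (le_of_eq ?_), h⟩
  simp only [eval_add, eval_mul, eval_pow, eval_X, eval_ofNat, eval_one, List.append_nil]
  rfl

open Polynomial in
theorem fraBisim_single_reducesTo_multiple (k : Option ℕ) :
    (fraBisim k .S .E).ReducesTo (fraBisim k .M .F) := by
  refine ⟨Filling.fraInput, ?_, Filling.yes_fraInput⟩
  refine StackProg.computableInPolyTime_of_runs_stk (StackProg.convert StackProg.convertHist)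
    (1000 * (X + 2) ^ 2 * (X + 1) +
      3 * (20 * (X + 2) ^ 2 * X + 20 * (X + 2) ^ 2 * (X + 2) ^ 2)) fun x => ?_
  have hl : (Code.fraInput x).length =
      (Code.bisimInput x.toBisimInput).length + (Code.list Code.name x.hist).length :=
    List.length_append
  obtain ⟨h₁, h₂, h₃⟩ := StackProg.counters_le x.toBisimInput
    (N := (Code.fraInput x).length) (by omega)
  obtain ⟨n, hn, h⟩ := StackProg.runs_convert x.toBisimInput
    (StackProg.Transduces.convertHist (r := x.aut.regs) x.hist rfl rfl rfl h₂) h₁ h₂ h₃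
  rw [← StackProg.bisimInput_input, ← StackProg.list_histList] at h
  refine ⟨n, hn.trans ?_, h⟩
  simp only [eval_add, eval_mul, eval_pow, eval_X, eval_ofNat, eval_one]
  refine Nat.add_le_add le_rfl (Nat.mul_le_mul_left _ (Nat.add_le_add ?_ le_rfl))
  exact Nat.mul_le_mul_left _ (hl.symm ▸ Nat.le_add_left _ _ :
    (Code.list Code.name x.hist).length ≤ (Code.fraInput x).length)

theorem mainTheorem11 (k : Option ℕ) :
    (∀ (X : Storage) (Y : Emptiness), (raBisim k X Y).ReducesTo (fraBisim k X Y)) ∧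
    ((raBisim k .S .F).ReducesTo (raBisim k .S .E0) ∧
      (raBisim k .S .E0).ReducesTo (raBisim k .S .E) ∧
      (raBisim k .S .E).ReducesTo (raBisim k .M .F) ∧
      (raBisim k .M .F).ReducesTo (raBisim k .M .E0) ∧
      (raBisim k .M .E0).ReducesTo (raBisim k .M .E)) ∧
    ((fraBisim k .S .F).ReducesTo (fraBisim k .S .E0) ∧
      (fraBisim k .S .E0).ReducesTo (fraBisim k .S .E) ∧
      (fraBisim k .S .E).ReducesTo (fraBisim k .M .F) ∧
      (fraBisim k .M .F).ReducesTo (fraBisim k .M .E0) ∧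
      (fraBisim k .M .E0).ReducesTo (fraBisim k .M .E)) :=
  ⟨raBisim_reducesTo_fraBisim k,
    ⟨raBisim_reducesTo_relax k _ (.inl ⟨rfl, rfl⟩), raBisim_reducesTo_relax k _ (.inr ⟨rfl, rfl⟩),
      raBisim_single_reducesTo_multiple k,
      raBisim_reducesTo_relax k _ (.inl ⟨rfl, rfl⟩), raBisim_reducesTo_relax k _ (.inr ⟨rfl, rfl⟩)⟩,
    ⟨fraBisim_reducesTo_relax k _ (.inl ⟨rfl, rfl⟩), fraBisim_reducesTo_relax k _ (.inr ⟨rfl, rfl⟩),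
      fraBisim_single_reducesTo_multiple k,
      fraBisim_reducesTo_relax k _ (.inl ⟨rfl, rfl⟩),
      fraBisim_reducesTo_relax k _ (.inr ⟨rfl, rfl⟩)⟩⟩
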